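/- Let $1\le\nu\le n-3$ and $c\neq-1$, and let $i\colon\mathbb{Q}_c^{n-\nu}\to\mathbb{H}^n$ be the inclusion of a complete simply connected umbilical submanifold of dimension $n-\nu$ and constant sectional curvature $c$ of the hyperbolic space $\mathbb{H}^n$ of curvature $-1$. Let $g\colon L^2\to\mathbb{Q}_c^{n-\nu}$ be a minimal isometric immersion of a (non-empty) two-dimensional Riemannian manifold. Let $N_i\mathbb{Q}_c^{n-\nu}$ be the normal bundle of $i$, regarded as a vector bundle over $L^2$ (its fiber at $x\in L^2$ is the normal space of $i$ at $g(x)$), and let $$G\colon N_i\mathbb{Q}_c^{n-\nu}\to\mathbb{H}^n,\qquad G(x,w)=\exp_{g(x)}w,$$ where $\exp$ is the exponential map of $\mathbb{H}^n$. Let $M^m$, $m=2+\nu$, be the set of the points of the total space $N_i\mathbb{Q}_c^{n-\nu}$ at which $G$ is an immersion, with the metric induced by $G$; the generalized cone over $g$ is $F_g=G|_{M^m}\colon M^m\to\mathbb{H}^n$. Then the normal bundle of $i$ has a global smooth orthonormal frame, so that the total space is diffeomorphic to $L^2\times\mathbb{R}^\nu$; the map $G$ is smooth, the set $M^m$ is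 open, and the following hold. (i) $F_g$ is a minimal immersion whose index of relative nullity is at least $\nu$ at every point; that is, at every point of $M^m$ the tangent vectors $X$ with $\alpha(X,Y)=0$ for all tangent vectors $Y$, where $\alpha$ is the second fundamental form of $F_g$, form a space of dimension at least $\nu$. (ii) $G$ is an immersion on the whole of $N_i\mathbb{Q}_c^{n-\nu}$ if and only if $\mathbb{Q}_c^{n-\nu}$ is a totally geodesic submanifold of an equidistant hypersurface (a hypersurface at constant signed distance $d\ne0$ from a totally geodesic hyperplane) or of a horosphere of $\mathbb{H}^n$. In that case $M^m$ is complete if and only if $L^2$ is complete. Moreover, if $\mathbb{Q}_c^{n-\nu}$ is a totally geodesic submanifold of an equidistant hypersurface, then the scalar curvature of $M^m$ is bounded along each fiber of the normal bundle. If $\mathbb{Q}_c^{n-\nu}$ is a totally geodesic submanifold of a horosphere, then the scalar curvature of $M^m$ is unbounded along the fiber over each point $x\in L^2$ at which the second fundamental form of $g$ does not vanish. -/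

import Mathlib

open scoped Manifold ContDiff ENNReal Topology

noncomputable section

namespace HypCone

/-! ### Hyperbolic space in the hyperboloid model -/

/-- The vector space `ℝ × ℝⁿ` underlying Lorentz space of dimension `n + 1`. -/
abbrev LorentzSpace (n : ℕ) : Type := ℝ × EuclideanSpace ℝ (Fin n)

/-- The Lorentz product `⟨(a, x), (b, y)⟩ = -a b + x ⬝ y`. -/
def lor {n : ℕ} (p q : LorentzSpace n) : ℝ := inner ℝ p.2 q.2 - p.1 * q.1

/-- The length of a (spacelike) vector. -/
def lnorm {n : ℕ} (w : LorentzSpace n) : ℝ := Real.sqrt (lor w w)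

/-- Hyperbolic space of curvature `-1`; its tangent space at `p` is the Lorentz orthogonal
complement of `p`, with the (positive definite) restriction of the Lorentz product. -/
def hyperbolicSpace (n : ℕ) : Set (LorentzSpace n) := {p | lor p p = -1 ∧ 0 < p.1}

/-- The exponential map of hyperbolic space: `exp_p w` is the value at time `1` of the geodesic
`t ↦ cosh (t |w|) p + sinh (t |w|) w / |w|` that starts at `p` with velocity `w`
(for `w = 0` the value is `p`). -/
def hexp {n : ℕ} (p w : LorentzSpace n) : LorentzSpace n :=
  Real.cosh (lnorm w) • p + (Real.sinh (lnorm w) / lnorm w) • w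

/-- The section `{p ∈ ℍⁿ | ⟨p, a⟩ = τ}` of hyperbolic space by an affine hyperplane. -/
def hypersurface {n : ℕ} (a : LorentzSpace n) (τ : ℝ) : Set (LorentzSpace n) :=
  {p | p ∈ hyperbolicSpace n ∧ lor p a = τ}

/-- For `a` unit spacelike, the signed distance `d` of `p` to the totally geodesic hyperplane
`a^⊥ ∩ ℍⁿ` satisfies `sinh d = ⟨p, a⟩`; so for `τ ≠ 0` the section `hypersurface a τ` is an
equidistant hypersurface, and all of them arise in this way. -/
def IsEquidistantData {n : ℕ} (a : LorentzSpace n) (τ : ℝ) : Prop := lor a a = 1 ∧ τ ≠ 0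

/-- For `a` a future-directed null vector, `hypersurface a (-1)` is a horosphere, and all
horospheres arise in this way. -/
def IsHorosphereData {n : ℕ} (a : LorentzSpace n) (τ : ℝ) : Prop :=
  lor a a = 0 ∧ 0 < a.1 ∧ τ = -1

/-! ### Intrinsic curvature of a Riemannian metric in coordinates

`b` is a basis of the coordinate space `V`, and `g y` is the matrix of the metric at `y` in the
coordinate frame given by `b`. -/

section Intrinsic

variable {V : Type*} [NormedAddCommGroup V] [NormedSpace ℝ V] {ι : Type*} [Fintype ι]
  [DecidableEq ι]

/-- The partial derivative `∂ᵢ φ`. -/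
def pderiv {W : Type*} [NormedAddCommGroup W] [NormedSpace ℝ W]
    (b : Module.Basis ι ℝ V) (i : ι) (φ : V → W) (y : V) : W := fderiv ℝ φ y (b i)

/-- The Christoffel symbols
`Γ^k_{ij} = 1/2 ∑ₗ g^{kl} (∂ᵢ g_{jl} + ∂ⱼ g_{il} - ∂ₗ g_{ij})`. -/
def christoffel (b : Module.Basis ι ℝ V) (g : V → Matrix ι ι ℝ) (y : V) (k i j : ι) : ℝ :=
  (1 / 2 : ℝ) * ∑ l, (g y)⁻¹ k l *
    (pderiv b i (fun z => g z j l) y + pderiv b j (fun z => g z i l) y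
      - pderiv b l (fun z => g z i j) y)

/-- The components `R^l_{ijk}` of the curvature tensor, `R(∂ᵢ, ∂ⱼ)∂ₖ = ∑ₗ R^l_{ijk} ∂ₗ`, where
`R(X, Y) = ∇_X ∇_Y - ∇_Y ∇_X - ∇_{[X, Y]}`. -/
def riemann (b : Module.Basis ι ℝ V) (g : V → Matrix ι ι ℝ) (y : V) (l i j k : ι) : ℝ :=
  pderiv b i (fun z => christoffel b g z l j k) y
    - pderiv b j (fun z => christoffel b g z l i k) y
    + ∑ p, (christoffel b g y l i p * christoffel b g y p j k
      - christoffel b g y l j p * christoffel b g y p i k)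

/-- The scalar curvature `∑ g^{jk} Ric_{jk}`, with `Ric_{jk} = ∑ᵢ R^i_{ijk}`. -/
def scalarCurvature (b : Module.Basis ι ℝ V) (g : V → Matrix ι ι ℝ) (y : V) : ℝ :=
  ∑ j, ∑ k, (g y)⁻¹ j k * ∑ i, riemann b g y i i j k

/-- Constant sectional curvature `c` at `y`: `R(X, Y)Z = c (⟨Y, Z⟩ X - ⟨X, Z⟩ Y)`. -/
def HasCurvature (b : Module.Basis ι ℝ V) (g : V → Matrix ι ι ℝ) (y : V) (c : ℝ) : Prop :=
  ∀ l i j k, riemann b g y l i j k =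
    c * (g y j k * (if l = i then 1 else 0) - g y i k * (if l = j then 1 else 0))

/-- The matrix of the metric induced by a map `f` into Lorentz space. -/
def inducedMetric {n : ℕ} (b : Module.Basis ι ℝ V) (f : V → LorentzSpace n) (y : V) :
    Matrix ι ι ℝ :=
  Matrix.of fun i j => lor (pderiv b i f y) (pderiv b j f y)

/-- The component `α(∂ᵢ, ∂ⱼ)` of the second fundamental form of an immersion `f` into hyperbolic
space, by the Gauss formula: the derivative `∂ᵢ∂ⱼ f - g_{ij} f` of the field `f_* ∂ⱼ` along `∂ᵢ`
with respect to the connection of hyperbolic space, minus its tangential part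
`f_* ∇_{∂ᵢ} ∂ⱼ = ∑ₖ Γ^k_{ij} ∂ₖ f`. -/
def secondFFCoord {n : ℕ} (b : Module.Basis ι ℝ V) (f : V → LorentzSpace n) (y : V)
    (i j : ι) : LorentzSpace n :=
  pderiv b i (pderiv b j f) y - inducedMetric b f y i j • f y
    - ∑ k, christoffel b (inducedMetric b f) y k i j • pderiv b k f y

end Intrinsic

/-! ### Immersed submanifolds of hyperbolic space

`P` is a manifold modelled on `V` and `F : P → ℝ × ℝⁿ` a map with values in hyperbolic space;
`P` carries the metric induced by `F`. At a point `z` all tensors are evaluated in the preferred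
chart at `z`, which is also the chart that Mathlib uses to identify the tangent space at `z`
with `V`. -/

section Immersed

variable {n : ℕ} {V : Type*} [NormedAddCommGroup V] [NormedSpace ℝ V] [FiniteDimensional ℝ V]
  {H : Type*} [TopologicalSpace H] (I : ModelWithCorners ℝ V H)
  {P : Type*} [TopologicalSpace P] [ChartedSpace H P]

/-- `F` is an immersion at `z`: its differential at `z` is injective. -/
def IsImmersionAt (F : P → LorentzSpace n) (z : P) : Prop :=
  Function.Injective (mfderiv I 𝓘(ℝ, LorentzSpace n) F z)

/-- `F` in the preferred chart at `z`. -/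
def rep (F : P → LorentzSpace n) (z : P) : V → LorentzSpace n := F ∘ (extChartAt I z).symm

/-- The second fundamental form of `F` at `z`, as a bilinear map on the tangent space. -/
def secondFF (F : P → LorentzSpace n) (z : P) :
    TangentSpace I z →ₗ[ℝ] TangentSpace I z →ₗ[ℝ] LorentzSpace n :=
  let b : Module.Basis _ ℝ V := Module.finBasis ℝ V
  b.constr ℝ fun i => b.constr ℝ fun j =>
    secondFFCoord b (rep I F z) (extChartAt I z z) i j

/-- The metric on the tangent space at `z` induced by `F`. -/
def metricAt (F : P → LorentzSpace n) (z : P) (X Y : TangentSpace I z) : ℝ :=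
  lor (mfderiv I 𝓘(ℝ, LorentzSpace n) F z X : LorentzSpace n)
    (mfderiv I 𝓘(ℝ, LorentzSpace n) F z Y : LorentzSpace n)

/-- The (unnormalized) mean curvature vector `∑ g^{ij} α(∂ᵢ, ∂ⱼ)` of `F` at `z`. -/
def meanCurvature (F : P → LorentzSpace n) (z : P) : LorentzSpace n :=
  let b : Module.Basis _ ℝ V := Module.finBasis ℝ V
  let y := extChartAt I z z
  ∑ i, ∑ j, (inducedMetric b (rep I F z) y)⁻¹ i j • secondFFCoord b (rep I F z) y i j

/-- The index of relative nullity of `F` at `z`: the dimension of the space of the tangent vectors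
`X` with `α(X, Y) = 0` for all tangent vectors `Y`. -/
def relativeNullity (F : P → LorentzSpace n) (z : P) : ℕ :=
  Module.finrank ℝ (LinearMap.ker (secondFF I F z))

/-- The scalar curvature at `z` of the metric induced by `F`. -/
def scalAt (F : P → LorentzSpace n) (z : P) : ℝ :=
  scalarCurvature (Module.finBasis ℝ V) (inducedMetric (Module.finBasis ℝ V) (rep I F z))
    (extChartAt I z z)

/-- The metric induced by `F` has constant sectional curvature `c`. -/
def HasConstantCurvature (F : P → LorentzSpace n) (c : ℝ) : Prop :=
  ∀ z, HasCurvature (Module.finBasis ℝ V) (inducedMetric (Module.finBasis ℝ V) (rep I F z))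
    (extChartAt I z z) c

/-- The length, in the metric induced by `F`, of a curve `γ : [0, 1] → P`. -/
def curveLength (F : P → LorentzSpace n) (γ : ℝ → P) : ℝ≥0∞ :=
  ∫⁻ s in Set.Icc (0 : ℝ) 1, ENNReal.ofReal (lnorm (derivWithin (F ∘ γ) (Set.Icc 0 1) s))

/-- The Riemannian distance of the metric induced by `F`. -/
def inducedEDist (F : P → LorentzSpace n) (x y : P) : ℝ≥0∞ :=
  ⨅ (γ : ℝ → P) (_ : γ 0 = x ∧ γ 1 = y ∧ ContMDiffOn 𝓘(ℝ, ℝ) I 1 γ (Set.Icc 0 1)),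
    curveLength F γ

/-- The metric induced by `F` is complete: every Cauchy sequence converges. -/
def IsCompleteInduced (F : P → LorentzSpace n) : Prop :=
  ∀ u : ℕ → P,
    (∀ ε : ℝ≥0∞, 0 < ε → ∃ K, ∀ k ≥ K, ∀ l ≥ K, inducedEDist I F (u k) (u l) < ε) →
    ∃ z, Filter.Tendsto u Filter.atTop (𝓝 z)

/-- `F` has values in the hypersurface `{p ∈ ℍⁿ | ⟨p, a⟩ = τ}` and is totally geodesic there: the
second fundamental form of `F` in this hypersurface, which is the component of `α` tangent to the
hypersurface, vanishes. -/
def IsTotallyGeodesicIn (F : P → LorentzSpace n) (a : LorentzSpace n) (τ : ℝ) : Prop :=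
  ∀ z, F z ∈ hypersurface a τ ∧ ∀ (X Y : TangentSpace I z) (ξ : LorentzSpace n),
    lor ξ (F z) = 0 → lor ξ a = 0 → lor (secondFF I F z X Y) ξ = 0

end Immersed

/-! ### Umbilical submanifolds, surfaces in them, and generalized cones -/

section Cone

variable {n : ℕ} (k : ℕ) {N : Type*} [TopologicalSpace N] [ChartedSpace (EuclideanSpace ℝ (Fin k)) N]
  {L : Type*} [TopologicalSpace L] [ChartedSpace (EuclideanSpace ℝ (Fin 2)) L]

/-- `i : N → ℍⁿ` is the inclusion of a complete umbilical submanifold of constant sectional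
curvature `c` (`N` carries the induced metric). -/
structure IsUmbilicalInclusion (i : N → LorentzSpace n) (c : ℝ) : Prop where
  smooth : ContMDiff (𝓡 k) 𝓘(ℝ, LorentzSpace n) ∞ i
  mem : ∀ q, i q ∈ hyperbolicSpace n
  immersion : ∀ q, IsImmersionAt (𝓡 k) i q
  embedding : Topology.IsEmbedding i
  complete : IsCompleteInduced (𝓡 k) i
  curvature : HasConstantCurvature (𝓡 k) i c
  umbilical : ∀ q, ∃ η : LorentzSpace n, ∀ X Y : TangentSpace (𝓡 k) q,
    secondFF (𝓡 k) i q X Y = metricAt (𝓡 k) i q X Y • η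

/-- The tangent space `i_* T_q N`. -/
def tangentImage (i : N → LorentzSpace n) (q : N) : Set (LorentzSpace n) :=
  Set.range fun X : TangentSpace (𝓡 k) q =>
    (mfderiv (𝓡 k) 𝓘(ℝ, LorentzSpace n) i q X : LorentzSpace n)

/-- The normal space at `q` of `i : N → ℍⁿ`. -/
def normalSpace (i : N → LorentzSpace n) (q : N) : Set (LorentzSpace n) :=
  {w | lor w (i q) = 0 ∧ ∀ v ∈ tangentImage k i q, lor w v = 0}

/-- `g : L → N` is a minimal immersion into `N`: its mean curvature vector in `N`, which is the
component tangent to `N` of the mean curvature vector of `i ∘ g`, vanishes. -/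
structure IsMinimalSurface (i : N → LorentzSpace n) (g : L → N) : Prop where
  smooth : ContMDiff (𝓡 2) (𝓡 k) ∞ g
  immersion : ∀ x, Function.Injective (mfderiv (𝓡 2) (𝓡 k) g x)
  minimal : ∀ x, ∀ v ∈ tangentImage k i (g x), lor (meanCurvature (𝓡 2) (i ∘ g) x) v = 0

/-- The second fundamental form of `g : L → N`, which is the component tangent to `N` of that of
`i ∘ g`, vanishes at `x`. -/
def IsTotallyGeodesicAt (i : N → LorentzSpace n) (g : L → N) (x : L) : Prop :=
  ∀ X Y : TangentSpace (𝓡 2) x, ∀ v ∈ tangentImage k i (g x),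
    lor (secondFF (𝓡 2) (i ∘ g) x X Y) v = 0

/-- The total space `{(x, w) | x ∈ L, w ∈ N_{g x} N}` of the normal bundle of `i`, over `L`. -/
def NormalBundle (i : N → LorentzSpace n) (g : L → N) : Type _ :=
  {z : L × LorentzSpace n // z.2 ∈ normalSpace k i (g z.1)}

/-- The map `G (x, w) = exp_{g x} w` on the normal bundle. -/
def coneMap (i : N → LorentzSpace n) (g : L → N) (z : NormalBundle k i g) : LorentzSpace n :=
  hexp (i (g z.1.1)) z.1.2

/-- A global smooth orthonormal frame `η₁, …, η_ν` of the normal bundle of `i`. -/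
structure NormalFrame (i : N → LorentzSpace n) (ν : ℕ) where
  vec : Fin ν → N → LorentzSpace n
  smooth : ∀ j, ContMDiff (𝓡 k) 𝓘(ℝ, LorentzSpace n) ∞ (vec j)
  normal : ∀ j q, vec j q ∈ normalSpace k i q
  orthonormal : ∀ j l q, lor (vec j q) (vec l q) = if j = l then 1 else 0

variable {k}

theorem lor_sum_smul_left {ν : ℕ} (t : Fin ν → ℝ) (e : Fin ν → LorentzSpace n)
    (v : LorentzSpace n) : lor (∑ j, t j • e j) v = ∑ j, t j * lor (e j) v := by
  simp only [lor, Prod.snd_sum, Prod.fst_sum, Prod.smul_snd, Prod.smul_fst, sum_inner,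
    real_inner_smul_left, Finset.sum_mul, smul_eq_mul, ← Finset.sum_sub_distrib]
  exact Finset.sum_congr rfl fun j _ => by ring

/-- The trivialization `(x, t) ↦ (x, ∑ⱼ tⱼ ηⱼ(g x))` of the normal bundle by a frame. It is the
diffeomorphism through which the smooth structure of the total space is read on `L × ℝ^ν`. -/
def NormalFrame.triv {i : N → LorentzSpace n} {ν : ℕ} (η : NormalFrame k i ν) (g : L → N)
    (z : L × EuclideanSpace ℝ (Fin ν)) : NormalBundle k i g :=
  ⟨(z.1, ∑ j, z.2 j • η.vec j (g z.1)), by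
    refine ⟨?_, fun v hv => ?_⟩
    · rw [lor_sum_smul_left]
      exact Finset.sum_eq_zero fun j _ => by rw [(η.normal j (g z.1)).1, mul_zero]
    · rw [lor_sum_smul_left]
      exact Finset.sum_eq_zero fun j _ => by rw [(η.normal j (g z.1)).2 v hv, mul_zero]⟩

/-- The map `G` read in the trivialization given by a frame. -/
def NormalFrame.cone {i : N → LorentzSpace n} {ν : ℕ} (η : NormalFrame k i ν) (g : L → N) :
    L × EuclideanSpace ℝ (Fin ν) → LorentzSpace n :=
  fun z => coneMap k i g (η.triv g z)

/-- The set `M` of the points of the normal bundle at which `G` is an immersion. -/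
def NormalFrame.domain {i : N → LorentzSpace n} {ν : ℕ} (η : NormalFrame k i ν) (g : L → N) :
    Set (L × EuclideanSpace ℝ (Fin ν)) :=
  {z | IsImmersionAt ((𝓡 2).prod (𝓡 ν)) (η.cone g) z}

end Cone

end HypCone

end

/-! Put h = 1 + c. The Gauss equation shows that the mean curvature vector η of the umbilical
submanifold satisfies ⟨η, η⟩ = h; normal vectors are spacelike, so c ≠ -1 gives h > 0. A Codazzi
argument, which needs dimension at least two, shows that ξ = η + h i is a constant vector of Lorentz
space (`IsUmbilicalOn.hasFDerivAt_zero`). A constant vector orthogonal to ξ that is normal at one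
point is normal everywhere, by uniqueness for a linear differential system
(`IsUmbilicalOn.perp_of_perp`). Hence there are constants C_j, lam_j such that the vectors C_j -
lam_j i form an orthonormal normal frame, η = ∑ lam_j (C_j - lam_j i) and ∑ lam_j² = h
(`IsUmbilicalInclusion.exists_parallelFrame`).

Let B_l be the components of G in this frame. Then G = ρ (i ∘ g) + ∑ B_l C_l with ρ = cosh |w| - ∑
lam_l B_l. As the C_l are constant, dG is ρ d(i ∘ g) in the directions of L, up to terms in the span
of i ∘ g and the frame. So G is an immersion exactly where ρ ≠ 0 (`IsConeData.injective_iff`), and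
its second fundamental form is ρ times that of g, with the fiber directions in the nullity
(`IsConeData.sff_coneOf`). Taking the trace gives minimality. The Gauss equation gives the scalar
curvature -(m² - m) - K / ρ², where K, the squared norm of the second fundamental form of g, is
constant on each fiber.

The rest of (ii) depends on ρ = cosh |w| - (sinh |w| / |w|) ⟨w, η⟩. As |η| = √h, its minimum on the
sphere |w| = r is cosh r - √h sinh r. This vanishes for some r exactly when h > 1; it is at least 1
- √h when h < 1, and it is e^{-r} when h = 1. Extrinsically ⟨ξ, i⟩ = -h and ⟨ξ, ξ⟩ = h - h², so ξ
defines an equidistant hypersurface through the submanifold when h < 1 and a horosphere when h = 1.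
Conversely `sum_sq_mul_eq` recovers h from such a hypersurface.

For completeness, the speed of a curve in the cone controls ρ times the speed of its projection, the
derivatives of the B_l and that of log cosh |w| (`curve_estimates`). Along the tail of a Cauchy
sequence cosh |w| is therefore bounded, ρ ≥ 1 / (2 cosh |w|) is bounded below, and the base points
and the B_l are Cauchy. Conversely the zero section is an isometric copy of L. -/

noncomputable section

namespace HypCone

/-! ### The Lorentz product -/

section Lorentz

variable {n : ℕ}

theorem lor_comm (p q : LorentzSpace n) : lor p q = lor q p := by
  simp only [lor, real_inner_comm, mul_comm]

theorem lor_add_left (p q r : LorentzSpace n) : lor (p + q) r = lor p r + lor q r := by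
  simp only [lor, Prod.snd_add, Prod.fst_add, inner_add_left]; ring

theorem lor_smul_left (a : ℝ) (p q : LorentzSpace n) : lor (a • p) q = a * lor p q := by
  simp only [lor, Prod.smul_snd, Prod.smul_fst, real_inner_smul_left, smul_eq_mul]; ring

theorem lor_add_right (p q r : LorentzSpace n) : lor p (q + r) = lor p q + lor p r := by
  simp only [lor_comm p, lor_add_left]

theorem lor_smul_right (a : ℝ) (p q : LorentzSpace n) : lor p (a • q) = a * lor p q := by
  simp only [lor_comm p, lor_smul_left]

theorem lor_zero_left (p : LorentzSpace n) : lor 0 p = 0 := by simp [lor]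

theorem lor_zero_right (p : LorentzSpace n) : lor p 0 = 0 := by simp [lor]

theorem lor_neg_left (p q : LorentzSpace n) : lor (-p) q = -lor p q := by
  simp only [lor, Prod.snd_neg, Prod.fst_neg, inner_neg_left]; ring

theorem lor_sub_left (p q r : LorentzSpace n) : lor (p - q) r = lor p r - lor q r := by
  rw [sub_eq_add_neg, lor_add_left, lor_neg_left, sub_eq_add_neg]

theorem lor_sub_right (p q r : LorentzSpace n) : lor p (q - r) = lor p q - lor p r := by
  simp only [lor_comm p, lor_sub_left]

theorem lor_sum_left {κ : Type*} (s : Finset κ) (e : κ → LorentzSpace n) (v : LorentzSpace n) :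
    lor (∑ j ∈ s, e j) v = ∑ j ∈ s, lor (e j) v := by
  classical
  induction s using Finset.induction_on with
  | empty => simp [lor_zero_left]
  | insert a s ha ih => rw [Finset.sum_insert ha, Finset.sum_insert ha, lor_add_left, ih]

theorem lor_sum_right {κ : Type*} (s : Finset κ) (e : κ → LorentzSpace n) (v : LorentzSpace n) :
    lor v (∑ j ∈ s, e j) = ∑ j ∈ s, lor v (e j) := by
  simp only [lor_comm v, lor_sum_left]

/-- The Lorentz product as a continuous bilinear map. -/
def lorL (n : ℕ) : LorentzSpace n →L[ℝ] LorentzSpace n →L[ℝ] ℝ :=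
  (innerSL ℝ).bilinearComp (ContinuousLinearMap.snd ℝ ℝ (EuclideanSpace ℝ (Fin n)))
      (ContinuousLinearMap.snd ℝ ℝ (EuclideanSpace ℝ (Fin n))) -
    (ContinuousLinearMap.mul ℝ ℝ).bilinearComp (ContinuousLinearMap.fst ℝ ℝ _)
      (ContinuousLinearMap.fst ℝ ℝ _)

theorem lorL_apply (p q : LorentzSpace n) : lorL n p q = lor p q := rfl

/-- The Lorentz product as a bilinear form. -/
def lorForm (n : ℕ) : LinearMap.BilinForm ℝ (LorentzSpace n) :=
  LinearMap.mk₂ ℝ lor lor_add_left lor_smul_left lor_add_right lor_smul_right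

theorem lor_eq_zero_of_forall {p : LorentzSpace n} (h : ∀ q, lor p q = 0) : p = 0 := by
  -- Reversing the time coordinate turns the Lorentz product into the Euclidean square norm.
  have h1 := h (-p.1, p.2)
  simp only [lor, real_inner_self_eq_norm_sq] at h1
  have h2 : ‖p.2‖ = 0 := by nlinarith [sq_nonneg p.1, norm_nonneg p.2]
  have h3 : p.1 = 0 := by nlinarith [sq_nonneg p.1, norm_nonneg p.2]
  exact Prod.ext h3 (norm_eq_zero.1 h2)

theorem lorForm_nondegenerate : (lorForm n).Nondegenerate :=
  ⟨fun _ h => lor_eq_zero_of_forall h,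
    fun p h => lor_eq_zero_of_forall fun q => by rw [lor_comm]; exact h q⟩

theorem contDiff_lor : ContDiff ℝ ω fun p : LorentzSpace n × LorentzSpace n => lor p.1 p.2 :=
  (lorL n).isBoundedBilinearMap.contDiff

theorem continuous_lor : Continuous fun p : LorentzSpace n × LorentzSpace n => lor p.1 p.2 :=
  contDiff_lor.continuous

theorem _root_.ContDiffAt.lor {V : Type*} [NormedAddCommGroup V] [NormedSpace ℝ V] {k : WithTop ℕ∞}
    {f g : V → LorentzSpace n} {y : V} (hf : ContDiffAt ℝ k f y) (hg : ContDiffAt ℝ k g y) :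
    ContDiffAt ℝ k (fun z => lor (f z) (g z)) y :=
  (contDiff_lor.of_le le_top).contDiffAt.comp y (hf.prodMk hg)

theorem _root_.HasFDerivAt.lor {V : Type*} [NormedAddCommGroup V] [NormedSpace ℝ V]
    {f g : V → LorentzSpace n} {f' g' : V →L[ℝ] LorentzSpace n} {y : V} (hf : HasFDerivAt f f' y)
    (hg : HasFDerivAt g g' y) :
    HasFDerivAt (fun z => lor (f z) (g z))
      ((lorL n (f y)).comp g' + ((lorL n).flip (g y)).comp f') y := by
  have := (lorL n).hasFDerivAt_of_bilinear hf hg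
  refine this.congr_fderiv ?_
  ext v
  simp

theorem fderiv_lor {V : Type*} [NormedAddCommGroup V] [NormedSpace ℝ V]
    {f g : V → LorentzSpace n} {y : V} (hf : DifferentiableAt ℝ f y)
    (hg : DifferentiableAt ℝ g y) (X : V) :
    fderiv ℝ (fun z => lor (f z) (g z)) y X = lor (fderiv ℝ f y X) (g y) +
      lor (f y) (fderiv ℝ g y X) := by
  rw [(hf.hasFDerivAt.lor hg.hasFDerivAt).fderiv]
  simp only [add_apply, ContinuousLinearMap.comp_apply,
    ContinuousLinearMap.flip_apply, lorL_apply]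
  ring

theorem _root_.HasDerivWithinAt.lor {f g : ℝ → LorentzSpace n} {f' g' : LorentzSpace n} {s : Set ℝ}
    {x : ℝ} (hf : HasDerivWithinAt f f' s x) (hg : HasDerivWithinAt g g' s x) :
    HasDerivWithinAt (fun z => lor (f z) (g z)) (lor f' (g x) + lor (f x) g') s x := by
  have := ((lorL n).isBoundedBilinearMap.hasFDerivAt (f x, g x)).comp_hasDerivWithinAt x
    (hf.prodMk hg)
  refine this.congr_deriv ?_
  simp [lorL_apply, add_comm]

/-- Vectors orthogonal to a timelike vector are spacelike. -/
theorem lor_self_nonneg {p w : LorentzSpace n} (hp : lor p p = -1) (h : lor w p = 0) :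
    0 ≤ lor w w := by
  simp only [lor, real_inner_self_eq_norm_sq] at *
  have h1 := abs_real_inner_le_norm w.2 p.2
  -- Orthogonality replaces the product of the spatial parts by `w.1 * p.1` in the Cauchy–Schwarz
  -- inequality; then `p.1 ^ 2 = 1 + ‖p.2‖ ^ 2` excludes `‖w.2‖ < |w.1|`.
  have h2 : (w.1 * p.1) ^ 2 ≤ (‖w.2‖ * ‖p.2‖) ^ 2 := by
    rw [← sub_eq_zero.1 h, ← sq_abs]
    exact pow_le_pow_left₀ (abs_nonneg _) h1 2
  have h3 : p.1 ^ 2 = 1 + ‖p.2‖ ^ 2 := by linarith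
  by_contra hneg
  have h4 : ‖w.2‖ ^ 2 < w.1 ^ 2 := by nlinarith
  nlinarith [mul_nonneg (sq_nonneg ‖p.2‖) (sub_nonneg.2 h4.le), sq_nonneg ‖w.2‖]

/-- With `‖w.2‖ ^ 2 = w.1 ^ 2` the Cauchy–Schwarz estimate reads `w.1 ^ 2 * (1 + ‖p.2‖ ^ 2) ≤ w.1 ^
2 * ‖p.2‖ ^ 2`, which forces `w.1 = 0`. -/
theorem lor_self_eq_zero {p w : LorentzSpace n} (hp : lor p p = -1) (h : lor w p = 0)
    (hw : lor w w = 0) : w = 0 := by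
  simp only [lor, real_inner_self_eq_norm_sq] at *
  have h1 := abs_real_inner_le_norm w.2 p.2
  have h2 : (w.1 * p.1) ^ 2 ≤ (‖w.2‖ * ‖p.2‖) ^ 2 := by
    rw [← sub_eq_zero.1 h, ← sq_abs]
    exact pow_le_pow_left₀ (abs_nonneg _) h1 2
  have h3 : p.1 ^ 2 = 1 + ‖p.2‖ ^ 2 := by linarith
  have h4 : ‖w.2‖ ^ 2 = w.1 ^ 2 := by nlinarith
  have h5 : w.1 ^ 2 ≤ 0 := by
    have : (w.1 * p.1) ^ 2 = w.1 ^ 2 + w.1 ^ 2 * ‖p.2‖ ^ 2 := by rw [mul_pow, h3]; ring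
    have h' : (‖w.2‖ * ‖p.2‖) ^ 2 = w.1 ^ 2 * ‖p.2‖ ^ 2 := by rw [mul_pow, h4]
    linarith
  have h6 : w.1 = 0 := by nlinarith [sq_nonneg w.1]
  refine Prod.ext h6 (norm_eq_zero.1 ?_)
  rw [h6] at h4
  simpa using h4

theorem lor_self_pos {p w : LorentzSpace n} (hp : lor p p = -1) (h : lor w p = 0)
    (hw : w ≠ 0) : 0 < lor w w :=
  lt_of_le_of_ne (lor_self_nonneg hp h) fun h0 => hw (lor_self_eq_zero hp h h0.symm)

end Lorentz

/-! ### Orthonormal bases for positive definite bilinear forms -/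

/-- The form is made into an inner product on `E`. This provides orthonormal frames of tangent and
normal spaces, on which the Lorentz product is positive definite. -/
theorem exists_orthonormal_basis {E : Type*} [AddCommGroup E] [Module ℝ E] [FiniteDimensional ℝ E]
    (B : LinearMap.BilinForm ℝ E) (hs : ∀ x y, B x y = B y x) (hp : ∀ x, x ≠ 0 → 0 < B x x) :
    ∃ u : Module.Basis (Fin (Module.finrank ℝ E)) ℝ E,
      ∀ a b, B (u a) (u b) = if a = b then 1 else 0 := by
  let cd : InnerProductSpace.Core ℝ E :=
    { inner := fun x y => B x y
      conj_inner_symm := fun x y => hs y x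
      re_inner_nonneg := fun x => by
        by_cases h : x = 0
        · simp [h]
        · exact (hp x h).le
      add_left := fun x y z => by simp
      smul_left := fun x y r => by simp
      definite := fun x h => by
        by_contra h0
        exact (hp x h0).ne' h }
  let := cd.toNormedAddCommGroup
  let _ : InnerProductSpace ℝ E := InnerProductSpace.ofCore cd.toCore
  have h := (stdOrthonormalBasis ℝ E).orthonormal
  refine ⟨(stdOrthonormalBasis ℝ E).toBasis, fun a b => ?_⟩
  have := (orthonormal_iff_ite.1 h) a b
  rw [OrthonormalBasis.coe_toBasis]
  exact this

/-! ### The functions `cosh √s` and `sinh √s / √s` -/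

/-- The entire function with `coshSqrt (r ^ 2) = cosh r`. -/
def coshSqrt : ℝ → ℝ :=
  FormalMultilinearSeries.ofScalarsSum (𝕜 := ℝ) (E := ℝ) fun k => ((2 * k).factorial : ℝ)⁻¹

/-- The entire function with `r * sinhcSqrt (r ^ 2) = sinh r`. -/
def sinhcSqrt : ℝ → ℝ :=
  FormalMultilinearSeries.ofScalarsSum (𝕜 := ℝ) (E := ℝ) fun k => ((2 * k + 1).factorial : ℝ)⁻¹

/-- The ratio test gives an infinite radius of convergence. It is applied to the two series that
make the exponential map smooth at the zero vector, where its formula divides by the length. -/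
theorem contDiff_ofScalarsSum {c : ℕ → ℝ} (hc : ∀ k, c k ≠ 0)
    (h : Filter.Tendsto (fun k => ‖c k.succ‖ / ‖c k‖) Filter.atTop (𝓝 0)) :
    ContDiff ℝ ∞ (FormalMultilinearSeries.ofScalarsSum (𝕜 := ℝ) (E := ℝ) c) := by
  have hr := FormalMultilinearSeries.ofScalars_radius_eq_top_of_tendsto ℝ c
    (Filter.Eventually.of_forall hc) h
  have hb := (FormalMultilinearSeries.ofScalars ℝ c).hasFPowerSeriesOnBall (by rw [hr]; simp)
  rw [hr] at hb
  have ha : AnalyticOnNhd ℝ (FormalMultilinearSeries.ofScalarsSum (𝕜 := ℝ) (E := ℝ) c)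
      Set.univ := by
    intro x _
    exact hb.analyticAt_of_mem (by simp)
  rw [← contDiffOn_univ]
  exact ha.contDiffOn uniqueDiffOn_univ

theorem tendsto_inv_succ_mul (a : ℕ → ℝ) (ha : ∀ k : ℕ, (k : ℝ) + 1 ≤ a k) :
    Filter.Tendsto (fun k => (a k)⁻¹) Filter.atTop (𝓝 0) := by
  refine Filter.Tendsto.inv_tendsto_atTop ?_
  refine Filter.tendsto_atTop_mono ha ?_
  exact Filter.tendsto_atTop_add_const_right _ _ tendsto_natCast_atTop_atTop

theorem contDiff_coshSqrt : ContDiff ℝ ∞ coshSqrt := by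
  refine contDiff_ofScalarsSum (fun k => by positivity) ?_
  refine (tendsto_inv_succ_mul (fun k => (2 * k + 2) * (2 * k + 1)) fun k => ?_).congr fun k => ?_
  · nlinarith [Nat.cast_nonneg (α := ℝ) k]
  · rw [show 2 * k.succ = 2 * k + 1 + 1 by omega, Nat.factorial_succ, Nat.factorial_succ]
    simp only [norm_inv, Real.norm_natCast]
    push_cast
    field_simp
    ring

theorem contDiff_sinhcSqrt : ContDiff ℝ ∞ sinhcSqrt := by
  refine contDiff_ofScalarsSum (fun k => by positivity) ?_
  refine (tendsto_inv_succ_mul (fun k => (2 * k + 3) * (2 * k + 2)) fun k => ?_).congr fun k => ?_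
  · nlinarith [Nat.cast_nonneg (α := ℝ) k]
  · rw [show 2 * k.succ + 1 = 2 * k + 1 + 1 + 1 by omega, Nat.factorial_succ (2 * k + 1 + 1),
      Nat.factorial_succ (2 * k + 1)]
    simp only [norm_inv, Real.norm_natCast]
    push_cast
    field_simp
    ring

theorem coshSqrt_sq (r : ℝ) : coshSqrt (r ^ 2) = Real.cosh r := by
  rw [coshSqrt, FormalMultilinearSeries.ofScalars_sum_eq, ← (Real.hasSum_cosh r).tsum_eq]
  refine tsum_congr fun k => ?_
  rw [smul_eq_mul, pow_mul]; field_simp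

theorem mul_sinhcSqrt_sq (r : ℝ) : r * sinhcSqrt (r ^ 2) = Real.sinh r := by
  rw [sinhcSqrt, FormalMultilinearSeries.ofScalars_sum_eq, ← (Real.hasSum_sinh r).tsum_eq,
    ← tsum_mul_left]
  refine tsum_congr fun k => ?_
  rw [smul_eq_mul, pow_succ r (2 * k), pow_mul]; field_simp

theorem sinhcSqrt_pos {s : ℝ} (hs : 0 ≤ s) : 0 < sinhcSqrt s := by
  rcases hs.eq_or_lt with rfl | h
  · rw [sinhcSqrt, FormalMultilinearSeries.ofScalarsSum_zero]; simp
  · have h1 := mul_sinhcSqrt_sq (Real.sqrt s)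
    rw [Real.sq_sqrt hs] at h1
    have h2 := Real.sinh_pos_iff.2 (Real.sqrt_pos.2 h)
    rw [← h1] at h2
    exact (pos_iff_pos_of_mul_pos h2).1 (Real.sqrt_pos.2 h)

/-- For `s > 0` differentiate `coshSqrt (r ^ 2) = cosh r` and divide by `2 * r`; the case `s = 0`
follows because both sides are continuous. -/
theorem hasDerivAt_coshSqrt {s : ℝ} (hs : 0 ≤ s) :
    HasDerivAt coshSqrt (sinhcSqrt s / 2) s := by
  have hd : Differentiable ℝ coshSqrt := contDiff_coshSqrt.differentiable (by simp)
  have key : ∀ r : ℝ, deriv coshSqrt (r ^ 2) * (2 * r) = r * sinhcSqrt (r ^ 2) := by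
    intro r
    have h1 : HasDerivAt (fun r : ℝ => coshSqrt (r ^ 2)) (deriv coshSqrt (r ^ 2) * (2 * r)) r := by
      refine ((hd (r ^ 2)).hasDerivAt.comp r (hasDerivAt_pow 2 r)).congr_deriv ?_
      simp
    have h2 : (fun r : ℝ => coshSqrt (r ^ 2)) = Real.cosh := funext coshSqrt_sq
    rw [h2] at h1
    rw [h1.unique (Real.hasDerivAt_cosh r), mul_sinhcSqrt_sq]
  have hpos : Set.EqOn (deriv coshSqrt) (fun s => sinhcSqrt s / 2) (Set.Ioi 0) := by
    intro s hs
    have h3 := key (Real.sqrt s)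
    rw [Real.sq_sqrt (le_of_lt hs)] at h3
    have h4 := Real.sqrt_pos.2 hs
    field_simp at h3 ⊢
    linarith
  have hcl : Set.EqOn (deriv coshSqrt) (fun s => sinhcSqrt s / 2) (closure (Set.Ioi 0)) :=
    hpos.closure (contDiff_coshSqrt.continuous_deriv (by simp))
      (contDiff_sinhcSqrt.continuous.div_const 2)
  rw [closure_Ioi] at hcl
  rw [← show deriv coshSqrt s = sinhcSqrt s / 2 from hcl hs]
  exact (hd s).hasDerivAt

/-! ### Immersions into hyperbolic space in coordinates -/

set_option linter.unusedSectionVars false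
set_option linter.unusedSimpArgs false

section Local

variable {n : ℕ} {V : Type*} [NormedAddCommGroup V] [NormedSpace ℝ V]
  {ι : Type*} [Fintype ι] [DecidableEq ι]

/-- The second derivative of `f`. -/
def D2 (f : V → LorentzSpace n) (y X Y : V) : LorentzSpace n := fderiv ℝ (fderiv ℝ f) y X Y

/-- `w` is the component of `D² f (X, Y)` normal to `f` in hyperbolic space. -/
structure IsNormalPart (f : V → LorentzSpace n) (y X Y : V) (w : LorentzSpace n) : Prop where
  perp : lor w (f y) = 0
  perp_fderiv : ∀ Z, lor w (fderiv ℝ f y Z) = 0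
  decomp : ∃ (r : ℝ) (Z : V), D2 f y X Y = w + r • f y + fderiv ℝ f y Z

theorem contDiffAt_fderiv {W : Type*} [NormedAddCommGroup W] [NormedSpace ℝ W] {f : V → W} {y : V}
    {k m : WithTop ℕ∞} (hf : ContDiffAt ℝ k f y) (hk : m + 1 ≤ k) :
    ContDiffAt ℝ m (fderiv ℝ f) y := hf.fderiv_right hk

theorem contDiffAt_pderiv {W : Type*} [NormedAddCommGroup W] [NormedSpace ℝ W] {f : V → W} {y : V}
    {k m : WithTop ℕ∞} (b : Module.Basis ι ℝ V) (i : ι) (hf : ContDiffAt ℝ k f y)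
    (hk : m + 1 ≤ k) : ContDiffAt ℝ m (pderiv b i f) y :=
  (contDiffAt_fderiv hf hk).clm_apply contDiffAt_const

theorem fderiv_fderiv_apply {W : Type*} [NormedAddCommGroup W] [NormedSpace ℝ W] {f : V → W}
    {y : V} (hf : ContDiffAt ℝ 2 f y) (X Y : V) :
    fderiv ℝ (fun z => fderiv ℝ f z Y) y X = fderiv ℝ (fderiv ℝ f) y X Y := by
  have h : DifferentiableAt ℝ (fderiv ℝ f) y :=
    (contDiffAt_fderiv (m := 1) hf (by norm_num)).differentiableAt (by simp)
  rw [(h.hasFDerivAt.clm_apply (hasFDerivAt_const Y y)).fderiv]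
  simp

theorem pderiv_pderiv {f : V → LorentzSpace n} {y : V} (hf : ContDiffAt ℝ 2 f y)
    (b : Module.Basis ι ℝ V) (i j : ι) : pderiv b i (pderiv b j f) y = D2 f y (b i) (b j) :=
  fderiv_fderiv_apply hf _ _

theorem D2_symm {f : V → LorentzSpace n} {y : V} (hf : ContDiffAt ℝ 2 f y) (X Y : V) :
    D2 f y X Y = D2 f y Y X := (hf.isSymmSndFDerivAt (by simp)) X Y

theorem pderiv_lor {f g : V → LorentzSpace n} {y : V} (hf : DifferentiableAt ℝ f y)
    (hg : DifferentiableAt ℝ g y) (b : Module.Basis ι ℝ V) (i : ι) :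
    pderiv b i (fun z => lor (f z) (g z)) y = lor (pderiv b i f y) (g y) +
      lor (f y) (pderiv b i g y) := fderiv_lor hf hg _

section Hyperbolic

variable {f : V → LorentzSpace n} {y : V} (hh : ∀ z, lor (f z) (f z) = -1)

include hh

theorem lor_fderiv_self (hf : DifferentiableAt ℝ f y) (X : V) :
    lor (fderiv ℝ f y X) (f y) = 0 := by
  have h := fderiv_lor hf hf X
  simp only [hh, lor_comm (f y)] at h
  rw [fderiv_fun_const] at h
  simp at h
  linarith

theorem lor_fderiv_pos (hf : DifferentiableAt ℝ f y) (hi : Function.Injective (fderiv ℝ f y))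
    {X : V} (hX : X ≠ 0) : 0 < lor (fderiv ℝ f y X) (fderiv ℝ f y X) :=
  lor_self_pos (hh y) (lor_fderiv_self hh hf X) fun h => hX (hi (by rw [h, map_zero]))

/-- The difference of two normal parts lies in the span of `f y` and the tangent space and is also
orthogonal to both, hence it is null, and a null vector orthogonal to `f y` vanishes. So a second
fundamental form can be identified by exhibiting a normal part, without computing Christoffel
symbols. -/
theorem IsNormalPart.unique {X Y : V} {w w' : LorentzSpace n} (h : IsNormalPart f y X Y w) (h' : IsNormalPart f y X Y w') :
    w = w' := by
  obtain ⟨r, Z, e⟩ := h.decomp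
  obtain ⟨r', Z', e'⟩ := h'.decomp
  rw [e] at e'
  have key : w - w' = (r' - r) • f y + fderiv ℝ f y (Z' - Z) := by
    rw [map_sub, sub_smul, sub_eq_iff_eq_add]
    have := sub_eq_iff_eq_add.2 e'.symm
    rw [eq_comm, ← sub_eq_zero] at e'
    rw [← sub_eq_zero, ← neg_eq_zero, ← e']
    abel
  refine sub_eq_zero.1 (lor_self_eq_zero (hh y) (p := f y) ?_ ?_)
  · rw [lor_sub_left, h.perp, h'.perp, sub_zero]
  · have h0 : lor (w - w') (w - w') =
        lor (w - w') ((r' - r) • f y + fderiv ℝ f y (Z' - Z)) := by rw [← key]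
    rw [h0]
    simp only [lor_add_right, lor_smul_right, lor_sub_left, h.perp, h'.perp, h.perp_fderiv,
      h'.perp_fderiv]
    ring

end Hyperbolic

theorem inducedMetric_apply (b : Module.Basis ι ℝ V) (f : V → LorentzSpace n) (y : V) (i j : ι) :
    inducedMetric b f y i j = lor (fderiv ℝ f y (b i)) (fderiv ℝ f y (b j)) := rfl

theorem fderiv_eq_sum (b : Module.Basis ι ℝ V) (A : V →L[ℝ] LorentzSpace n) (X : V) :
    A X = ∑ i, b.repr X i • A (b i) := by
  conv_lhs => rw [← b.sum_repr X]
  simp only [map_sum, map_smul]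

/-- A vector in the kernel of the matrix would give a tangent vector of length zero. -/
theorem isUnit_det_inducedMetric (b : Module.Basis ι ℝ V) {f : V → LorentzSpace n} {y : V}
    (hh : ∀ z, lor (f z) (f z) = -1) (hf : DifferentiableAt ℝ f y)
    (hi : Function.Injective (fderiv ℝ f y)) : IsUnit (inducedMetric b f y).det := by
  rw [← Matrix.isUnit_iff_isUnit_det, ← Matrix.mulVec_injective_iff_isUnit]
  rw [← Matrix.coe_mulVecLin, ← LinearMap.ker_eq_bot, LinearMap.ker_eq_bot']
  intro v hv
  rw [Matrix.mulVecLin_apply] at hv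
  set X : V := ∑ j, v j • b j with hX
  have hA : fderiv ℝ f y X = ∑ j, v j • fderiv ℝ f y (b j) := by rw [hX]; simp
  have h0 : lor (fderiv ℝ f y X) (fderiv ℝ f y X) = 0 := by
    rw [hA, lor_sum_left]
    refine Finset.sum_eq_zero fun i _ => ?_
    have := congrFun hv i
    simp only [Matrix.mulVec, dotProduct, inducedMetric_apply, Pi.zero_apply] at this
    rw [lor_smul_left, lor_sum_right]
    simp only [lor_smul_right]
    rw [Finset.sum_congr rfl fun j _ => mul_comm (v j) _, this, mul_zero]
  have hX0 : X = 0 := by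
    by_contra hne
    exact (lor_fderiv_pos hh hf hi hne).ne' h0
  have := b.linearIndependent
  rw [Fintype.linearIndependent_iff] at this
  exact funext (this v (hX ▸ hX0))

theorem contDiffAt_det {k : WithTop ℕ∞} {M : V → Matrix ι ι ℝ} {y : V}
    (hM : ∀ i j, ContDiffAt ℝ k (fun z => M z i j) y) : ContDiffAt ℝ k (fun z => (M z).det) y := by
  simp only [Matrix.det_apply']
  exact ContDiffAt.sum fun σ _ => contDiffAt_const.mul (contDiffAt_prod fun i _ => hM _ _)

theorem contDiffAt_inv_apply {k : WithTop ℕ∞} {M : V → Matrix ι ι ℝ} {y : V}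
    (hM : ∀ i j, ContDiffAt ℝ k (fun z => M z i j) y) (hu : IsUnit (M y).det) (i j : ι) :
    ContDiffAt ℝ k (fun z => (M z)⁻¹ i j) y := by
  simp only [Matrix.inv_def, Ring.inverse_eq_inv', Matrix.smul_apply, smul_eq_mul,
    Matrix.adjugate_apply]
  refine ((contDiffAt_det hM).inv hu.ne_zero).mul (contDiffAt_det fun p q => ?_)
  by_cases hp : p = j
  · subst hp; simp only [Matrix.updateRow_self]; exact contDiffAt_const
  · simp only [Matrix.updateRow_ne hp]; exact hM p q

theorem contDiffAt_inducedMetric (b : Module.Basis ι ℝ V) {f : V → LorentzSpace n} {y : V}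
    {k m : WithTop ℕ∞} (hf : ContDiffAt ℝ k f y) (hk : m + 1 ≤ k) (i j : ι) :
    ContDiffAt ℝ m (fun z => inducedMetric b f z i j) y :=
  (contDiffAt_pderiv b i hf hk).lor (contDiffAt_pderiv b j hf hk)

theorem pderiv_inducedMetric (b : Module.Basis ι ℝ V) {f : V → LorentzSpace n} {y : V}
    (hf : ContDiffAt ℝ 2 f y) (i j l : ι) :
    pderiv b i (fun z => inducedMetric b f z j l) y =
      lor (D2 f y (b i) (b j)) (fderiv ℝ f y (b l)) +
        lor (fderiv ℝ f y (b j)) (D2 f y (b i) (b l)) := by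
  have h : ∀ j, DifferentiableAt ℝ (pderiv b j f) y := fun j =>
    (contDiffAt_pderiv (m := 1) b j hf (by norm_num)).differentiableAt (by simp)
  rw [← pderiv_pderiv hf, ← pderiv_pderiv hf]
  exact pderiv_lor (h j) (h l) b i

/-! ### Gauss formula, Gauss equation and traces in orthonormal frames. -/

section Immersion

variable {f : V → LorentzSpace n} {y : V} (b : Module.Basis ι ℝ V)
  (hh : ∀ z, lor (f z) (f z) = -1) (hi : Function.Injective (fderiv ℝ f y))

include hh hi

/-- Each derivative of the metric is a sum of two products of a second with a first derivative of
`f`. By the symmetry of second derivatives all but two equal terms cancel in the Christoffel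
combination. -/
theorem sum_christoffel_mul (hf : ContDiffAt ℝ 2 f y) (i j l : ι) :
    ∑ k, christoffel b (inducedMetric b f) y k i j * inducedMetric b f y k l =
      lor (D2 f y (b i) (b j)) (fderiv ℝ f y (b l)) := by
  have hu := isUnit_det_inducedMetric b hh (hf.differentiableAt (by simp)) hi
  have hc : ∀ k, christoffel b (inducedMetric b f) y k i j =
      ∑ p, (inducedMetric b f y)⁻¹ k p * lor (D2 f y (b i) (b j)) (fderiv ℝ f y (b p)) := by
    intro k
    rw [christoffel, Finset.mul_sum]
    refine Finset.sum_congr rfl fun p _ => ?_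
    simp only [pderiv_inducedMetric b hf]
    rw [D2_symm hf (b j) (b i), D2_symm hf (b p) (b i), D2_symm hf (b p) (b j),
      lor_comm (fderiv ℝ f y (b j)), lor_comm (fderiv ℝ f y (b i))]
    ring
  have hsym : ∀ p q, inducedMetric b f y p q = inducedMetric b f y q p := fun p q =>
    lor_comm _ _
  have hinv := Matrix.mul_nonsing_inv _ hu
  simp only [hc, Finset.sum_mul]
  rw [Finset.sum_comm]
  have : ∀ p, ∑ k, (inducedMetric b f y)⁻¹ k p * lor (D2 f y (b i) (b j)) (fderiv ℝ f y (b p)) *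
      inducedMetric b f y k l = (if l = p then 1 else 0) *
        lor (D2 f y (b i) (b j)) (fderiv ℝ f y (b p)) := by
    intro p
    have h1 := congrFun (congrFun hinv l) p
    rw [Matrix.mul_apply, Matrix.one_apply] at h1
    rw [← h1, Finset.sum_mul]
    refine Finset.sum_congr rfl fun k _ => ?_
    rw [hsym k l]; ring
  simp only [this]
  simp

theorem contDiffAt_christoffel (hf : ContDiffAt ℝ 3 f y) (k i j : ι) :
    ContDiffAt ℝ 1 (fun z => christoffel b (inducedMetric b f) z k i j) y := by
  have hu := isUnit_det_inducedMetric b hh (hf.differentiableAt (by simp)) hi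
  have hg : ∀ p q, ContDiffAt ℝ 2 (fun z => inducedMetric b f z p q) y := fun p q =>
    contDiffAt_inducedMetric b hf (by norm_num) p q
  have hp : ∀ r p q, ContDiffAt ℝ 1 (pderiv b r fun z => inducedMetric b f z p q) y :=
    fun r p q => contDiffAt_pderiv b r (hg p q) (by norm_num)
  refine contDiffAt_const.mul (ContDiffAt.sum fun l _ => ?_)
  refine ((contDiffAt_inv_apply hg hu k l).of_le (by norm_num)).mul ?_
  exact ((hp _ _ _).add (hp _ _ _)).sub (hp _ _ _)

omit hi in
theorem lor_D2_self (hf : ContDiffAt ℝ 2 f y) (X Y : V) :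
    lor (D2 f y X Y) (f y) = -lor (fderiv ℝ f y X) (fderiv ℝ f y Y) := by
  have hev : (fun z => lor (fderiv ℝ f z Y) (f z)) =ᶠ[𝓝 y] fun _ => 0 := by
    filter_upwards [hf.eventually (by simp)] with z hz
    exact lor_fderiv_self hh (hz.differentiableAt (by simp)) Y
  have h1 := hev.fderiv_eq (𝕜 := ℝ)
  have hd : DifferentiableAt ℝ (fun z => fderiv ℝ f z Y) y :=
    (((contDiffAt_fderiv (m := 1) hf (by norm_num)).clm_apply
      contDiffAt_const).differentiableAt (by simp))
  have h2 := fderiv_lor hd (hf.differentiableAt (by simp)) X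
  rw [h1, fderiv_fderiv_apply hf] at h2
  simp only [fderiv_fun_const, Pi.zero_apply, zero_apply] at h2
  rw [lor_comm (fderiv ℝ f y X)]
  unfold D2
  linarith

theorem lor_secondFFCoord_fderiv (hf : ContDiffAt ℝ 2 f y) (i j : ι) (X : V) :
    lor (secondFFCoord b f y i j) (fderiv ℝ f y X) = 0 := by
  rw [fderiv_eq_sum b, lor_sum_right]
  refine Finset.sum_eq_zero fun l _ => ?_
  rw [lor_smul_right, secondFFCoord, pderiv_pderiv hf, lor_sub_left, lor_sub_left, lor_smul_left,
    lor_comm (f y), lor_fderiv_self hh (hf.differentiableAt (by simp)), lor_sum_left]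
  simp only [lor_smul_left]
  have := sum_christoffel_mul b hh hi hf i j l
  simp only [inducedMetric_apply] at this
  simp only [pderiv]
  rw [this]; ring

omit hi in
theorem lor_secondFFCoord_self (hf : ContDiffAt ℝ 2 f y) (i j : ι) :
    lor (secondFFCoord b f y i j) (f y) = 0 := by
  rw [secondFFCoord, pderiv_pderiv hf, lor_sub_left, lor_sub_left, lor_smul_left, hh,
    lor_D2_self hh hf, lor_sum_left, inducedMetric_apply]
  simp only [lor_smul_left, pderiv, lor_fderiv_self hh (hf.differentiableAt (by simp : (2 : WithTop ℕ∞) ≠ 0))]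
  simp

/-- The second fundamental form as a bilinear map. -/
def sff (b : Module.Basis ι ℝ V) (f : V → LorentzSpace n) (y : V) :
    V →ₗ[ℝ] V →ₗ[ℝ] LorentzSpace n :=
  b.constr ℝ fun i => b.constr ℝ fun j => secondFFCoord b f y i j

omit hh hi in
theorem sff_basis (b : Module.Basis ι ℝ V) (f : V → LorentzSpace n) (y : V) (i j : ι) :
    sff b f y (b i) (b j) = secondFFCoord b f y i j := by
  rw [sff, Module.Basis.constr_basis, Module.Basis.constr_basis]

omit hh hi in
theorem bilin_eq_sum {W : Type*} [AddCommGroup W] [Module ℝ W] (b : Module.Basis ι ℝ V)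
    (B : V →ₗ[ℝ] V →ₗ[ℝ] W) (X Y : V) :
    B X Y = ∑ i, ∑ j, (b.repr X i * b.repr Y j) • B (b i) (b j) := by
  conv_lhs => rw [← b.sum_repr X, ← b.sum_repr Y]
  simp only [map_sum, map_smul, LinearMap.sum_apply, LinearMap.smul_apply, Finset.smul_sum,
    smul_smul]
  rw [Finset.sum_comm]
  simp only [mul_comm]

omit hh hi in
theorem secondFFCoord_eq (hf : ContDiffAt ℝ 2 f y) (i j : ι) :
    D2 f y (b i) (b j) = secondFFCoord b f y i j + inducedMetric b f y i j • f y +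
      fderiv ℝ f y (∑ k, christoffel b (inducedMetric b f) y k i j • b k) := by
  rw [secondFFCoord, pderiv_pderiv hf, map_sum]
  simp only [map_smul, pderiv]
  abel

/-- Together with `IsNormalPart.unique` this characterizes `sff` without reference to the basis or
to the Christoffel symbols. -/
theorem isNormalPart_sff (hf : ContDiffAt ℝ 2 f y) (X Y : V) :
    IsNormalPart f y X Y (sff b f y X Y) := by
  have hb := bilin_eq_sum b (sff b f y) X Y
  refine ⟨?_, fun Z => ?_, lor (fderiv ℝ f y X) (fderiv ℝ f y Y), ∑ i, ∑ j, (b.repr X i * b.repr Y j) •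
    ∑ k, christoffel b (inducedMetric b f) y k i j • b k, ?_⟩
  · rw [hb]
    simp only [lor_sum_left, lor_smul_left, sff_basis, lor_secondFFCoord_self b hh hf, mul_zero,
      Finset.sum_const_zero]
  · rw [hb]
    simp only [lor_sum_left, lor_smul_left, sff_basis, lor_secondFFCoord_fderiv b hh hi hf,
      mul_zero, Finset.sum_const_zero]
  · have h2 : D2 f y X Y = ∑ i, ∑ j, (b.repr X i * b.repr Y j) • D2 f y (b i) (b j) :=
      bilin_eq_sum b
        ((ContinuousLinearMap.coeLM ℝ).comp (fderiv ℝ (fderiv ℝ f) y).toLinearMap) X Y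
    rw [h2, hb]
    simp only [secondFFCoord_eq b hf, sff_basis, map_sum, map_smul, smul_add, Finset.sum_add_distrib]
    congr 2
    rw [fderiv_eq_sum b _ X, fderiv_eq_sum b _ Y]
    simp only [lor_sum_left, lor_sum_right, lor_smul_left, lor_smul_right, Finset.sum_smul, smul_smul,
      inducedMetric_apply]
    simp only [Finset.mul_sum, Finset.sum_smul]
    rw [Finset.sum_comm]
    exact Finset.sum_congr rfl fun i _ => Finset.sum_congr rfl fun j _ => by congr 1; ring

/-- The tangential part `∇_{∂ᵢ} ∂ⱼ` of the second derivative. -/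
def nablaCoord (b : Module.Basis ι ℝ V) (f : V → LorentzSpace n) (y : V) (i j : ι) : V :=
  ∑ k, christoffel b (inducedMetric b f) y k i j • b k

theorem lor_D2_D2 (hf : ContDiffAt ℝ 2 f y) (i j s l : ι) :
    lor (D2 f y (b i) (b j)) (D2 f y (b s) (b l)) =
      lor (secondFFCoord b f y i j) (secondFFCoord b f y s l) -
        inducedMetric b f y i j * inducedMetric b f y s l +
        ∑ k, christoffel b (inducedMetric b f) y k i j *
          lor (D2 f y (b s) (b l)) (fderiv ℝ f y (b k)) := by
  have hd := hf.differentiableAt (by simp)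
  have h1 : ∑ k, christoffel b (inducedMetric b f) y k i j *
      lor (D2 f y (b s) (b l)) (fderiv ℝ f y (b k)) =
      lor (fderiv ℝ f y (nablaCoord b f y i j)) (D2 f y (b s) (b l)) := by
    rw [nablaCoord, map_sum, lor_sum_left]
    simp only [map_smul, lor_smul_left, lor_comm (D2 f y (b s) (b l))]
  rw [h1, secondFFCoord_eq b hf i j, secondFFCoord_eq b hf s l]
  simp only [lor_add_left, lor_add_right, lor_smul_left, lor_smul_right, nablaCoord,
    lor_secondFFCoord_fderiv b hh hi hf, lor_secondFFCoord_self b hh hf, hh,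
    lor_comm (f y) (secondFFCoord b f y s l), lor_comm (fderiv ℝ f y _) (secondFFCoord b f y s l),
    lor_fderiv_self hh hd]
  rw [lor_comm (f y), lor_fderiv_self hh hd]
  ring

/-- This is the derivative along `b s` of the identity `sum_christoffel_mul`. The only third
derivative of `f` that appears is symmetric in `s` and `i`, so it disappears from the curvature
tensor. -/
theorem lor_third (hf : ContDiffAt ℝ 3 f y) (s i j l : ι) :
    ∑ q, pderiv b s (fun z => christoffel b (inducedMetric b f) z q i j) y *
        inducedMetric b f y q l +
      ∑ p, christoffel b (inducedMetric b f) y p i j *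
        lor (D2 f y (b s) (b p)) (fderiv ℝ f y (b l)) =
    lor (D2 (pderiv b j f) y (b s) (b i)) (fderiv ℝ f y (b l)) +
      lor (secondFFCoord b f y i j) (secondFFCoord b f y s l) -
      inducedMetric b f y i j * inducedMetric b f y s l := by
  have hf2 : ContDiffAt ℝ 2 f y := hf.of_le (by norm_num)
  have hD : ContDiffAt ℝ 2 (fderiv ℝ f) y := contDiffAt_fderiv hf (by norm_num)
  have hpj : ∀ j, ContDiffAt ℝ 2 (pderiv b j f) y := fun j =>
    contDiffAt_pderiv b j hf (by norm_num)
  have hpij : ContDiffAt ℝ 1 (pderiv b i (pderiv b j f)) y :=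
    contDiffAt_pderiv b i (hpj j) (by norm_num)
  have : FiniteDimensional ℝ V := b.finiteDimensional_of_finite
  have hev : (fun z => lor (pderiv b i (pderiv b j f) z) (pderiv b l f z)) =ᶠ[𝓝 y]
      fun z => ∑ k, christoffel b (inducedMetric b f) z k i j * inducedMetric b f z k l := by
    have hinj : ∀ᶠ z in 𝓝 y, Function.Injective (fderiv ℝ f z) :=
      hD.continuousAt.eventually (ContinuousLinearMap.isOpen_injective.mem_nhds hi)
    filter_upwards [hf2.eventually (by simp), hinj] with z hz hiz
    rw [sum_christoffel_mul b hh hiz hz, pderiv_pderiv hz]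
    rfl
  have h1 := hev.fderiv_eq (𝕜 := ℝ)
  have h2 := DFunLike.congr_fun h1 (b s)
  rw [fderiv_lor (hpij.differentiableAt (by simp)) ((hpj l).differentiableAt (by simp))] at h2
  have hc : ∀ k, DifferentiableAt ℝ (fun z => christoffel b (inducedMetric b f) z k i j) y :=
    fun k => (contDiffAt_christoffel b hh hi hf k i j).differentiableAt (by simp)
  have hg : ∀ k, DifferentiableAt ℝ (fun z => inducedMetric b f z k l) y := fun k =>
    (contDiffAt_inducedMetric (m := 2) b hf (by norm_num) k l).differentiableAt (by simp)
  rw [fderiv_fun_sum (u := Finset.univ)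
    (A := fun k z => christoffel b (inducedMetric b f) z k i j * inducedMetric b f z k l)
    fun k _ => (hc k).fun_mul (hg k)] at h2
  simp only [sum_apply, fderiv_fun_mul (hc _) (hg _), add_apply, smul_apply, smul_eq_mul,
    Finset.sum_add_distrib] at h2
  have e1 : ∀ k, fderiv ℝ (fun z => inducedMetric b f z k l) y (b s) =
      lor (D2 f y (b s) (b k)) (fderiv ℝ f y (b l)) +
        lor (fderiv ℝ f y (b k)) (D2 f y (b s) (b l)) := fun k =>
    pderiv_inducedMetric b hf2 s k l
  have e2 : fderiv ℝ (pderiv b i (pderiv b j f)) y (b s) = D2 (pderiv b j f) y (b s) (b i) :=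
    pderiv_pderiv (hpj j) b s i
  have e3 : fderiv ℝ (pderiv b l f) y (b s) = D2 f y (b s) (b l) := pderiv_pderiv hf2 b s l
  simp only [e1, mul_add, Finset.sum_add_distrib] at h2
  rw [e2, e3, pderiv_pderiv hf2, lor_D2_D2 b hh hi hf2] at h2
  simp only [pderiv, lor_comm (fderiv ℝ f y (b _)) (D2 f y (b s) (b l))] at h2 ⊢
  simp only [mul_comm (inducedMetric b f y _ l)] at h2
  linarith

/-- The Gauss equation. -/
theorem sum_riemann_mul (hf : ContDiffAt ℝ 3 f y) (s i j l : ι) :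
    ∑ q, riemann b (inducedMetric b f) y q s i j * inducedMetric b f y q l =
      lor (secondFFCoord b f y i j) (secondFFCoord b f y s l) -
        lor (secondFFCoord b f y s j) (secondFFCoord b f y i l) -
      (inducedMetric b f y i j * inducedMetric b f y s l -
        inducedMetric b f y s j * inducedMetric b f y i l) := by
  have hf2 : ContDiffAt ℝ 2 f y := hf.of_le (by norm_num)
  have h1 := lor_third b hh hi hf s i j l
  have h2 := lor_third b hh hi hf i s j l
  -- The third derivatives in `h1` and `h2` agree, so they cancel when the two identities are
  -- subtracted.
  have hs := D2_symm (contDiffAt_pderiv (m := 2) b j hf (by norm_num)) (b s) (b i)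
  rw [hs] at h1
  have key : ∀ s i j, ∑ p, christoffel b (inducedMetric b f) y p i j *
      lor (D2 f y (b s) (b p)) (fderiv ℝ f y (b l)) =
      ∑ q, (∑ p, christoffel b (inducedMetric b f) y q s p *
        christoffel b (inducedMetric b f) y p i j) * inducedMetric b f y q l := by
    intro s i j
    simp only [← sum_christoffel_mul b hh hi hf2, Finset.mul_sum, Finset.sum_mul]
    rw [Finset.sum_comm]
    exact Finset.sum_congr rfl fun q _ => Finset.sum_congr rfl fun p _ => by ring
  rw [key] at h1 h2
  simp only [riemann, add_mul, sub_mul, Finset.sum_add_distrib, Finset.sum_sub_distrib]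
  linarith

/-- The curvature tensor of the induced metric, in terms of the second fundamental form. -/
def gaussForm (b : Module.Basis ι ℝ V) (f : V → LorentzSpace n) (y X Y Z W : V) : ℝ :=
  lor (sff b f y Y Z) (sff b f y X W) - lor (sff b f y X Z) (sff b f y Y W) -
    (lor (fderiv ℝ f y Y) (fderiv ℝ f y Z) * lor (fderiv ℝ f y X) (fderiv ℝ f y W) -
      lor (fderiv ℝ f y X) (fderiv ℝ f y Z) * lor (fderiv ℝ f y Y) (fderiv ℝ f y W))

theorem riemann_eq (hf : ContDiffAt ℝ 3 f y) (q s i j : ι) :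
    riemann b (inducedMetric b f) y q s i j =
      ∑ l, (inducedMetric b f y)⁻¹ q l * gaussForm b f y (b s) (b i) (b j) (b l) := by
  have hu := isUnit_det_inducedMetric b hh (hf.differentiableAt (by simp)) hi
  have h := fun l => sum_riemann_mul b hh hi hf s i j l
  have h' : ∀ l, gaussForm b f y (b s) (b i) (b j) (b l) =
      ∑ q, riemann b (inducedMetric b f) y q s i j * inducedMetric b f y q l := by
    intro l
    rw [h l, gaussForm]
    simp only [sff_basis, inducedMetric_apply]
  simp only [h', Finset.mul_sum]
  rw [Finset.sum_comm]
  have hinv := Matrix.nonsing_inv_mul _ hu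
  have h3 : ∀ p, ∑ l, (inducedMetric b f y)⁻¹ q l *
      (riemann b (inducedMetric b f) y p s i j * inducedMetric b f y p l) =
      (if q = p then 1 else 0) * riemann b (inducedMetric b f) y p s i j := by
    intro p
    have h1 := congrFun (congrFun hinv q) p
    rw [Matrix.mul_apply, Matrix.one_apply] at h1
    rw [← h1, Finset.sum_mul]
    refine Finset.sum_congr rfl fun l _ => ?_
    rw [inducedMetric_apply, inducedMetric_apply, lor_comm]; ring
  simp only [h3]
  simp

omit hh hi in
-- If `Q` is the matrix of coordinates of the orthonormal vectors and `g` that of the metric, then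
-- `Q * g * Qᵀ = 1`. Both index types have the same cardinality, so the factors commute to `g * (Qᵀ
-- * Q) = 1`.
theorem inv_inducedMetric_apply {κ : Type*} [Fintype κ] [DecidableEq κ] (u : κ → V)
    (hκ : Fintype.card κ = Fintype.card ι)
    (hu : ∀ a c, lor (fderiv ℝ f y (u a)) (fderiv ℝ f y (u c)) = if a = c then 1 else 0) (i j : ι) :
    (inducedMetric b f y)⁻¹ i j = ∑ a, b.repr (u a) i * b.repr (u a) j := by
  let Q : Matrix κ ι ℝ := Matrix.of fun a i => b.repr (u a) i
  have h1 : Q * (inducedMetric b f y * Q.transpose) = 1 := by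
    ext a c
    rw [Matrix.one_apply, ← hu, fderiv_eq_sum b _ (u a), fderiv_eq_sum b _ (u c), Matrix.mul_apply,
      lor_sum_left]
    refine Finset.sum_congr rfl fun i _ => ?_
    rw [Matrix.mul_apply, lor_smul_left, lor_sum_right]
    simp only [Q, Matrix.of_apply, Matrix.transpose_apply, lor_smul_right, inducedMetric_apply]
    congr 1
    exact Finset.sum_congr rfl fun j _ => mul_comm _ _
  have h2 := (Matrix.mul_eq_one_comm_of_card_eq _ _ _ hκ).1 h1
  rw [Matrix.mul_assoc] at h2
  rw [Matrix.inv_eq_right_inv h2]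
  rfl

omit hh hi in
/-- The trace of a bilinear map with respect to the induced metric. -/
theorem sum_inv_smul {W : Type*} [AddCommGroup W] [Module ℝ W] {κ : Type*} [Fintype κ]
    [DecidableEq κ] (u : κ → V) (hκ : Fintype.card κ = Fintype.card ι)
    (hu : ∀ a c, lor (fderiv ℝ f y (u a)) (fderiv ℝ f y (u c)) = if a = c then 1 else 0)
    (B : V →ₗ[ℝ] V →ₗ[ℝ] W) :
    ∑ i, ∑ j, (inducedMetric b f y)⁻¹ i j • B (b i) (b j) = ∑ a, B (u a) (u a) := by
  simp only [bilin_eq_sum b B (u _), inv_inducedMetric_apply b u hκ hu, Finset.sum_smul]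
  rw [Finset.sum_congr rfl fun i _ => Finset.sum_comm, Finset.sum_comm]

/-- This is the Gauss equation contracted twice in an orthonormal frame: the squared length of the
trace of the second fundamental form, minus its squared norm, minus the contribution of the ambient
curvature `-1`. -/
theorem scalarCurvature_eq (hf : ContDiffAt ℝ 3 f y) {κ : Type*} [Fintype κ]
    [DecidableEq κ] (u : κ → V) (hκ : Fintype.card κ = Fintype.card ι)
    (hu : ∀ a c, lor (fderiv ℝ f y (u a)) (fderiv ℝ f y (u c)) = if a = c then 1 else 0) :
    scalarCurvature b (inducedMetric b f) y =
      lor (∑ a, sff b f y (u a) (u a)) (∑ a, sff b f y (u a) (u a)) -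
        ∑ a, ∑ c, lor (sff b f y (u a) (u c)) (sff b f y (u c) (u a)) -
        ((Fintype.card κ : ℝ) ^ 2 - Fintype.card κ) := by
  have inner : ∀ j k, ∑ i, riemann b (inducedMetric b f) y i i j k =
      ∑ a, gaussForm b f y (u a) (b j) (b k) (u a) := by
    intro j k
    simp only [riemann_eq b hh hi hf]
    exact sum_inv_smul b u hκ hu (LinearMap.mk₂ ℝ (fun X W => gaussForm b f y X (b j) (b k) W)
      (by intros; simp only [gaussForm, map_add, LinearMap.add_apply, lor_add_left, lor_add_right]; ring)
      (by intros; simp only [gaussForm, map_smul, LinearMap.smul_apply, lor_smul_left, lor_smul_right,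
            smul_eq_mul]; ring)
      (by intros; simp only [gaussForm, map_add, LinearMap.add_apply, lor_add_left, lor_add_right]; ring)
      (by intros; simp only [gaussForm, map_smul, LinearMap.smul_apply, lor_smul_left, lor_smul_right,
            smul_eq_mul]; ring))
  have outer : scalarCurvature b (inducedMetric b f) y =
      ∑ c, ∑ a, gaussForm b f y (u a) (u c) (u c) (u a) := by
    simp only [scalarCurvature, inner]
    exact sum_inv_smul b u hκ hu
      (LinearMap.mk₂ ℝ (fun Y Z => ∑ a, gaussForm b f y (u a) Y Z (u a))
      (by
        intros; rw [← Finset.sum_add_distrib]; refine Finset.sum_congr rfl fun a _ => ?_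
        simp only [gaussForm, map_add, LinearMap.add_apply, lor_add_left, lor_add_right]; ring)
      (by
        intros; rw [smul_eq_mul, Finset.mul_sum]; refine Finset.sum_congr rfl fun a _ => ?_
        simp only [gaussForm, map_smul, LinearMap.smul_apply, lor_smul_left, lor_smul_right,
            smul_eq_mul]; ring)
      (by
        intros; rw [← Finset.sum_add_distrib]; refine Finset.sum_congr rfl fun a _ => ?_
        simp only [gaussForm, map_add, LinearMap.add_apply, lor_add_left, lor_add_right]; ring)
      (by
        intros; rw [smul_eq_mul, Finset.mul_sum]; refine Finset.sum_congr rfl fun a _ => ?_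
        simp only [gaussForm, map_smul, LinearMap.smul_apply, lor_smul_left, lor_smul_right,
            smul_eq_mul]; ring))
  rw [outer]
  simp only [gaussForm, hu, Finset.sum_sub_distrib, lor_sum_left, lor_sum_right]
  exact congrArg₂ HSub.hSub (congrArg₂ HSub.hSub Finset.sum_comm Finset.sum_comm) (by simp [sq])

end Immersion

theorem D2_comp {U : Type*} [NormedAddCommGroup U] [NormedSpace ℝ U] {f : V → LorentzSpace n}
    {ψ : U → V} {y : U} (hf : ContDiffAt ℝ 2 f (ψ y)) (hψ : ContDiffAt ℝ 2 ψ y) (X Y : U) :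
    D2 (f ∘ ψ) y X Y = D2 f (ψ y) (fderiv ℝ ψ y X) (fderiv ℝ ψ y Y) +
      fderiv ℝ f (ψ y) (fderiv ℝ (fderiv ℝ ψ) y X Y) := by
  have hev : fderiv ℝ (f ∘ ψ) =ᶠ[𝓝 y] fun z => (fderiv ℝ f (ψ z)).comp (fderiv ℝ ψ z) := by
    filter_upwards [hψ.eventually (by simp),
      hψ.continuousAt.eventually (hf.eventually (by simp))] with z hz hfz
    exact fderiv_comp z (hfz.differentiableAt (by simp)) (hz.differentiableAt (by simp))
  have h1 : DifferentiableAt ℝ (fderiv ℝ f) (ψ y) :=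
    (contDiffAt_fderiv (m := 1) hf (by norm_num)).differentiableAt (by simp)
  have h2 : DifferentiableAt ℝ (fderiv ℝ ψ) y :=
    (contDiffAt_fderiv (m := 1) hψ (by norm_num)).differentiableAt (by simp)
  have h3 := (h1.hasFDerivAt.comp y (hψ.differentiableAt (by simp)).hasFDerivAt).clm_comp
    h2.hasFDerivAt
  rw [D2, hev.fderiv_eq]
  change fderiv ℝ (fun z => ((fderiv ℝ f ∘ ψ) z).comp (fderiv ℝ ψ z)) y X Y = _
  rw [h3.fderiv]
  simp [D2, add_comm]

end Local

theorem three_le_infty : (3 : WithTop ℕ∞) ≤ ((⊤ : ℕ∞) : WithTop ℕ∞) :=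
  WithTop.coe_le_coe.2 (le_top : (3 : ℕ∞) ≤ ⊤)

theorem two_le_infty : (2 : WithTop ℕ∞) ≤ ((⊤ : ℕ∞) : WithTop ℕ∞) :=
  WithTop.coe_le_coe.2 (le_top : (2 : ℕ∞) ≤ ⊤)

/-! ### Immersed submanifolds in charts -/

section Charts

variable {n : ℕ} {V : Type*} [NormedAddCommGroup V] [NormedSpace ℝ V] [FiniteDimensional ℝ V]
  {H : Type*} [TopologicalSpace H] {I : ModelWithCorners ℝ V H} [I.Boundaryless]
  {P : Type*} [TopologicalSpace P] [ChartedSpace H P]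
  {F : P → LorentzSpace n}

theorem mfderiv_eq_fderiv_rep (hF : ContMDiff I 𝓘(ℝ, LorentzSpace n) ∞ F) (z : P) :
    (mfderiv I 𝓘(ℝ, LorentzSpace n) F z : V →L[ℝ] LorentzSpace n) =
      fderiv ℝ (rep I F z) (extChartAt I z z) := by
  have h : MDifferentiableAt I 𝓘(ℝ, LorentzSpace n) F z := (hF z).mdifferentiableAt (by simp)
  rw [h.mfderiv, I.range_eq_univ, fderivWithin_univ]
  rfl

variable [IsManifold I ∞ P]

theorem contDiffAt_rep (hF : ContMDiff I 𝓘(ℝ, LorentzSpace n) ∞ F) (z : P) {y : V}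
    (hy : y ∈ (extChartAt I z).target) : ContDiffAt ℝ ∞ (rep I F z) y := by
  have h1 := hF.comp_contMDiffOn (contMDiffOn_extChartAt_symm (n := ∞) (I := I) z)
  exact (contMDiffOn_iff_contDiffOn.1 h1).contDiffAt ((isOpen_extChartAt_target z).mem_nhds hy)

theorem contDiffAt_extChartAt_comp_symm (z : P) {y : V} (hy : y ∈ (extChartAt I z).target) (z' : P)
    (hz' : (extChartAt I z).symm y ∈ (extChartAt I z').source) :
    ContDiffAt ℝ ∞ (extChartAt I z' ∘ (extChartAt I z).symm) y := by
  have h1 : ContMDiffAt 𝓘(ℝ, V) I ∞ (extChartAt I z).symm y :=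
    (contMDiffOn_extChartAt_symm (n := ∞) (I := I) z).contMDiffAt
      ((isOpen_extChartAt_target z).mem_nhds hy)
  have h2 : ContMDiffAt I 𝓘(ℝ, V) ∞ (extChartAt I z') ((extChartAt I z).symm y) :=
    contMDiffAt_extChartAt' (by simpa using hz')
  exact (h2.comp y h1).contDiffAt

/-- Change of charts for the map `F` near a point of the domain of the chart at `z`. -/
theorem exists_chart_change (F : P → LorentzSpace n) (z : P) {y : V}
    (hy : y ∈ (extChartAt I z).target) :
    ∃ ψ : V → V, ContDiffAt ℝ ∞ ψ (extChartAt I ((extChartAt I z).symm y) ((extChartAt I z).symm y)) ∧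
      ψ (extChartAt I ((extChartAt I z).symm y) ((extChartAt I z).symm y)) = y ∧
      rep I F ((extChartAt I z).symm y) =ᶠ[𝓝 (extChartAt I ((extChartAt I z).symm y)
        ((extChartAt I z).symm y))] rep I F z ∘ ψ := by
  set q := (extChartAt I z).symm y with hq
  have hs : q ∈ (extChartAt I z).source := (extChartAt I z).map_target hy
  refine ⟨extChartAt I z ∘ (extChartAt I q).symm, ?_, ?_, ?_⟩
  · exact contDiffAt_extChartAt_comp_symm q (mem_extChartAt_target q) z (by simpa using hs)
  · rw [Function.comp_apply, extChartAt_to_inv, hq, (extChartAt I z).right_inv hy]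
  · have hc : ContinuousAt (extChartAt I q).symm (extChartAt I q q) := continuousAt_extChartAt_symm q
    have hn : (extChartAt I z).source ∈ 𝓝 ((extChartAt I q).symm (extChartAt I q q)) := by
      rw [extChartAt_to_inv]
      exact (isOpen_extChartAt_source z).mem_nhds hs
    filter_upwards [hc hn] with w hw
    simp only [rep, Function.comp_apply]
    rw [(extChartAt I z).left_inv hw]

theorem fderiv_injective_of_comp {f f' : V → LorentzSpace n} {ψ : V → V} {y : V}
    (hf : DifferentiableAt ℝ f (ψ y)) (hψ : DifferentiableAt ℝ ψ y) (he : f' =ᶠ[𝓝 y] f ∘ ψ)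
    (hi : Function.Injective (fderiv ℝ f' y)) :
    fderiv ℝ f' y = (fderiv ℝ f (ψ y)).comp (fderiv ℝ ψ y) ∧
      Function.Surjective (fderiv ℝ ψ y) ∧ Function.Injective (fderiv ℝ f (ψ y)) := by
  have h1 : fderiv ℝ f' y = (fderiv ℝ f (ψ y)).comp (fderiv ℝ ψ y) := by
    rw [he.fderiv_eq, fderiv_comp y hf hψ]
  have h2 : Function.Injective (fderiv ℝ ψ y) := by
    intro a c hac
    apply hi
    rw [h1, ContinuousLinearMap.comp_apply, hac, ContinuousLinearMap.comp_apply]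
  have h3 : Function.Surjective (fderiv ℝ ψ y) :=
    LinearMap.surjective_of_injective (f := (fderiv ℝ ψ y).toLinearMap) h2
  refine ⟨h1, h3, fun a c hac => ?_⟩
  obtain ⟨a, rfl⟩ := h3 a
  obtain ⟨c, rfl⟩ := h3 c
  congr 1
  apply hi
  rw [h1]; exact hac

/-- The second derivative of the change of coordinates `ψ` enters only through `fderiv ℝ f`, that
is, tangentially. Hence the normal part of the second derivative is tensorial. -/
theorem IsNormalPart.of_comp {f f' : V → LorentzSpace n} {ψ : V → V} {y : V}
    (hf : ContDiffAt ℝ 2 f (ψ y)) (hψ : ContDiffAt ℝ 2 ψ y) (he : f' =ᶠ[𝓝 y] f ∘ ψ)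
    (hi : Function.Injective (fderiv ℝ f' y)) {X Y : V} {w : LorentzSpace n}
    (h : IsNormalPart f' y X Y w) :
    IsNormalPart f (ψ y) (fderiv ℝ ψ y X) (fderiv ℝ ψ y Y) w := by
  obtain ⟨h1, h3, -⟩ := fderiv_injective_of_comp (hf.differentiableAt (by simp))
    (hψ.differentiableAt (by simp)) he hi
  obtain ⟨r, Z, hZ⟩ := h.decomp
  have hy : f' y = f (ψ y) := he.eq_of_nhds
  refine ⟨hy ▸ h.perp, fun Z => ?_, r,
    fderiv ℝ ψ y Z - fderiv ℝ (fderiv ℝ ψ) y X Y, ?_⟩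
  · obtain ⟨Z, rfl⟩ := h3 Z
    have := h.perp_fderiv Z
    rwa [h1] at this
  · have h4 := D2_comp hf hψ X Y
    have h5 : D2 f' y X Y = D2 (f ∘ ψ) y X Y := by
      simp only [D2]; rw [(he.fderiv (𝕜 := ℝ)).fderiv_eq]
    rw [← h5, hZ, h1, hy, ContinuousLinearMap.comp_apply] at h4
    rw [map_sub, ← sub_eq_iff_eq_add.2 h4]
    abel

end Charts

/-! ### Umbilical immersions in coordinates -/

section UmbilicalLocal

variable {n : ℕ} {V : Type*} [NormedAddCommGroup V] [NormedSpace ℝ V]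
  {ι : Type*} [Fintype ι] [DecidableEq ι]

/-- `f` is an umbilical immersion of `s` into hyperbolic space with mean curvature vector `η` of
squared length `1 + c`. -/
structure IsUmbilicalOn (b : Module.Basis ι ℝ V) (f : V → LorentzSpace n) (s : Set V)
    (η : V → LorentzSpace n) (c : ℝ) : Prop where
  hyp : ∀ z, lor (f z) (f z) = -1
  smooth : ∀ y ∈ s, ContDiffAt ℝ 3 f y
  injective : ∀ y ∈ s, Function.Injective (fderiv ℝ f y)
  umbilical : ∀ y ∈ s, ∀ X Y, sff b f y X Y = lor (fderiv ℝ f y X) (fderiv ℝ f y Y) • η y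
  perp : ∀ y ∈ s, lor (η y) (f y) = 0
  perp_fderiv : ∀ y ∈ s, ∀ X, lor (η y) (fderiv ℝ f y X) = 0
  normSq : ∀ y ∈ s, lor (η y) (η y) = 1 + c

namespace IsUmbilicalOn

variable {b : Module.Basis ι ℝ V} {f : V → LorentzSpace n} {s : Set V}
  {η : V → LorentzSpace n} {c : ℝ} (h : IsUmbilicalOn b f s η c)

include h

theorem D2_eq {y : V} (hy : y ∈ s) (i j : ι) :
    D2 f y (b i) (b j) = inducedMetric b f y i j • (η y + f y) +
      fderiv ℝ f y (nablaCoord b f y i j) := by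
  rw [secondFFCoord_eq b ((h.smooth y hy).of_le (by norm_num)), ← sff_basis, h.umbilical y hy,
    smul_add]
  rfl

theorem diag_pos {y : V} (hy : y ∈ s) (i : ι) : 0 < inducedMetric b f y i i :=
  lor_fderiv_pos h.hyp ((h.smooth y hy).differentiableAt (by simp)) (h.injective y hy) (b.ne_zero i)

/-- The nonzero vector `g_jj • b i - g_ji • b j` has squared length `g_jj` times the Gram
determinant. -/
theorem det_pos {y : V} (hy : y ∈ s) {i j : ι} (hij : i ≠ j) :
    0 < inducedMetric b f y i i * inducedMetric b f y j j - inducedMetric b f y j i ^ 2 := by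
  have hX : inducedMetric b f y j j • b i - inducedMetric b f y j i • b j ≠ 0 := by
    intro h0
    have h1 := congrArg (fun v => b.repr v i) h0
    simp [hij.symm] at h1
    exact (h.diag_pos hy j).ne' h1
  have h1 := lor_fderiv_pos h.hyp ((h.smooth y hy).differentiableAt (by simp))
    (h.injective y hy) hX
  have h2 := h.diag_pos hy j
  simp only [map_sub, map_smul, lor_sub_left, lor_sub_right, lor_smul_left, lor_smul_right,
    lor_comm (fderiv ℝ f y (b i)) (fderiv ℝ f y (b j))] at h1
  simp only [← inducedMetric_apply] at h1
  have h3 : 0 < inducedMetric b f y j j *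
    (inducedMetric b f y i i * inducedMetric b f y j j - inducedMetric b f y j i ^ 2) := by
    linarith
  exact (pos_iff_pos_of_mul_pos h3).1 h2

variable (hs : IsOpen s)

include hs

/-- No regularity of `η` is assumed. It is obtained by solving the Gauss formula for `b i`, `b i`
for `η + f`, where the coefficient `g_ii` is positive. -/
theorem differentiableAt_add [Nonempty ι] {y : V} (hy : y ∈ s) :
    DifferentiableAt ℝ (fun z => η z + f z) y := by
  obtain ⟨i⟩ := ‹Nonempty ι›
  have hf := h.smooth y hy
  have he : (fun z => η z + f z) =ᶠ[𝓝 y] fun z => (inducedMetric b f z i i)⁻¹ •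
      (pderiv b i (pderiv b i f) z -
        ∑ k, christoffel b (inducedMetric b f) z k i i • pderiv b k f z) := by
    filter_upwards [hs.mem_nhds hy] with z hz
    rw [pderiv_pderiv ((h.smooth z hz).of_le (by norm_num)), h.D2_eq hz, nablaCoord, map_sum]
    simp only [map_smul, pderiv, add_sub_cancel_right]
    rw [smul_smul, inv_mul_cancel₀ (h.diag_pos hz i).ne', one_smul]
  have hp : ∀ k, ContDiffAt ℝ 2 (pderiv b k f) y := fun k => contDiffAt_pderiv b k hf (by norm_num)
  have hd : ContDiffAt ℝ 1 (fun z => (inducedMetric b f z i i)⁻¹ •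
      (pderiv b i (pderiv b i f) z -
        ∑ k, christoffel b (inducedMetric b f) z k i i • pderiv b k f z)) y := by
    refine ((contDiffAt_inducedMetric (m := 1) b hf (by norm_num) i i).inv
      (h.diag_pos hy i).ne').smul ((contDiffAt_pderiv b i (hp i) (by norm_num)).sub ?_)
    exact ContDiffAt.sum fun k _ => (contDiffAt_christoffel b h.hyp (h.injective y hy) hf k i i).smul
      ((hp k).of_le (by norm_num))
  exact he.differentiableAt_iff.2 (hd.differentiableAt (by simp))

/-- A Codazzi argument: differentiating the Gauss formula expresses `g_ij • ∂_r (η + f)`, modulo the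
space `W`, as a third derivative of `f`, which is symmetric in `r` and `i`. Two different indices
then suffice to isolate one derivative of `η + f`. -/
theorem fderiv_add_mem [Nontrivial ι] {y : V} (hy : y ∈ s) (i : ι) :
    fderiv ℝ (fun z => η z + f z) y (b i) ∈
      (Submodule.span ℝ {η y + f y} ⊔ LinearMap.range (fderiv ℝ f y).toLinearMap) := by
  set W := (Submodule.span ℝ {η y + f y} ⊔ LinearMap.range (fderiv ℝ f y).toLinearMap)
  have hf := h.smooth y hy
  have hf2 : ContDiffAt ℝ 2 f y := hf.of_le (by norm_num)
  have hW1 : η y + f y ∈ W := Submodule.mem_sup_left (Submodule.mem_span_singleton_self _)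
  have hW2 : ∀ X, fderiv ℝ f y X ∈ W := fun X => Submodule.mem_sup_right ⟨X, rfl⟩
  have hW3 : ∀ i j, D2 f y (b i) (b j) ∈ W := fun i j => by
    rw [h.D2_eq hy]; exact W.add_mem (W.smul_mem _ hW1) (hW2 _)
  have hζ := h.differentiableAt_add hs hy
  have hp : ∀ k, ContDiffAt ℝ 2 (pderiv b k f) y := fun k => contDiffAt_pderiv b k hf (by norm_num)
  have hg : ∀ i j, DifferentiableAt ℝ (fun z => inducedMetric b f z i j) y := fun i j =>
    (contDiffAt_inducedMetric (m := 1) b hf (by norm_num) i j).differentiableAt (by simp)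
  have hΓ : ∀ k i j, DifferentiableAt ℝ (fun z => christoffel b (inducedMetric b f) z k i j) y :=
    fun k i j => (contDiffAt_christoffel b h.hyp (h.injective y hy) hf k i j).differentiableAt
      (by simp)
  have key : ∀ r i j, inducedMetric b f y i j • fderiv ℝ (fun z => η z + f z) y (b r) -
      D2 (pderiv b j f) y (b r) (b i) ∈ W := by
    intro r i j
    have he : pderiv b i (pderiv b j f) =ᶠ[𝓝 y] fun z => inducedMetric b f z i j • (η z + f z) +
        ∑ k, christoffel b (inducedMetric b f) z k i j • pderiv b k f z := by
      filter_upwards [hs.mem_nhds hy] with z hz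
      rw [pderiv_pderiv ((h.smooth z hz).of_le (by norm_num)), h.D2_eq hz, nablaCoord, map_sum]
      simp only [map_smul, pderiv]
    have hA := (hg i j).hasFDerivAt.fun_smul hζ.hasFDerivAt
    have hB := HasFDerivAt.fun_sum (u := Finset.univ) fun k _ =>
      (hΓ k i j).hasFDerivAt.fun_smul ((hp k).differentiableAt (by simp)).hasFDerivAt
    have h1 := congrArg (fun T => T (b r)) (he.fderiv_eq.trans (hA.fun_add hB).fderiv)
    simp only [add_apply, sum_apply, smul_apply, ContinuousLinearMap.smulRight_apply] at h1
    have h2 : fderiv ℝ (pderiv b i (pderiv b j f)) y (b r) = D2 (pderiv b j f) y (b r) (b i) :=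
      pderiv_pderiv (hp j) b r i
    rw [h2] at h1
    rw [h1, add_assoc, sub_add_eq_sub_sub, sub_self, zero_sub]
    refine W.neg_mem (W.add_mem (W.smul_mem _ hW1) (W.sum_mem fun k _ => W.add_mem ?_ ?_))
    · refine W.smul_mem _ ?_
      have h3 : fderiv ℝ (pderiv b k f) y (b r) = D2 f y (b r) (b k) := pderiv_pderiv hf2 b r k
      rw [h3]; exact hW3 _ _
    · exact W.smul_mem _ (hW2 _)
  obtain ⟨j, hj⟩ := exists_ne i
  have h1 : ∀ r i j, inducedMetric b f y i j • fderiv ℝ (fun z => η z + f z) y (b r) -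
      inducedMetric b f y r j • fderiv ℝ (fun z => η z + f z) y (b i) ∈ W := by
    intro r i j
    have := W.sub_mem (key r i j) (key i r j)
    rw [D2_symm (hp j) (b i) (b r)] at this
    convert this using 1
    abel
  have hd := h.det_pos hy hj
  -- The combination eliminates the derivative along `b j` and leaves the derivative along `b i`
  -- multiplied by the Gram determinant.
  have h2 := W.add_mem (W.smul_mem (inducedMetric b f y i i) (h1 i j j))
    (W.smul_mem (inducedMetric b f y i j) (h1 j i i))
  have h3 : (inducedMetric b f y j j * inducedMetric b f y i i - inducedMetric b f y i j ^ 2) •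
      fderiv ℝ (fun z => η z + f z) y (b i) ∈ W := by
    convert h2 using 1
    rw [show inducedMetric b f y j i = inducedMetric b f y i j from lor_comm _ _]
    module
  exact (W.smul_mem_iff hd.ne').1 h3

/-- The vector `η + (1 + c) f` is constant for an umbilical immersion. -/
theorem hasFDerivAt_zero [Nontrivial ι] {y : V} (hy : y ∈ s) :
    HasFDerivAt (fun z => η z + (1 + c) • f z) (0 : V →L[ℝ] LorentzSpace n) y := by
  have hf := h.smooth y hy
  have hf2 : ContDiffAt ℝ 2 f y := hf.of_le (by norm_num)
  have hfd := hf.differentiableAt (by simp)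
  have hζ := h.differentiableAt_add hs hy
  have e0 : (fun z => η z + (1 + c) • f z) = fun z => (η z + f z) + c • f z := by
    funext z; module
  rw [e0]
  refine (hζ.hasFDerivAt.add (hfd.hasFDerivAt.const_smul c)).congr_fderiv ?_
  have : FiniteDimensional ℝ V := b.finiteDimensional_of_finite
  refine ContinuousLinearMap.coe_injective (b.ext fun i => ?_)
  simp only [ContinuousLinearMap.coe_coe, add_apply, smul_apply, zero_apply]
  -- The derivative of `η + f` along `b i` is `r • (η + f)` plus the tangent vector of `v`. Pairing
  -- with `f` gives `r = 0`. Pairing with the tangent vectors, where `⟨η + f, η + f⟩ = c` enters,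
  -- gives that `v` is `-c • b i`.
  obtain ⟨w, hw, t, ⟨v, rfl⟩, hv⟩ := Submodule.mem_sup.1 (h.fderiv_add_mem hs hy i)
  obtain ⟨r, rfl⟩ := Submodule.mem_span_singleton.1 hw
  simp only [ContinuousLinearMap.coe_coe] at hv
  have q1 : ∀ X, lor (f y) (fderiv ℝ f y X) = 0 := fun X => by
    rw [lor_comm, lor_fderiv_self h.hyp hfd]
  have q2 : lor (f y) (η y) = 0 := by rw [lor_comm, h.perp y hy]
  have p1 : lor (fderiv ℝ (fun z => η z + f z) y (b i)) (f y) = 0 := by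
    have he : (fun z => lor (η z + f z) (f z)) =ᶠ[𝓝 y] fun _ => -1 := by
      filter_upwards [hs.mem_nhds hy] with z hz
      rw [lor_add_left, h.perp z hz, h.hyp, zero_add]
    have h1 := DFunLike.congr_fun (he.fderiv_eq (𝕜 := ℝ)) (b i)
    rw [fderiv_lor hζ hfd] at h1
    simp only [fderiv_fun_const, Pi.zero_apply, zero_apply, lor_add_left,
      h.perp_fderiv y hy, q1] at h1
    linarith
  have hr : r = 0 := by
    rw [← hv, lor_add_left, lor_smul_left, lor_add_left, h.perp y hy, h.hyp,
      lor_fderiv_self h.hyp hfd] at p1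
    linarith
  have p2 : ∀ l, lor (fderiv ℝ (fun z => η z + f z) y (b i)) (fderiv ℝ f y (b l)) =
      -(c * inducedMetric b f y i l) := by
    intro l
    have he : (fun z => lor (η z + f z) (fderiv ℝ f z (b l))) =ᶠ[𝓝 y] fun _ => 0 := by
      filter_upwards [hs.mem_nhds hy] with z hz
      rw [lor_add_left, h.perp_fderiv z hz, lor_comm,
        lor_fderiv_self h.hyp ((h.smooth z hz).differentiableAt (by simp)), zero_add]
    have hd : DifferentiableAt ℝ (fun z => fderiv ℝ f z (b l)) y :=
      (contDiffAt_pderiv (m := 1) b l hf (by norm_num)).differentiableAt (by simp)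
    have h1 := DFunLike.congr_fun (he.fderiv_eq (𝕜 := ℝ)) (b i)
    have h2 : fderiv ℝ (fun z => fderiv ℝ f z (b l)) y (b i) = D2 f y (b i) (b l) :=
      fderiv_fderiv_apply hf2 _ _
    rw [fderiv_lor hζ hd, h2, h.D2_eq hy] at h1
    simp only [fderiv_fun_const, Pi.zero_apply, zero_apply, lor_add_right, lor_smul_right,
      lor_add_left, h.perp_fderiv y hy, q1, q2, h.perp y hy, h.hyp, h.normSq y hy] at h1
    linarith
  have hv' : fderiv ℝ f y (v + c • b i) = 0 := by
    refine lor_self_eq_zero (h.hyp y) (lor_fderiv_self h.hyp hfd _) ?_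
    have h4 : ∀ l, lor (fderiv ℝ f y (b l)) (fderiv ℝ f y (v + c • b i)) = 0 := by
      intro l
      have h3 := p2 l
      rw [← hv, hr, zero_smul, zero_add] at h3
      rw [map_add, map_smul, lor_add_right, lor_smul_right, lor_comm _ (fderiv ℝ f y v), h3,
        lor_comm, inducedMetric_apply]
      ring
    rw [show lor (fderiv ℝ f y (v + c • b i)) (fderiv ℝ f y (v + c • b i)) =
      lor (∑ l, b.repr (v + c • b i) l • fderiv ℝ f y (b l)) (fderiv ℝ f y (v + c • b i)) by
        rw [← fderiv_eq_sum], lor_sum_left]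
    exact Finset.sum_eq_zero fun l _ => by rw [lor_smul_left, h4, mul_zero]
  rw [← hv, hr, zero_smul, zero_add, ← map_smul, ← map_add, hv']

omit hs in
-- The hypothesis trades `lor w (η y)` for `-(1 + c) * lor w (f y)`. So the functions `lor w f` and
-- `lor w (∂_k f)` satisfy a closed homogeneous linear first-order system.
theorem lor_D2_of_perp {w : LorentzSpace n} {y : V} (hy : y ∈ s)
    (hw : lor w (η y + (1 + c) • f y) = 0) (i j : ι) :
    lor w (D2 f y (b i) (b j)) = -(c * inducedMetric b f y i j) * lor w (f y) +
      ∑ k, christoffel b (inducedMetric b f) y k i j * lor w (pderiv b k f y) := by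
  rw [h.D2_eq hy, nablaCoord, map_sum, lor_add_right, lor_smul_right, lor_sum_right]
  simp only [map_smul, lor_smul_right, pderiv]
  rw [lor_add_right, lor_smul_right] at hw
  rw [lor_add_right]
  congr 1
  linear_combination (inducedMetric b f y i j) * hw

omit hs in
/-- A vector orthogonal to `η + (1 + c) f` that is normal at one point is normal everywhere. -/
theorem perp_of_perp (hconv : Convex ℝ s) {w : LorentzSpace n}
    (hw : ∀ y ∈ s, lor w (η y + (1 + c) • f y) = 0) {p q : V} (hp : p ∈ s) (hq : q ∈ s)
    (h0 : lor w (f p) = 0) (h1 : ∀ X, lor w (fderiv ℝ f p X) = 0) :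
    lor w (f q) = 0 ∧ ∀ X, lor w (fderiv ℝ f q X) = 0 := by
  set γ : ℝ → V := fun t => p + t • (q - p) with hγ
  have hγs : ∀ t ∈ Set.Icc (0 : ℝ) 1, γ t ∈ s := fun t ht =>
    hconv.add_smul_sub_mem hp hq ht
  have hγd : ∀ t, HasDerivAt γ (q - p) t := fun t =>
    (((hasDerivAt_id t).smul_const (q - p)).const_add p).congr_deriv (one_smul _ _)
  have hγc : Continuous γ := continuous_iff_continuousAt.2 fun t => (hγd t).continuousAt
  set v : ι → ℝ := fun r => b.repr (q - p) r with hv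
  have hvs : q - p = ∑ r, v r • b r := (b.sum_repr _).symm
  -- Along the segment from `p` to `q` these functions solve a homogeneous linear system with zero
  -- initial value, so they vanish by Grönwall's inequality.
  let ψ : ℝ → ℝ × (ι → ℝ) := fun t => (lor w (f (γ t)), fun i => lor w (pderiv b i f (γ t)))
  let ψ' : ℝ → ℝ × (ι → ℝ) := fun t => (lor w (fderiv ℝ f (γ t) (q - p)),
    fun i => lor w (D2 f (γ t) (q - p) (b i)))
  have hψ : ∀ t ∈ Set.Icc (0 : ℝ) 1, HasDerivAt ψ (ψ' t) t := by
    intro t ht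
    have hf := h.smooth _ (hγs t ht)
    have hlor : ∀ {u : ℝ → LorentzSpace n} {u' : LorentzSpace n}, HasDerivAt u u' t →
        HasDerivAt (fun t => lor w (u t)) (lor w u') t := fun hu =>
      (lorL n w).hasFDerivAt.comp_hasDerivAt t hu
    refine HasDerivAt.prodMk ?_ (hasDerivAt_pi.2 fun i => ?_)
    · exact hlor ((hf.differentiableAt (by simp)).hasFDerivAt.comp_hasDerivAt t (hγd t))
    · have hd : HasFDerivAt (pderiv b i f) (fderiv ℝ (pderiv b i f) (γ t)) (γ t) :=
        ((contDiffAt_pderiv (m := 1) b i hf (by norm_num)).differentiableAt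
          (by simp)).hasFDerivAt
      have := hlor (hd.comp_hasDerivAt t (hγd t))
      rwa [show fderiv ℝ (pderiv b i f) (γ t) (q - p) = D2 f (γ t) (q - p) (b i) from
        fderiv_fderiv_apply (hf.of_le (by norm_num)) _ _] at this
  -- A continuous bound for the coefficients of the system; the summand `1` accounts for the
  -- derivative of `lor w f`, which is a combination of the `lor w (∂_r f)`.
  let M : ℝ → ℝ := fun t => ∑ r, |v r| * (1 + ∑ i, (|c * inducedMetric b f (γ t) r i| +
    ∑ k, |christoffel b (inducedMetric b f) (γ t) k r i|))
  have hM : ContinuousOn M (Set.Icc 0 1) := by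
    intro t ht
    have hf := h.smooth _ (hγs t ht)
    have hg : ∀ i j, ContinuousAt (fun t => inducedMetric b f (γ t) i j) t := fun i j =>
      ContinuousAt.comp (f := γ) (g := fun z => inducedMetric b f z i j)
        (contDiffAt_inducedMetric (m := 1) b hf (by norm_num) i j).continuousAt hγc.continuousAt
    have hΓ : ∀ k i j, ContinuousAt (fun t => christoffel b (inducedMetric b f) (γ t) k i j) t :=
      fun k i j => ContinuousAt.comp (f := γ)
        (g := fun z => christoffel b (inducedMetric b f) z k i j)
        (contDiffAt_christoffel b h.hyp (h.injective _ (hγs t ht)) hf k i j).continuousAt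
        hγc.continuousAt
    refine ContinuousAt.continuousWithinAt (tendsto_finsetSum _ fun r _ =>
      continuousAt_const.mul (continuousAt_const.add (tendsto_finsetSum _ fun i _ =>
        ((continuousAt_const.mul (hg r i)).abs).add
          (tendsto_finsetSum _ fun k _ => (hΓ k r i).abs))))
  obtain ⟨K, hK⟩ := isCompact_Icc.exists_bound_of_continuousOn hM
  have hbound : ∀ t ∈ Set.Ico (0 : ℝ) 1, ‖ψ' t‖ ≤ K * ‖ψ t‖ + 0 := by
    intro t ht
    have ht' := Set.Ico_subset_Icc_self ht
    have hMK : M t ≤ K := (le_abs_self _).trans (hK t ht')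
    have hn0 : |lor w (f (γ t))| ≤ ‖ψ t‖ := norm_fst_le (ψ t)
    have hn1 : ∀ k, |lor w (pderiv b k f (γ t))| ≤ ‖ψ t‖ := fun k =>
      (norm_le_pi_norm (ψ t).2 k).trans (norm_snd_le (ψ t))
    have hnn := norm_nonneg (ψ t)
    have hsum : ∀ r i, |c * inducedMetric b f (γ t) r i| +
        ∑ k, |christoffel b (inducedMetric b f) (γ t) k r i| ≤
        ∑ i, (|c * inducedMetric b f (γ t) r i| +
          ∑ k, |christoffel b (inducedMetric b f) (γ t) k r i|) := fun r i =>
      Finset.single_le_sum (f := fun i => |c * inducedMetric b f (γ t) r i| +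
          ∑ k, |christoffel b (inducedMetric b f) (γ t) k r i|)
        (fun i _ => by positivity) (Finset.mem_univ i)
    rw [add_zero]
    refine le_trans ?_ (mul_le_mul_of_nonneg_right hMK hnn)
    have hMnn : 0 ≤ M t * ‖ψ t‖ := mul_nonneg
      (Finset.sum_nonneg fun r _ => by positivity) hnn
    refine max_le ?_ ((pi_norm_le_iff_of_nonneg hMnn).2 fun i => ?_)
    · change |lor w (fderiv ℝ f (γ t) (q - p))| ≤ _
      rw [hvs, map_sum, lor_sum_right, Finset.sum_mul]
      refine (Finset.abs_sum_le_sum_abs _ _).trans (Finset.sum_le_sum fun r _ => ?_)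
      rw [map_smul, lor_smul_right, abs_mul, mul_assoc]
      refine mul_le_mul_of_nonneg_left ?_ (abs_nonneg _)
      refine (hn1 r).trans (le_mul_of_one_le_left hnn ?_)
      exact le_add_of_nonneg_right (Finset.sum_nonneg fun i _ => by positivity)
    · change |lor w (D2 f (γ t) (q - p) (b i))| ≤ _
      have e1 : D2 f (γ t) (q - p) (b i) = ∑ r, v r • D2 f (γ t) (b r) (b i) := by
        rw [D2, hvs, map_sum, sum_apply]
        simp only [map_smul, smul_apply, D2]
      rw [e1, lor_sum_right, Finset.sum_mul]
      refine (Finset.abs_sum_le_sum_abs _ _).trans (Finset.sum_le_sum fun r _ => ?_)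
      rw [lor_smul_right, abs_mul, mul_assoc]
      refine mul_le_mul_of_nonneg_left ?_ (abs_nonneg _)
      rw [h.lor_D2_of_perp (hγs t ht') (hw _ (hγs t ht'))]
      calc _ ≤ |c * inducedMetric b f (γ t) r i| * ‖ψ t‖ +
            (∑ k, |christoffel b (inducedMetric b f) (γ t) k r i|) * ‖ψ t‖ := by
            refine (abs_add_le _ _).trans (add_le_add ?_ ?_)
            · rw [abs_mul, abs_neg]
              exact mul_le_mul_of_nonneg_left hn0 (abs_nonneg _)
            · rw [Finset.sum_mul]
              refine (Finset.abs_sum_le_sum_abs _ _).trans (Finset.sum_le_sum fun k _ => ?_)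
              rw [abs_mul]
              exact mul_le_mul_of_nonneg_left (hn1 k) (abs_nonneg _)
        _ = (|c * inducedMetric b f (γ t) r i| +
            ∑ k, |christoffel b (inducedMetric b f) (γ t) k r i|) * ‖ψ t‖ := by ring
        _ ≤ _ := mul_le_mul_of_nonneg_right ((hsum r i).trans (by linarith)) hnn
  have hψ0 : ‖ψ 0‖ ≤ 0 := by
    have : γ 0 = p := by simp [hγ]
    have h2 : ψ 0 = 0 := by
      refine Prod.ext ?_ (funext fun i => ?_)
      · change lor w (f (γ 0)) = 0; rw [this, h0]
      · change lor w (pderiv b i f (γ 0)) = 0; rw [this]; exact h1 _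
    rw [h2, norm_zero]
  have hgr := norm_le_gronwallBound_of_norm_deriv_right_le
    (fun t ht => (hψ t ht).continuousAt.continuousWithinAt)
    (fun t ht => (hψ t (Set.Ico_subset_Icc_self ht)).hasDerivWithinAt) hψ0 hbound 1
    (by simp)
  rw [gronwallBound_ε0_δ0] at hgr
  have hψ1 : ψ 1 = 0 := norm_le_zero_iff.1 hgr
  have hγ1 : γ 1 = q := by simp [hγ]
  have g0 : lor w (f (γ 1)) = 0 := congrArg Prod.fst hψ1
  have g1 : ∀ i, lor w (pderiv b i f (γ 1)) = 0 := fun i => congrFun (congrArg Prod.snd hψ1) i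
  rw [hγ1] at g0 g1
  refine ⟨g0, fun X => ?_⟩
  rw [fderiv_eq_sum b, lor_sum_right]
  exact Finset.sum_eq_zero fun i _ => by
    rw [lor_smul_right, show fderiv ℝ f q (b i) = pderiv b i f q from rfl, g1, mul_zero]

end IsUmbilicalOn

end UmbilicalLocal

/-! ### Normal spaces -/

section PerpSpace

variable {n : ℕ} {U : Type*} [AddCommGroup U] [Module ℝ U] [FiniteDimensional ℝ U]

/-- The Lorentz orthogonal complement of `p` and of the image of `A`. -/
def perpSpace (A : U →ₗ[ℝ] LorentzSpace n) (p : LorentzSpace n) : Submodule ℝ (LorentzSpace n) :=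
  (lorForm n).orthogonal (Submodule.span ℝ {p} ⊔ LinearMap.range A)

theorem mem_perpSpace {A : U →ₗ[ℝ] LorentzSpace n} {p w : LorentzSpace n} :
    w ∈ perpSpace A p ↔ lor w p = 0 ∧ ∀ X, lor w (A X) = 0 := by
  rw [perpSpace, LinearMap.BilinForm.mem_orthogonal_iff]
  constructor
  · intro h
    refine ⟨?_, fun X => ?_⟩
    · rw [lor_comm]; exact h p (Submodule.mem_sup_left (Submodule.mem_span_singleton_self p))
    · rw [lor_comm]; exact h _ (Submodule.mem_sup_right ⟨X, rfl⟩)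
  · rintro ⟨h1, h2⟩ v hv
    obtain ⟨a, ha, t, ⟨X, rfl⟩, rfl⟩ := Submodule.mem_sup.1 hv
    obtain ⟨r, rfl⟩ := Submodule.mem_span_singleton.1 ha
    change lor _ _ = 0
    rw [lor_add_left, lor_smul_left, lor_comm p, h1, lor_comm, h2, mul_zero, add_zero]

/-- As `p` is timelike and orthogonal to the range of `A`, the span of both has dimension one more
than `U`. The Lorentz form is nondegenerate on a space of dimension `n + 1`. -/
theorem finrank_perpSpace {A : U →ₗ[ℝ] LorentzSpace n} {p : LorentzSpace n}
    (hp : lor p p = -1) (hA : Function.Injective A) (hAp : ∀ X, lor (A X) p = 0) :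
    Module.finrank ℝ (perpSpace A p) = n - Module.finrank ℝ U := by
  rw [perpSpace, LinearMap.BilinForm.finrank_orthogonal lorForm_nondegenerate]
  have hp0 : p ≠ 0 := by rintro rfl; simp [lor] at hp
  have h1 := Submodule.finrank_sup_add_finrank_inf_eq (Submodule.span ℝ {p}) (LinearMap.range A)
  have h2 : Submodule.span ℝ {p} ⊓ LinearMap.range A = ⊥ := by
    rw [Submodule.eq_bot_iff]
    rintro v ⟨hv, X, rfl⟩
    obtain ⟨r, hr⟩ := Submodule.mem_span_singleton.1 hv
    have := hAp X
    rw [← hr, lor_smul_left, hp] at this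
    rw [← hr, show r = 0 by linarith, zero_smul]
  rw [h2, finrank_bot, add_zero, finrank_span_singleton hp0, LinearMap.finrank_range_of_inj hA] at h1
  rw [h1, Module.finrank_prod, Module.finrank_self, finrank_euclideanSpace_fin]
  omega

/-- A maximal orthonormal family of a normal space spans it. -/
theorem eq_sum_of_mem_perpSpace {A : U →ₗ[ℝ] LorentzSpace n} {p : LorentzSpace n}
    (hp : lor p p = -1) (hA : Function.Injective A) (hAp : ∀ X, lor (A X) p = 0)
    {κ : Type*} [Fintype κ] [DecidableEq κ] (hκ : Fintype.card κ + Module.finrank ℝ U = n)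
    {e : κ → LorentzSpace n} (he : ∀ j, e j ∈ perpSpace A p)
    (ho : ∀ j l, lor (e j) (e l) = if j = l then 1 else 0) {w : LorentzSpace n}
    (hw : w ∈ perpSpace A p) : w = ∑ j, lor w (e j) • e j := by
  let e' : κ → perpSpace A p := fun j => ⟨e j, he j⟩
  have hcoef : ∀ (a : κ → ℝ) l, lor (∑ j, a j • e j) (e l) = a l := by
    intro a l
    rw [lor_sum_left]
    simp [lor_smul_left, ho]
  have hli : LinearIndependent ℝ e' := by
    rw [Fintype.linearIndependent_iff]
    intro a h l
    have h1 : ∑ j, a j • e j = 0 := by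
      have := congrArg Subtype.val h
      simpa [e'] using this
    rw [← hcoef a l, h1, lor_zero_left]
  have hcard : Fintype.card κ = Module.finrank ℝ (perpSpace A p) := by
    rw [finrank_perpSpace hp hA hAp]; omega
  rcases isEmpty_or_nonempty κ with hem | hne
  · have h0 : Module.finrank ℝ (perpSpace A p) = 0 := by rw [← hcard, Fintype.card_eq_zero]
    rw [Submodule.finrank_eq_zero] at h0
    rw [h0, Submodule.mem_bot] at hw
    simp [hw]
  · obtain ⟨B, hB⟩ : ∃ B : Module.Basis κ ℝ (perpSpace A p), ∀ j, B j = e' j :=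
      ⟨basisOfLinearIndependentOfCardEqFinrank hli hcard, fun j => by simp⟩
    have h1 : w = ∑ j, B.repr ⟨w, hw⟩ j • e j := by
      have := congrArg Subtype.val (B.sum_repr ⟨w, hw⟩)
      simp only [hB] at this
      simpa [e'] using this.symm
    have h2 : ∀ l, lor w (e l) = B.repr ⟨w, hw⟩ l := fun l => by
      conv_lhs => rw [h1]
      exact hcoef _ l
    simp only [h2]
    exact h1

theorem exists_orthonormal_perpSpace {A : U →ₗ[ℝ] LorentzSpace n} {p : LorentzSpace n}
    (hp : lor p p = -1) (hA : Function.Injective A) (hAp : ∀ X, lor (A X) p = 0) {ν : ℕ}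
    (hν : ν + Module.finrank ℝ U = n) :
    ∃ e : Fin ν → LorentzSpace n, (∀ j, e j ∈ perpSpace A p) ∧
      ∀ j l, lor (e j) (e l) = if j = l then 1 else 0 := by
  have hcard : Module.finrank ℝ (perpSpace A p) = ν := by
    rw [finrank_perpSpace hp hA hAp]; omega
  obtain ⟨u, hu⟩ := exists_orthonormal_basis ((lorForm n).restrict (perpSpace A p))
    (fun x y => lor_comm _ _) (fun x hx => lor_self_pos hp (mem_perpSpace.1 x.2).1
      fun h => hx (Subtype.ext h))
  refine ⟨fun j => (u (finCongr hcard.symm j) : LorentzSpace n), fun j => (u _).2, fun j l => ?_⟩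
  have := hu (finCongr hcard.symm j) (finCongr hcard.symm l)
  simp only [EmbeddingLike.apply_eq_iff_eq] at this
  exact this

end PerpSpace

/-! ### The parallel frame of an umbilical submanifold -/

section Umbilical

variable {n : ℕ} {k : ℕ} {N : Type*} [TopologicalSpace N]
  [ChartedSpace (EuclideanSpace ℝ (Fin k)) N] {i : N → LorentzSpace n} {c : ℝ}

/-- The vectors `C j - lam j • i q` form an orthonormal frame of the normal bundle of `i`, in which
the mean curvature vector has the components `lam j`. -/
structure IsParallelFrame (k : ℕ) {N : Type*} [TopologicalSpace N]
    [ChartedSpace (EuclideanSpace ℝ (Fin k)) N] (i : N → LorentzSpace n) {ν : ℕ}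
    (C : Fin ν → LorentzSpace n) (lam : Fin ν → ℝ) : Prop where
  normal : ∀ j q, C j - lam j • i q ∈ normalSpace k i q
  orthonormal : ∀ j l q, lor (C j - lam j • i q) (C l - lam l • i q) = if j = l then 1 else 0
  umbilical : ∀ q (X Y : TangentSpace (𝓡 k) q), secondFF (𝓡 k) i q X Y =
    metricAt (𝓡 k) i q X Y • ∑ j, lam j • (C j - lam j • i q)

variable (hi : IsUmbilicalInclusion k i c)

include hi

theorem IsUmbilicalInclusion.lor_self (q : N) : lor (i q) (i q) = -1 := (hi.mem q).1

theorem IsUmbilicalInclusion.metricAt_eq (q : N) (X Y : EuclideanSpace ℝ (Fin k)) :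
    metricAt (𝓡 k) i q X Y = lor (fderiv ℝ (rep (𝓡 k) i q) (extChartAt (𝓡 k) q q) X)
      (fderiv ℝ (rep (𝓡 k) i q) (extChartAt (𝓡 k) q q) Y) := by
  unfold metricAt
  rw [mfderiv_eq_fderiv_rep hi.smooth]
  rfl

theorem IsUmbilicalInclusion.injective (q : N) :
    Function.Injective (fderiv ℝ (rep (𝓡 k) i q) (extChartAt (𝓡 k) q q)) := by
  have := hi.immersion q
  unfold IsImmersionAt at this
  rwa [mfderiv_eq_fderiv_rep hi.smooth] at this

variable [IsManifold (𝓡 k) ∞ N]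

/-- The mean curvature vector of an umbilical submanifold is normal, of squared length `1 + c`. -/
theorem IsUmbilicalInclusion.mean (hk : 2 ≤ k) {q : N} {η : LorentzSpace n}
    (hη : ∀ X Y : TangentSpace (𝓡 k) q,
      secondFF (𝓡 k) i q X Y = metricAt (𝓡 k) i q X Y • η) :
    lor η (i q) = 0 ∧
      (∀ X, lor η (fderiv ℝ (rep (𝓡 k) i q) (extChartAt (𝓡 k) q q) X) = 0) ∧
      lor η η = 1 + c := by
  set f := rep (𝓡 k) i q with hfdef
  set y := extChartAt (𝓡 k) q q with hy
  set b := Module.finBasis ℝ (EuclideanSpace ℝ (Fin k)) with hb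
  have hh : ∀ z, lor (f z) (f z) = -1 := fun z => hi.lor_self _
  have hf : ContDiffAt ℝ ∞ f y := contDiffAt_rep hi.smooth q (mem_extChartAt_target q)
  have hf3 : ContDiffAt ℝ 3 f y := hf.of_le three_le_infty
  have hf2 : ContDiffAt ℝ 2 f y := hf.of_le two_le_infty
  have hinj : Function.Injective (fderiv ℝ f y) := hi.injective q
  have hη' : ∀ X Y, sff b f y X Y = lor (fderiv ℝ f y X) (fderiv ℝ f y Y) • η := fun X Y => by
    rw [← hi.metricAt_eq]; exact hη X Y
  have hfr : Module.finrank ℝ (EuclideanSpace ℝ (Fin k)) = k := finrank_euclideanSpace_fin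
  let a0 : Fin (Module.finrank ℝ (EuclideanSpace ℝ (Fin k))) := ⟨0, by omega⟩
  let a1 : Fin (Module.finrank ℝ (EuclideanSpace ℝ (Fin k))) := ⟨1, by omega⟩
  have ha : a0 ≠ a1 := by simp [a0, a1]
  have hN := isNormalPart_sff b hh hinj hf2 (b a0) (b a0)
  rw [hη'] at hN
  have hpos := lor_fderiv_pos hh (hf2.differentiableAt (by simp)) hinj (b.ne_zero a0)
  have h1 : lor η (i q) = 0 := by
    have := hN.perp
    rw [lor_smul_left] at this
    have h2 := (mul_eq_zero.1 this).resolve_left hpos.ne'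
    simpa [f, y, rep] using h2
  have h2 : ∀ X, lor η (fderiv ℝ f y X) = 0 := fun X => by
    have := hN.perp_fderiv X
    rw [lor_smul_left] at this
    exact (mul_eq_zero.1 this).resolve_left hpos.ne'
  refine ⟨h1, h2, ?_⟩
  -- Taken on a single point and with the constant that makes the norm condition a tautology, only
  -- to make `det_pos` available.
  have hU : IsUmbilicalOn b f {y} (fun _ => η) (lor η η - 1) :=
    ⟨hh, fun z hz => hz ▸ hf3, fun z hz => hz ▸ hinj, fun z hz => hz ▸ hη', fun z hz => by
      rw [Set.mem_singleton_iff.1 hz]; simpa [f, y, rep] using h1, fun z hz => hz ▸ h2,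
      fun z hz => by ring⟩
  have hd := hU.det_pos (Set.mem_singleton y) ha
  -- The Gauss equation on the plane of the first two coordinate vectors equates `c` and `lor η η -
  -- 1`, both multiplied by the Gram determinant.
  have hG := sum_riemann_mul b hh hinj hf3 a0 a1 a1 a0
  have hR : ∀ l, riemann b (inducedMetric b f) y l a0 a1 a1 =
      c * (inducedMetric b f y a1 a1 * (if l = a0 then 1 else 0) -
        inducedMetric b f y a0 a1 * (if l = a1 then 1 else 0)) := fun l => hi.curvature q l a0 a1 a1
  simp only [hR, ← sff_basis, hη', lor_smul_left, lor_smul_right, ← inducedMetric_apply] at hG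
  have hsum : ∑ l, c * (inducedMetric b f y a1 a1 * (if l = a0 then 1 else 0) -
        inducedMetric b f y a0 a1 * (if l = a1 then 1 else 0)) * inducedMetric b f y l a0 =
      c * (inducedMetric b f y a1 a1 * inducedMetric b f y a0 a0 -
        inducedMetric b f y a0 a1 * inducedMetric b f y a1 a0) := by
    simp [mul_sub, sub_mul, Finset.sum_sub_distrib, mul_assoc]
  rw [hsum] at hG
  have hsym : inducedMetric b f y a0 a1 = inducedMetric b f y a1 a0 := lor_comm _ _
  rw [hsym] at hG
  have h3 : (lor η η - 1 - c) * (inducedMetric b f y a0 a0 * inducedMetric b f y a1 a1 -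
      inducedMetric b f y a1 a0 ^ 2) = 0 := by linear_combination -hG
  have := (mul_eq_zero.1 h3).resolve_right hd.ne'
  linarith

omit [IsManifold (𝓡 k) ∞ N] in
theorem IsUmbilicalInclusion.mem_normalSpace_iff {q : N} {w : LorentzSpace n} :
    w ∈ normalSpace k i q ↔ w ∈ perpSpace
      (fderiv ℝ (rep (𝓡 k) i q) (extChartAt (𝓡 k) q q)).toLinearMap (i q) := by
  rw [mem_perpSpace]
  simp only [normalSpace, tangentImage, Set.mem_ofPred_eq, mfderiv_eq_fderiv_rep hi.smooth]
  refine and_congr Iff.rfl ⟨fun h X => h _ ⟨X, rfl⟩, ?_⟩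
  rintro h _ ⟨X, rfl⟩
  exact h X

/-- The hypotheses on `i` refer at each point to the preferred chart of that point. Differentiation
needs one fixed chart around `q₀`, and `A` is the differential of the change of charts. -/
theorem IsUmbilicalInclusion.chart_data (q₀ : N) {y : EuclideanSpace ℝ (Fin k)}
    (hy : y ∈ (extChartAt (𝓡 k) q₀).target) :
    ∃ A : EuclideanSpace ℝ (Fin k) →L[ℝ] EuclideanSpace ℝ (Fin k), Function.Surjective A ∧
      fderiv ℝ (rep (𝓡 k) i ((extChartAt (𝓡 k) q₀).symm y))
        (extChartAt (𝓡 k) ((extChartAt (𝓡 k) q₀).symm y) ((extChartAt (𝓡 k) q₀).symm y)) =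
        (fderiv ℝ (rep (𝓡 k) i q₀) y).comp A ∧
      Function.Injective (fderiv ℝ (rep (𝓡 k) i q₀) y) ∧
      ∀ X Y, IsNormalPart (rep (𝓡 k) i q₀) y (A X) (A Y)
        (secondFF (𝓡 k) i ((extChartAt (𝓡 k) q₀).symm y) X Y) := by
  obtain ⟨ψ, hψ, hψy, he⟩ := exists_chart_change (I := 𝓡 k) i q₀ hy
  set q := (extChartAt (𝓡 k) q₀).symm y with hq
  set y' := extChartAt (𝓡 k) q q with hy'
  have hf : ContDiffAt ℝ ∞ (rep (𝓡 k) i q₀) (ψ y') := by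
    rw [hψy]; exact contDiffAt_rep hi.smooth q₀ hy
  have hf2 := hf.of_le two_le_infty
  have hψ2 := hψ.of_le two_le_infty
  have hinj : Function.Injective (fderiv ℝ (rep (𝓡 k) i q) y') := hi.injective q
  obtain ⟨h1, h2, h3⟩ := fderiv_injective_of_comp (hf2.differentiableAt (by simp))
    (hψ2.differentiableAt (by simp)) he hinj
  have hf' : ContDiffAt ℝ 2 (rep (𝓡 k) i q) y' :=
    (contDiffAt_rep hi.smooth q (mem_extChartAt_target q)).of_le two_le_infty
  refine ⟨fderiv ℝ ψ y', h2, hψy ▸ h1, hψy ▸ h3, fun X Y => ?_⟩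
  have := IsNormalPart.of_comp hf2 hψ2 he hinj
    (isNormalPart_sff (Module.finBasis ℝ _) (fun z => hi.lor_self _) hinj hf' X Y)
  rw [hψy] at this
  exact this

theorem IsUmbilicalInclusion.mem_normalSpace_symm_iff (q₀ : N) {y : EuclideanSpace ℝ (Fin k)}
    (hy : y ∈ (extChartAt (𝓡 k) q₀).target) {w : LorentzSpace n} :
    w ∈ normalSpace k i ((extChartAt (𝓡 k) q₀).symm y) ↔
      lor w (rep (𝓡 k) i q₀ y) = 0 ∧ ∀ X, lor w (fderiv ℝ (rep (𝓡 k) i q₀) y X) = 0 := by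
  obtain ⟨A, hA, hAf, -, -⟩ := hi.chart_data q₀ hy
  rw [hi.mem_normalSpace_iff, mem_perpSpace, hAf]
  refine and_congr Iff.rfl ⟨fun h X => ?_, fun h X => h _⟩
  obtain ⟨X, rfl⟩ := hA X
  exact h X

theorem IsUmbilicalInclusion.isUmbilicalOn (hk : 2 ≤ k) {η : N → LorentzSpace n}
    (hη : ∀ q, ∀ X Y : TangentSpace (𝓡 k) q,
      secondFF (𝓡 k) i q X Y = metricAt (𝓡 k) i q X Y • η q) (q₀ : N) :
    IsUmbilicalOn (Module.finBasis ℝ (EuclideanSpace ℝ (Fin k))) (rep (𝓡 k) i q₀)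
      (extChartAt (𝓡 k) q₀).target (η ∘ (extChartAt (𝓡 k) q₀).symm) c := by
  have hh : ∀ z, lor (rep (𝓡 k) i q₀ z) (rep (𝓡 k) i q₀ z) = -1 := fun z => hi.lor_self _
  have hf : ∀ y ∈ (extChartAt (𝓡 k) q₀).target, ContDiffAt ℝ 3 (rep (𝓡 k) i q₀) y :=
    fun y hy => (contDiffAt_rep hi.smooth q₀ hy).of_le three_le_infty
  have hinj : ∀ y ∈ (extChartAt (𝓡 k) q₀).target,
      Function.Injective (fderiv ℝ (rep (𝓡 k) i q₀) y) := fun y hy => by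
    obtain ⟨A, -, -, h, -⟩ := hi.chart_data q₀ hy
    exact h
  have hperp : ∀ y ∈ (extChartAt (𝓡 k) q₀).target,
      lor (η ((extChartAt (𝓡 k) q₀).symm y)) (rep (𝓡 k) i q₀ y) = 0 ∧
      ∀ X, lor (η ((extChartAt (𝓡 k) q₀).symm y)) (fderiv ℝ (rep (𝓡 k) i q₀) y X) = 0 := by
    intro y hy
    rw [← hi.mem_normalSpace_symm_iff q₀ hy, hi.mem_normalSpace_iff, mem_perpSpace]
    exact ⟨(hi.mean hk (hη _)).1, (hi.mean hk (hη _)).2.1⟩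
  refine ⟨hh, hf, hinj, fun y hy X Y => ?_, fun y hy => (hperp y hy).1,
    fun y hy => (hperp y hy).2, fun y hy => (hi.mean hk (hη _)).2.2⟩
  obtain ⟨A, hA, hAf, hi', hn⟩ := hi.chart_data q₀ hy
  obtain ⟨X, rfl⟩ := hA X
  obtain ⟨Y, rfl⟩ := hA Y
  have e : secondFF (𝓡 k) i ((extChartAt (𝓡 k) q₀).symm y) X Y =
      lor (fderiv ℝ (rep (𝓡 k) i q₀) y (A X)) (fderiv ℝ (rep (𝓡 k) i q₀) y (A Y)) •
        η ((extChartAt (𝓡 k) q₀).symm y) :=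
    (hη _ X Y).trans (by rw [hi.metricAt_eq, hAf]; rfl)
  exact (isNormalPart_sff _ hh (hinj y hy) ((hf y hy).of_le (by norm_num)) _ _).unique hh
    ((congrArg (IsNormalPart _ _ _ _) e).mp (hn X Y))

theorem IsUmbilicalInclusion.eventually_ball (q₀ : N) {p : N → N → Prop}
    (h : ∀ r > 0, Metric.ball (extChartAt (𝓡 k) q₀ q₀) r ⊆ (extChartAt (𝓡 k) q₀).target →
      ∀ y ∈ Metric.ball (extChartAt (𝓡 k) q₀ q₀) r, p q₀ ((extChartAt (𝓡 k) q₀).symm y)) :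
    ∀ᶠ q in 𝓝 q₀, p q₀ q := by
  obtain ⟨r, hr, hb⟩ := Metric.isOpen_iff.1 (isOpen_extChartAt_target (I := 𝓡 k) q₀) _
    (mem_extChartAt_target q₀)
  have h1 := (continuousAt_extChartAt (I := 𝓡 k) q₀).eventually (Metric.ball_mem_nhds _ hr)
  filter_upwards [h1, extChartAt_source_mem_nhds (I := 𝓡 k) q₀] with q hq hs
  have := h r hr hb _ hq
  rwa [(extChartAt (𝓡 k) q₀).left_inv hs] at this

variable [PreconnectedSpace N]

theorem IsUmbilicalInclusion.add_smul_eq (hk : 2 ≤ k) {η : N → LorentzSpace n}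
    (hη : ∀ q, ∀ X Y : TangentSpace (𝓡 k) q,
      secondFF (𝓡 k) i q X Y = metricAt (𝓡 k) i q X Y • η q) (q q' : N) :
    η q + (1 + c) • i q = η q' + (1 + c) • i q' := by
  have hloc : IsLocallyConstant fun q => η q + (1 + c) • i q := by
    rw [IsLocallyConstant.iff_eventually_eq]
    intro q₀
    refine hi.eventually_ball q₀
      (p := fun q₀ q => η q + (1 + c) • i q = η q₀ + (1 + c) • i q₀) fun r hr hb y hy => ?_
    have hfr : Module.finrank ℝ (EuclideanSpace ℝ (Fin k)) = k := finrank_euclideanSpace_fin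
    have : Nontrivial (Fin (Module.finrank ℝ (EuclideanSpace ℝ (Fin k)))) :=
      Fin.nontrivial_iff_two_le.2 (by omega)
    have hU := hi.isUmbilicalOn hk hη q₀
    have hd := fun y (hy : y ∈ Metric.ball (extChartAt (𝓡 k) q₀ q₀) r) =>
      hU.hasFDerivAt_zero (isOpen_extChartAt_target q₀) (hb hy)
    have h1 := Metric.isOpen_ball.is_const_of_fderiv_eq_zero
      (convex_ball (extChartAt (𝓡 k) q₀ q₀) r).isPreconnected
      (fun y hy => (hd y hy).differentiableAt.differentiableWithinAt)
      (fun y hy => (hd y hy).fderiv) hy (Metric.mem_ball_self hr)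
    simpa [rep] using h1
  exact hloc.apply_eq_of_preconnectedSpace q q'

theorem IsUmbilicalInclusion.normalSpace_mono (hk : 2 ≤ k) {η : N → LorentzSpace n}
    (hη : ∀ q, ∀ X Y : TangentSpace (𝓡 k) q,
      secondFF (𝓡 k) i q X Y = metricAt (𝓡 k) i q X Y • η q) {w : LorentzSpace n}
    (hw : ∀ q, lor w (η q + (1 + c) • i q) = 0) {q : N} (hq : w ∈ normalSpace k i q) (q' : N) :
    w ∈ normalSpace k i q' := by
  have hloc : IsLocallyConstant fun q => w ∈ normalSpace k i q := by
    rw [IsLocallyConstant.iff_eventually_eq]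
    intro q₀
    refine hi.eventually_ball q₀
      (p := fun q₀ q => (w ∈ normalSpace k i q) = (w ∈ normalSpace k i q₀)) fun r hr hb y hy => ?_
    have hU := hi.isUmbilicalOn hk hη q₀
    have hU' : IsUmbilicalOn (Module.finBasis ℝ (EuclideanSpace ℝ (Fin k))) (rep (𝓡 k) i q₀)
        (Metric.ball (extChartAt (𝓡 k) q₀ q₀) r) (η ∘ (extChartAt (𝓡 k) q₀).symm) c :=
      ⟨hU.hyp, fun y hy => hU.smooth y (hb hy), fun y hy => hU.injective y (hb hy),
        fun y hy => hU.umbilical y (hb hy), fun y hy => hU.perp y (hb hy),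
        fun y hy => hU.perp_fderiv y (hb hy), fun y hy => hU.normSq y (hb hy)⟩
    have h0 := Metric.mem_ball_self (x := extChartAt (𝓡 k) q₀ q₀) hr
    have e0 := hi.mem_normalSpace_symm_iff q₀ (hb h0) (w := w)
    rw [extChartAt_to_inv] at e0
    rw [eq_iff_iff, hi.mem_normalSpace_symm_iff q₀ (hb hy), e0]
    exact ⟨fun h => hU'.perp_of_perp (convex_ball _ _) (fun y _ => hw _) hy h0 h.1 h.2,
      fun h => hU'.perp_of_perp (convex_ball _ _) (fun y _ => hw _) h0 hy h.1 h.2⟩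
  have := hloc.apply_eq_of_preconnectedSpace q q'
  exact this ▸ hq

/-- Start from an orthonormal normal frame `e` at one point `q₀` and split each vector into a part
along `η q₀` and a part `κ j` orthogonal to it. The constant vector `κ j` stays normal along all of
`N`, while `η q₀` is continued as `η q = ξ - (1 + c) • i q`, whose length is constant. The condition
`c ≠ -1` permits the division by `1 + c = lor (η q) (η q)`. -/
theorem IsUmbilicalInclusion.exists_parallelFrame [Nonempty N] {ν : ℕ} (hk : 2 ≤ k)
    (hn : ν + k = n) (hc : c ≠ -1) :
    ∃ (C : Fin ν → LorentzSpace n) (lam : Fin ν → ℝ), IsParallelFrame k i C lam ∧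
      ∑ j, lam j ^ 2 = 1 + c ∧ 0 < 1 + c := by
  choose η hη using hi.umbilical
  obtain ⟨q₀⟩ := ‹Nonempty N›
  have hm := fun q => hi.mean hk (hη q)
  have hpos : 0 < 1 + c := by
    have h0 := lor_self_nonneg (hi.lor_self q₀) (hm q₀).1
    rw [(hm q₀).2.2] at h0
    exact lt_of_le_of_ne h0 fun h => hc (by linarith)
  have hηN : ∀ q, η q ∈ normalSpace k i q := fun q => by
    rw [hi.mem_normalSpace_iff, mem_perpSpace]; exact ⟨(hm q).1, (hm q).2.1⟩
  have hperp0 := fun X => lor_fderiv_self (fun z => hi.lor_self ((extChartAt (𝓡 k) q₀).symm z))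
    ((contDiffAt_rep hi.smooth q₀ (mem_extChartAt_target q₀)).differentiableAt (by simp)) X
  simp only [extChartAt_to_inv] at hperp0
  have hfr : Module.finrank ℝ (EuclideanSpace ℝ (Fin k)) = k := finrank_euclideanSpace_fin
  obtain ⟨e, he, ho⟩ := exists_orthonormal_perpSpace (hi.lor_self q₀) (hi.injective q₀) hperp0
    (ν := ν) (by rw [hfr]; exact hn)
  have hsum := eq_sum_of_mem_perpSpace (hi.lor_self q₀) (hi.injective q₀) hperp0
    (κ := Fin ν) (by rw [hfr, Fintype.card_fin]; exact hn) he ho (hi.mem_normalSpace_iff.1 (hηN q₀))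
  set lam : Fin ν → ℝ := fun j => lor (η q₀) (e j) with hlam
  set ξ := η q₀ + (1 + c) • i q₀ with hξ
  have hξq : ∀ q, η q = ξ - (1 + c) • i q := fun q => by
    rw [hξ, ← hi.add_smul_eq hk hη q q₀]; abel
  have hlamsq : ∑ j, lam j ^ 2 = 1 + c := by
    rw [← (hm q₀).2.2]
    conv_rhs => rw [hsum]
    rw [lor_sum_left]
    refine Finset.sum_congr rfl fun j _ => ?_
    rw [lor_smul_left, ← hsum, lor_comm (e j), sq]
  -- The component of `e j` orthogonal to `η q₀`, hence also to `ξ`, since `e j` and `η q₀` are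
  -- orthogonal to `i q₀`.
  let κ : Fin ν → LorentzSpace n := fun j => e j - (lam j / (1 + c)) • η q₀
  have he' : ∀ j, e j ∈ normalSpace k i q₀ := fun j => hi.mem_normalSpace_iff.2 (he j)
  have hκξ : ∀ j, lor (κ j) ξ = 0 := fun j => by
    simp only [κ, hξ, lor_sub_left, lor_smul_left, lor_add_right, lor_smul_right, (he' j).1,
      (hm q₀).1, (hm q₀).2.2, lor_comm (e j)]
    simp only [hlam]; field_simp; ring
  have hκN : ∀ j q, κ j ∈ normalSpace k i q := fun j => by
    refine hi.normalSpace_mono hk hη (q := q₀) (fun q => ?_) ?_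
    · rw [hi.add_smul_eq hk hη q q₀]; exact hκξ j
    · rw [hi.mem_normalSpace_iff]
      exact Submodule.sub_mem _ (he j)
        (Submodule.smul_mem _ _ (hi.mem_normalSpace_iff.1 (hηN q₀)))
  have hκη : ∀ j q, lor (κ j) (η q) = 0 := fun j q => by
    rw [hξq, lor_sub_right, hκξ, lor_smul_right, (hκN j q).1, mul_zero, sub_zero]
  have hE : ∀ j q, (κ j + (lam j / (1 + c)) • ξ) - lam j • i q =
      κ j + (lam j / (1 + c)) • η q := fun j q => by
    rw [hξq, smul_sub, smul_smul, div_mul_cancel₀ _ hpos.ne']; abel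
  have hκκ : ∀ j l, lor (κ j) (κ l) = (if j = l then 1 else 0) - lam j * lam l / (1 + c) := by
    intro j l
    have h1 : lor (κ j) (κ l) = lor (κ j) (e l) := by
      conv_lhs => rw [show κ l = e l - (lam l / (1 + c)) • η q₀ from rfl]
      rw [lor_sub_right, lor_smul_right, hκη, mul_zero, sub_zero]
    rw [h1]
    simp only [κ, lor_sub_left, lor_smul_left, ho]
    simp only [hlam]; ring
  refine ⟨fun j => κ j + (lam j / (1 + c)) • ξ, lam, ⟨fun j q => ?_, fun j l q => ?_,
    fun q X Y => ?_⟩, hlamsq, hpos⟩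
  · rw [hE, hi.mem_normalSpace_iff]
    exact Submodule.add_mem _ (hi.mem_normalSpace_iff.1 (hκN j q))
      (Submodule.smul_mem _ _ (hi.mem_normalSpace_iff.1 (hηN q)))
  · rw [hE, hE]
    simp only [lor_add_left, lor_add_right, lor_smul_left, lor_smul_right, hκη,
      lor_comm (η q) (κ l), hκκ, (hm q).2.2]
    field_simp
    ring
  · rw [hη]
    congr 1
    have h1 : ∑ j, lam j • κ j = 0 := by
      have : ∑ j, lam j • κ j = (∑ j, lam j • e j) - ((∑ j, lam j ^ 2) / (1 + c)) • η q₀ := by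
        simp only [κ, smul_sub, Finset.sum_sub_distrib, smul_smul, Finset.sum_div, Finset.sum_smul]
        congr 1
        exact Finset.sum_congr rfl fun j _ => by congr 1; ring
      rw [this, hlamsq, div_self hpos.ne', one_smul, ← hsum, sub_self]
    simp only [hE, smul_add, Finset.sum_add_distrib, h1, zero_add, smul_smul]
    rw [← Finset.sum_smul]
    have : ∑ j, lam j * (lam j / (1 + c)) = (∑ j, lam j ^ 2) / (1 + c) := by
      rw [Finset.sum_div]
      exact Finset.sum_congr rfl fun j _ => by ring
    rw [this, hlamsq, div_self hpos.ne', one_smul]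

end Umbilical

/-! ### Generalized cones in coordinates -/

section ConeLocal

variable {n ν : ℕ} {V₁ V₂ : Type*} [NormedAddCommGroup V₁] [NormedSpace ℝ V₁]
  [NormedAddCommGroup V₂] [NormedSpace ℝ V₂]

theorem sff_symm {V : Type*} [NormedAddCommGroup V] [NormedSpace ℝ V] {ι : Type*} [Fintype ι]
    [DecidableEq ι] (b : Module.Basis ι ℝ V) {f : V → LorentzSpace n} {y : V}
    (hh : ∀ z, lor (f z) (f z) = -1) (hi : Function.Injective (fderiv ℝ f y))
    (hf : ContDiffAt ℝ 2 f y) (X Y : V) : sff b f y X Y = sff b f y Y X := by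
  have h := isNormalPart_sff b hh hi hf Y X
  refine (isNormalPart_sff b hh hi hf X Y).unique hh ⟨h.perp, h.perp_fderiv, ?_⟩
  rw [D2_symm hf]; exact h.decomp

/-- The map `ρ φ + ∑ B_l C_l` near the point `y`, where the vectors `C_l - lam_l φ` are orthonormal
and normal to `φ`. -/
structure IsConeData (φ : V₁ → LorentzSpace n) (C : Fin ν → LorentzSpace n) (lam : Fin ν → ℝ)
    (ρ : V₁ × V₂ → ℝ) (B : Fin ν → V₁ × V₂ → ℝ) (y : V₁ × V₂) : Prop where
  hyp : ∀ z, lor (φ z) (φ z) = -1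
  smooth : ContDiffAt ℝ 3 φ y.1
  injective : Function.Injective (fderiv ℝ φ y.1)
  lor_left : ∀ l z, lor (C l) (φ z) = -lam l
  lor_const : ∀ l m, lor (C l) (C m) = (if l = m then 1 else 0) - lam l * lam m
  smooth_coeff : ContDiffAt ℝ 3 ρ y
  smooth_B : ∀ l, ContDiffAt ℝ 3 (B l) y
  sq_eq : ∀ z, (ρ z + ∑ l, lam l * B l z) ^ 2 = 1 + ∑ l, B l z ^ 2
  vert : ∀ v : V₂, (∀ l, fderiv ℝ (B l) y (0, v) = 0) → v = 0

/-- The map `ρ φ + ∑ B_l C_l`. -/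
def coneOf (φ : V₁ → LorentzSpace n) (C : Fin ν → LorentzSpace n) (ρ : V₁ × V₂ → ℝ)
    (B : Fin ν → V₁ × V₂ → ℝ) (z : V₁ × V₂) : LorentzSpace n := ρ z • φ z.1 + ∑ l, B l z • C l

/-- The component of `w` orthogonal to the orthonormal vectors `e l`. -/
def perpPart (e : Fin ν → LorentzSpace n) (w : LorentzSpace n) : LorentzSpace n :=
  w - ∑ l, lor w (e l) • e l

theorem perpPart_add (e : Fin ν → LorentzSpace n) (w w' : LorentzSpace n) :
    perpPart e (w + w') = perpPart e w + perpPart e w' := by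
  simp only [perpPart, lor_add_left, add_smul, Finset.sum_add_distrib]; abel

theorem perpPart_smul (e : Fin ν → LorentzSpace n) (r : ℝ) (w : LorentzSpace n) :
    perpPart e (r • w) = r • perpPart e w := by
  simp only [perpPart, lor_smul_left, smul_sub, Finset.smul_sum, smul_smul]

theorem perpPart_sum {κ : Type*} (s : Finset κ) (e : Fin ν → LorentzSpace n)
    (w : κ → LorentzSpace n) : perpPart e (∑ a ∈ s, w a) = ∑ a ∈ s, perpPart e (w a) :=
  map_sum (⟨⟨perpPart e, by simp [perpPart, lor_zero_left]⟩, perpPart_add e⟩ :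
    LorentzSpace n →+ LorentzSpace n) w s

namespace IsConeData

variable {φ : V₁ → LorentzSpace n} {C : Fin ν → LorentzSpace n} {lam : Fin ν → ℝ}
  {ρ : V₁ × V₂ → ℝ} {B : Fin ν → V₁ × V₂ → ℝ} {y : V₁ × V₂} (h : IsConeData φ C lam ρ B y)

include h

theorem lor_const_fderiv (l : Fin ν) (X : V₁) : lor (C l) (fderiv ℝ φ y.1 X) = 0 := by
  have h1 := fderiv_lor (f := fun _ => C l) (differentiableAt_const _)
    (h.smooth.differentiableAt (by simp)) X
  simp only [h.lor_left] at h1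
  simpa [lor_zero_left] using h1.symm

theorem lor_fderiv (X : V₁) : lor (fderiv ℝ φ y.1 X) (φ y.1) = 0 :=
  lor_fderiv_self h.hyp (h.smooth.differentiableAt (by simp)) X

theorem frame_perp (l : Fin ν) : lor (C l - lam l • φ y.1) (φ y.1) = 0 := by
  rw [lor_sub_left, lor_smul_left, h.lor_left, h.hyp]; ring

theorem frame_perp_fderiv (l : Fin ν) (X : V₁) :
    lor (C l - lam l • φ y.1) (fderiv ℝ φ y.1 X) = 0 := by
  rw [lor_sub_left, lor_smul_left, h.lor_const_fderiv, lor_comm, h.lor_fderiv]; ring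

theorem frame_orthonormal (l m : Fin ν) :
    lor (C l - lam l • φ y.1) (C m - lam m • φ y.1) = if l = m then 1 else 0 := by
  rw [lor_sub_right, lor_smul_right, h.frame_perp, lor_sub_left, lor_smul_left, h.lor_const,
    lor_comm (φ y.1), h.lor_left]
  ring

theorem lor_sum_frame (p : ℝ) (q : Fin ν → ℝ) (X : V₁) (p' : ℝ) (q' : Fin ν → ℝ) (X' : V₁) :
    lor (fderiv ℝ φ y.1 X + p • φ y.1 + ∑ l, q l • (C l - lam l • φ y.1))
      (fderiv ℝ φ y.1 X' + p' • φ y.1 + ∑ l, q' l • (C l - lam l • φ y.1)) =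
    lor (fderiv ℝ φ y.1 X) (fderiv ℝ φ y.1 X') - p * p' + ∑ l, q l * q' l := by
  simp only [lor_add_left, lor_add_right, lor_smul_left, lor_smul_right, lor_sum_left,
    lor_sum_right, h.lor_fderiv, h.frame_perp, h.frame_perp_fderiv, h.hyp, h.frame_orthonormal,
    lor_comm (φ y.1) (fderiv ℝ φ y.1 _), lor_comm (φ y.1) (C _ - _),
    lor_comm (fderiv ℝ φ y.1 _) (C _ - _)]
  have e : ∑ l, q' l * q l = ∑ l, q l * q' l := Finset.sum_congr rfl fun _ _ => mul_comm _ _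
  simp only [mul_zero, zero_add, add_zero, Finset.sum_const_zero, mul_ite, mul_one]
  simp only [Finset.sum_ite_eq', Finset.mem_univ, if_true, e]
  ring

theorem coneOf_eq : coneOf φ C ρ B y = (ρ y + ∑ l, lam l * B l y) • φ y.1 +
    ∑ l, B l y • (C l - lam l • φ y.1) := by
  simp only [coneOf, smul_sub, Finset.sum_sub_distrib, add_smul, Finset.sum_smul, smul_smul,
    mul_comm (lam _)]
  abel

theorem hyp_coneOf (z : V₁ × V₂) : lor (coneOf φ C ρ B z) (coneOf φ C ρ B z) = -1 := by
  have e0 : ∀ l, ∑ m, B m z * lor (C m) (C l) = B l z - lam l * ∑ m, lam m * B m z := fun l => by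
    simp only [h.lor_const, mul_sub, Finset.sum_sub_distrib, Finset.mul_sum]
    congr 1
    · simp
    · exact Finset.sum_congr rfl fun m _ => by ring
  have e2 : ∀ l, lor (φ z.1) (C l) = - lam l := fun l => by rw [lor_comm, h.lor_left]
  have e3 : ∑ l, B l z * -lam l = -∑ l, lam l * B l z := by
    rw [← Finset.sum_neg_distrib]
    exact Finset.sum_congr rfl fun l _ => by ring
  have e4 : ∑ l, B l z * (ρ z * -lam l + (B l z - lam l * ∑ m, lam m * B m z)) =
      ∑ l, B l z ^ 2 - (ρ z + ∑ l, lam l * B l z) * ∑ l, lam l * B l z := by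
    rw [Finset.mul_sum, ← Finset.sum_sub_distrib]
    exact Finset.sum_congr rfl fun l _ => by ring
  have := h.sq_eq z
  simp only [coneOf, lor_add_left, lor_add_right, lor_smul_left, lor_smul_right, lor_sum_left,
    lor_sum_right, h.hyp, h.lor_left, e2, e0, e3, e4]
  linarith

theorem smooth_coneOf : ContDiffAt ℝ 3 (coneOf φ C ρ B) y :=
  (h.smooth_coeff.smul (h.smooth.comp y contDiffAt_fst)).add
    (ContDiffAt.sum fun l _ => (h.smooth_B l).smul contDiffAt_const)

omit h in
theorem fderiv_coneOf_apply {z : V₁ × V₂} (hφ : DifferentiableAt ℝ φ z.1)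
    (hρ : DifferentiableAt ℝ ρ z) (hB : ∀ l, DifferentiableAt ℝ (B l) z) (Y : V₁ × V₂) :
    fderiv ℝ (coneOf φ C ρ B) z Y = ρ z • fderiv ℝ φ z.1 Y.1 + fderiv ℝ ρ z Y • φ z.1 +
      ∑ l, fderiv ℝ (B l) z Y • C l := by
  have h1 : HasFDerivAt (fun z : V₁ × V₂ => φ z.1)
      ((fderiv ℝ φ z.1).comp (ContinuousLinearMap.fst ℝ V₁ V₂)) z :=
    hφ.hasFDerivAt.comp z hasFDerivAt_fst
  have h2 := (hρ.hasFDerivAt.fun_smul h1).fun_add (HasFDerivAt.fun_sum (u := Finset.univ) fun l _ =>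
    (hB l).hasFDerivAt.fun_smul (hasFDerivAt_const (C l) z))
  have h3 : fderiv ℝ (coneOf φ C ρ B) z = _ := h2.fderiv
  rw [h3]
  simp [sum_apply]

/-- The differential of `ρ + ∑ lam_l B_l`. -/
def dheight (lam : Fin ν → ℝ) (ρ : V₁ × V₂ → ℝ) (B : Fin ν → V₁ × V₂ → ℝ) (y Y : V₁ × V₂) : ℝ :=
  fderiv ℝ ρ y Y + ∑ l, lam l * fderiv ℝ (B l) y Y

theorem mul_dheight (Y : V₁ × V₂) : (ρ y + ∑ l, lam l * B l y) * dheight lam ρ B y Y =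
    ∑ l, B l y * fderiv ℝ (B l) y Y := by
  have hρ := (h.smooth_coeff.differentiableAt (by simp)).hasFDerivAt
  have hB := fun l => ((h.smooth_B l).differentiableAt (by simp)).hasFDerivAt
  have h1 := (hρ.fun_add (HasFDerivAt.fun_sum (u := Finset.univ) fun l _ =>
    (hB l).const_mul (lam l))).pow 2
  have h2 := (HasFDerivAt.fun_sum (u := Finset.univ) fun l _ => (hB l).pow 2).const_add 1
  have h3 : (fun z => (ρ z + ∑ l, lam l * B l z) ^ 2) = fun z => 1 + ∑ l, B l z ^ 2 :=
    funext h.sq_eq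
  rw [h3] at h1
  have h4 := DFunLike.congr_fun (h1.unique h2) Y
  simp [sum_apply] at h4
  rw [dheight]
  have e : ∑ l, 2 * B l y * (fderiv ℝ (B l) y) Y = 2 * ∑ l, B l y * fderiv ℝ (B l) y Y := by
    rw [Finset.mul_sum]; exact Finset.sum_congr rfl fun l _ => by ring
  rw [e] at h4
  linarith

theorem height_ne_zero : ρ y + ∑ l, lam l * B l y ≠ 0 := by
  intro h0
  have := h.sq_eq y
  rw [h0] at this
  have h2 : 0 ≤ ∑ l, B l y ^ 2 := Finset.sum_nonneg fun l _ => sq_nonneg _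
  linarith

/-- The vectors `C l` are constant, so only `φ` and the coefficients are differentiated. Rewriting
`C l` by the frame makes the three summands mutually orthogonal. -/
theorem fderiv_coneOf (Y : V₁ × V₂) : fderiv ℝ (coneOf φ C ρ B) y Y =
    fderiv ℝ φ y.1 (ρ y • Y.1) + dheight lam ρ B y Y • φ y.1 +
      ∑ l, fderiv ℝ (B l) y Y • (C l - lam l • φ y.1) := by
  rw [fderiv_coneOf_apply (h.smooth.differentiableAt (by simp))
    (h.smooth_coeff.differentiableAt (by simp))
    fun l => (h.smooth_B l).differentiableAt (by simp), dheight, map_smul]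
  simp only [smul_sub, Finset.sum_sub_distrib, add_smul, Finset.sum_smul, smul_smul,
    mul_comm (lam _)]
  abel

theorem lor_fderiv_coneOf (Y Y' : V₁ × V₂) :
    lor (fderiv ℝ (coneOf φ C ρ B) y Y) (fderiv ℝ (coneOf φ C ρ B) y Y') =
      ρ y ^ 2 * lor (fderiv ℝ φ y.1 Y.1) (fderiv ℝ φ y.1 Y'.1) -
        dheight lam ρ B y Y * dheight lam ρ B y Y' +
        ∑ l, fderiv ℝ (B l) y Y * fderiv ℝ (B l) y Y' := by
  rw [h.fderiv_coneOf, h.fderiv_coneOf, h.lor_sum_frame]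
  simp only [map_smul, lor_smul_left, lor_smul_right]
  ring

theorem dheight_eq_zero {Y : V₁ × V₂} (hY : ∀ l, fderiv ℝ (B l) y Y = 0) :
    dheight lam ρ B y Y = 0 := by
  have := h.mul_dheight Y
  simp only [hY, mul_zero, Finset.sum_const_zero] at this
  exact (mul_eq_zero.1 this).resolve_left h.height_ne_zero

variable [FiniteDimensional ℝ V₁] [FiniteDimensional ℝ V₂] (hdim : Module.finrank ℝ V₂ = ν)

include hdim

theorem exists_vertical (q : Fin ν → ℝ) : ∃ v : V₂, ∀ l, fderiv ℝ (B l) y (0, v) = q l := by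
  let T : V₂ →ₗ[ℝ] (Fin ν → ℝ) := LinearMap.pi fun l =>
    ((fderiv ℝ (B l) y).toLinearMap).comp (LinearMap.inr ℝ V₁ V₂)
  have hT : Function.Injective T := by
    rw [← LinearMap.ker_eq_bot, LinearMap.ker_eq_bot']
    intro v hv
    exact h.vert v fun l => congrFun hv l
  have hS := (LinearMap.injective_iff_surjective_of_finrank_eq_finrank
    (by rw [hdim, Module.finrank_fin_fun])).1 hT
  obtain ⟨v, hv⟩ := hS q
  exact ⟨v, fun l => congrFun hv l⟩

/-- The values on `(X, 0)` are cancelled by a vertical vector. By `lor_fderiv_coneOf` and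
`dheight_eq_zero` these lifts are orthogonal to the fiber, and their lengths are those of `X` scaled
by `|ρ y|`. -/
theorem exists_lift (X : V₁) : ∃ v : V₂, ∀ l, fderiv ℝ (B l) y (X, v) = 0 := by
  obtain ⟨v, hv⟩ := h.exists_vertical hdim fun l => -fderiv ℝ (B l) y (X, 0)
  refine ⟨v, fun l => ?_⟩
  have : ((X, v) : V₁ × V₂) = (X, 0) + (0, v) := by simp
  rw [this, map_add, hv]; ring

/-- If `ρ y = 0`, the horizontal lift of any nonzero vector is killed. Otherwise pairing with the
tangent vectors of `φ` and with the frame shows that the kernel is zero. -/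
theorem injective_iff [Nontrivial V₁] :
    Function.Injective (fderiv ℝ (coneOf φ C ρ B) y) ↔ ρ y ≠ 0 := by
  constructor
  · intro hi h0
    obtain ⟨X, hX⟩ := exists_ne (0 : V₁)
    obtain ⟨v, hv⟩ := h.exists_lift hdim X
    have h1 : fderiv ℝ (coneOf φ C ρ B) y (X, v) = fderiv ℝ (coneOf φ C ρ B) y 0 := by
      rw [h.fderiv_coneOf, h.dheight_eq_zero hv, map_zero]
      simp [hv, h0]
    exact hX (congrArg Prod.fst (hi h1))
  · intro h0
    rw [injective_iff_map_eq_zero]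
    rintro ⟨X, v⟩ hY
    have h2 := h.fderiv_coneOf (X, v)
    rw [hY] at h2
    have hX : X = 0 := by
      by_contra hne
      have h3 := lor_fderiv_pos h.hyp (h.smooth.differentiableAt (by simp)) h.injective hne
      have h4 : lor (fderiv ℝ φ y.1 (ρ y • (X, v).1) + dheight lam ρ B y (X, v) • φ y.1 +
        ∑ l, fderiv ℝ (B l) y (X, v) • (C l - lam l • φ y.1))
        (fderiv ℝ φ y.1 X + (0 : ℝ) • φ y.1 + ∑ l, (0 : ℝ) • (C l - lam l • φ y.1)) = 0 := by
        rw [← h2, lor_zero_left]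
      rw [h.lor_sum_frame] at h4
      simp [lor_smul_left, h0, h3.ne'] at h4
    subst hX
    have hv : v = 0 := h.vert v fun m => by
      have h4 : lor (fderiv ℝ φ y.1 (ρ y • ((0 : V₁), v).1) + dheight lam ρ B y (0, v) • φ y.1 +
        ∑ l, fderiv ℝ (B l) y (0, v) • (C l - lam l • φ y.1))
        (fderiv ℝ φ y.1 0 + (0 : ℝ) • φ y.1 +
          ∑ l, (if l = m then 1 else 0 : ℝ) • (C l - lam l • φ y.1)) = 0 := by
        rw [← h2, lor_zero_left]
      rw [h.lor_sum_frame] at h4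
      simpa [lor_zero_left] using h4
    rw [hv]; rfl

/-- In the span of `φ y.1` and the frame, the point of the cone is a unit timelike vector, and the
vertical directions of the cone fill its orthogonal complement. -/
theorem mem_span (p : ℝ) (q : Fin ν → ℝ) :
    p • φ y.1 + ∑ l, q l • (C l - lam l • φ y.1) ∈ Submodule.span ℝ {coneOf φ C ρ B y} ⊔
      LinearMap.range (fderiv ℝ (coneOf φ C ρ B) y).toLinearMap := by
  set a := ρ y + ∑ l, lam l * B l y with ha
  -- This is minus the Lorentz product of the given vector with the point of the cone, that is, its
  -- coefficient along that point.
  set r := a * p - ∑ l, B l y * q l with hr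
  obtain ⟨v, hv⟩ := h.exists_vertical hdim fun l => q l - r * B l y
  have h1 : dheight lam ρ B y (0, v) = p - r * a := by
    have h2 := h.mul_dheight (0, v)
    simp only [hv, mul_sub, Finset.sum_sub_distrib] at h2
    have h3 : ∑ l, B l y * (r * B l y) = r * (a ^ 2 - 1) := by
      rw [ha, h.sq_eq, add_sub_cancel_left, Finset.mul_sum]
      exact Finset.sum_congr rfl fun l _ => by ring
    rw [h3] at h2
    refine mul_left_cancel₀ h.height_ne_zero ?_
    rw [← ha] at h2 ⊢
    rw [h2, hr]; ring
  have h2 : p • φ y.1 + ∑ l, q l • (C l - lam l • φ y.1) = r • coneOf φ C ρ B y +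
      fderiv ℝ (coneOf φ C ρ B) y (0, v) := by
    rw [h.fderiv_coneOf, h.coneOf_eq, h1]
    simp only [hv, sub_smul, Finset.sum_sub_distrib, smul_zero, map_zero, smul_add, Finset.smul_sum,
      smul_smul]
    module
  rw [h2]
  exact Submodule.add_mem _
    (Submodule.mem_sup_left (Submodule.smul_mem _ _ (Submodule.mem_span_singleton_self _)))
    (Submodule.mem_sup_right ⟨_, rfl⟩)

theorem D2_coneOf (Y Y' : V₁ × V₂) : D2 (coneOf φ C ρ B) y Y Y' =
    ρ y • D2 φ y.1 Y.1 Y'.1 + (fderiv ℝ ρ y Y • fderiv ℝ φ y.1 Y'.1 +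
      fderiv ℝ ρ y Y' • fderiv ℝ φ y.1 Y.1) + (fderiv ℝ (fderiv ℝ ρ) y Y Y' • φ y.1 +
      ∑ l, fderiv ℝ (fderiv ℝ (B l)) y Y Y' • C l) := by
  have hf2 : ContDiffAt ℝ 2 (coneOf φ C ρ B) y := h.smooth_coneOf.of_le (by norm_num)
  have hev : (fun z => fderiv ℝ (coneOf φ C ρ B) z Y') =ᶠ[𝓝 y] fun z =>
      ρ z • fderiv ℝ φ z.1 Y'.1 + fderiv ℝ ρ z Y' • φ z.1 + ∑ l, fderiv ℝ (B l) z Y' • C l := by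
    have e1 : ∀ᶠ z : V₁ × V₂ in 𝓝 y, ContDiffAt ℝ 3 φ z.1 :=
      continuous_fst.continuousAt.eventually (h.smooth.eventually (by simp))
    have e2 : ∀ᶠ z in 𝓝 y, ∀ l, ContDiffAt ℝ 3 (B l) z :=
      Filter.eventually_all.2 fun l => (h.smooth_B l).eventually (by simp)
    filter_upwards [e1, h.smooth_coeff.eventually (by simp), e2] with z h1 h2 h3
    exact fderiv_coneOf_apply (h1.differentiableAt (by simp)) (h2.differentiableAt (by simp))
      (fun l => (h3 l).differentiableAt (by simp)) Y'
  rw [D2, ← fderiv_fderiv_apply hf2, hev.fderiv_eq]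
  have h1 : HasFDerivAt (fun z : V₁ × V₂ => fderiv ℝ φ z.1 Y'.1)
      ((fderiv ℝ (fun z => fderiv ℝ φ z Y'.1) y.1).comp (ContinuousLinearMap.fst ℝ V₁ V₂)) y := by
    have : DifferentiableAt ℝ (fun z => fderiv ℝ φ z Y'.1) y.1 :=
      (((contDiffAt_fderiv (m := 2) h.smooth (by norm_num)).clm_apply
        contDiffAt_const).differentiableAt (by simp))
    exact this.hasFDerivAt.comp y hasFDerivAt_fst
  have h2 : HasFDerivAt (fun z : V₁ × V₂ => φ z.1)
      ((fderiv ℝ φ y.1).comp (ContinuousLinearMap.fst ℝ V₁ V₂)) y :=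
    (h.smooth.differentiableAt (by simp)).hasFDerivAt.comp y hasFDerivAt_fst
  have h3 : ∀ {u : V₁ × V₂ → ℝ}, ContDiffAt ℝ 3 u y →
      HasFDerivAt (fun z => fderiv ℝ u z Y') (fderiv ℝ (fun z => fderiv ℝ u z Y') y) y :=
    fun hu => (((contDiffAt_fderiv (m := 2) hu (by norm_num)).clm_apply
      contDiffAt_const).differentiableAt (by simp)).hasFDerivAt
  have h4 := (((h.smooth_coeff.differentiableAt (by simp)).hasFDerivAt.fun_smul h1).fun_add
    ((h3 h.smooth_coeff).fun_smul h2)).fun_add (HasFDerivAt.fun_sum (u := Finset.univ) fun l _ =>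
      (h3 (h.smooth_B l)).fun_smul (hasFDerivAt_const (C l) y))
  rw [h4.fderiv]
  simp only [add_apply, sum_apply, smul_apply, ContinuousLinearMap.smulRight_apply,
    ContinuousLinearMap.comp_apply, ContinuousLinearMap.coe_fst', smul_zero, zero_add,
    fderiv_fderiv_apply (h.smooth_coeff.of_le (by norm_num : (2 : WithTop ℕ∞) ≤ 3)),
    fderiv_fderiv_apply (h.smooth.of_le (by norm_num : (2 : WithTop ℕ∞) ≤ 3)),
    fderiv_fderiv_apply ((h.smooth_B _).of_le (by norm_num : (2 : WithTop ℕ∞) ≤ 3)), D2]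
  abel

/-- The space `W` spanned by the point and the tangent space of the cone contains `φ`, all `C l`
and, as `ρ y ≠ 0`, the tangent space of `φ`. Modulo `W` only `ρ • D2 φ` survives, and there only the
part of `w` orthogonal to the frame. -/
theorem isNormalPart_coneOf (h0 : ρ y ≠ 0) {Y Y' : V₁ × V₂} {w : LorentzSpace n}
    (hw : IsNormalPart φ y.1 Y.1 Y'.1 w) :
    IsNormalPart (coneOf φ C ρ B) y Y Y' (ρ y • perpPart (fun l => C l - lam l • φ y.1) w) := by
  set e : Fin ν → LorentzSpace n := fun l => C l - lam l • φ y.1 with he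
  set W := Submodule.span ℝ {coneOf φ C ρ B y} ⊔
      LinearMap.range (fderiv ℝ (coneOf φ C ρ B) y).toLinearMap with hW
  have p1 : lor (perpPart e w) (φ y.1) = 0 := by
    simp only [perpPart, lor_sub_left, lor_sum_left, lor_smul_left, hw.perp, e, h.frame_perp]
    simp
  have p2 : ∀ X, lor (perpPart e w) (fderiv ℝ φ y.1 X) = 0 := fun X => by
    simp only [perpPart, lor_sub_left, lor_sum_left, lor_smul_left, hw.perp_fderiv, e,
      h.frame_perp_fderiv]
    simp
  have p3 : ∀ m, lor (perpPart e w) (C m - lam m • φ y.1) = 0 := fun m => by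
    simp only [perpPart, lor_sub_left, lor_sum_left, lor_smul_left, e, h.frame_orthonormal]
    simp
  have hU : ∀ p : ℝ, ∀ q : Fin ν → ℝ, p • φ y.1 + ∑ l, q l • e l ∈ W := h.mem_span hdim
  have hφW : φ y.1 ∈ W := by simpa using hU 1 0
  have heW : ∀ m, e m ∈ W := fun m => by
    simpa using hU 0 (fun l => if l = m then 1 else 0)
  have hCW : ∀ m, C m ∈ W := fun m => by
    have : C m = e m + lam m • φ y.1 := by simp [e]
    rw [this]; exact W.add_mem (heW m) (W.smul_mem _ hφW)
  have hdW : ∀ X, fderiv ℝ φ y.1 X ∈ W := fun X => by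
    have h1 := h.fderiv_coneOf (X, 0)
    have h2 : ρ y • fderiv ℝ φ y.1 X = fderiv ℝ (coneOf φ C ρ B) y (X, 0) -
        (dheight lam ρ B y (X, 0) • φ y.1 + ∑ l, fderiv ℝ (B l) y (X, 0) • e l) := by
      rw [h1, map_smul, add_assoc, add_sub_cancel_right]
    have h3 : ρ y • fderiv ℝ φ y.1 X ∈ W := by
      rw [h2]; exact W.sub_mem (Submodule.mem_sup_right ⟨_, rfl⟩) (hU _ _)
    exact (W.smul_mem_iff h0).1 h3
  refine ⟨?_, fun Z => ?_, ?_⟩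
  · rw [lor_smul_left, h.coneOf_eq, lor_add_right, lor_smul_right, p1, lor_sum_right]
    simp only [lor_smul_right, p3, mul_zero, Finset.sum_const_zero, add_zero]
  · rw [lor_smul_left, h.fderiv_coneOf, lor_add_right, lor_add_right, lor_smul_right, p1, p2,
      lor_sum_right]
    simp only [lor_smul_right, p3, mul_zero, Finset.sum_const_zero, add_zero]
  · have hmem : D2 (coneOf φ C ρ B) y Y Y' - ρ y • perpPart e w ∈ W := by
      obtain ⟨r, Z, hZ⟩ := hw.decomp
      have : D2 (coneOf φ C ρ B) y Y Y' - ρ y • perpPart e w =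
          ρ y • (r • φ y.1 + fderiv ℝ φ y.1 Z + ∑ l, lor w (e l) • e l) +
          (fderiv ℝ ρ y Y • fderiv ℝ φ y.1 Y'.1 +
          fderiv ℝ ρ y Y' • fderiv ℝ φ y.1 Y.1) + (fderiv ℝ (fderiv ℝ ρ) y Y Y' • φ y.1 +
          ∑ l, fderiv ℝ (fderiv ℝ (B l)) y Y Y' • C l) := by
        rw [h.D2_coneOf hdim, hZ, perpPart]
        module
      rw [this]
      exact W.add_mem (W.add_mem (W.smul_mem _ (W.add_mem (W.add_mem (W.smul_mem _ hφW) (hdW _))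
        (W.sum_mem fun l _ => W.smul_mem _ (heW l)))) (W.add_mem (W.smul_mem _ (hdW _))
        (W.smul_mem _ (hdW _)))) (W.add_mem (W.smul_mem _ hφW)
        (W.sum_mem fun l _ => W.smul_mem _ (hCW l)))
    obtain ⟨u, hu, t, ⟨Z, rfl⟩, hv⟩ := Submodule.mem_sup.1 hmem
    obtain ⟨r, rfl⟩ := Submodule.mem_span_singleton.1 hu
    refine ⟨r, Z, ?_⟩
    rw [add_assoc, ← sub_eq_iff_eq_add', ← hv]
    rfl

/-! ### Second fundamental form, mean curvature and scalar curvature of a cone. -/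

section Results

variable {ι ι₁ : Type*} [Fintype ι] [DecidableEq ι] [Fintype ι₁] [DecidableEq ι₁]
  (b : Module.Basis ι ℝ (V₁ × V₂)) (b₁ : Module.Basis ι₁ ℝ V₁) (h0 : ρ y ≠ 0) [Nontrivial V₁]

include h0

theorem sff_coneOf (Y Y' : V₁ × V₂) : sff b (coneOf φ C ρ B) y Y Y' =
    ρ y • perpPart (fun l => C l - lam l • φ y.1) (sff b₁ φ y.1 Y.1 Y'.1) :=
  (isNormalPart_sff b h.hyp_coneOf ((h.injective_iff hdim).2 h0)
    (h.smooth_coneOf.of_le (by norm_num)) Y Y').unique h.hyp_coneOf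
    (h.isNormalPart_coneOf hdim h0
      (isNormalPart_sff b₁ h.hyp h.injective (h.smooth.of_le (by norm_num)) Y.1 Y'.1))

omit [Fintype ι] [DecidableEq ι] [Fintype ι₁] [DecidableEq ι₁] in
-- The horizontal lifts of `(ρ y)⁻¹ • u a` are orthonormal and orthogonal to the fiber; a vertical
-- orthonormal basis completes them.
theorem exists_adapted {κ : Type*} [Fintype κ] [DecidableEq κ] (u : κ → V₁)
    (hu : ∀ a c, lor (fderiv ℝ φ y.1 (u a)) (fderiv ℝ φ y.1 (u c)) = if a = c then 1 else 0) :
    ∃ U : κ ⊕ Fin ν → V₁ × V₂,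
      (∀ a c, lor (fderiv ℝ (coneOf φ C ρ B) y (U a)) (fderiv ℝ (coneOf φ C ρ B) y (U c)) =
        if a = c then 1 else 0) ∧ (∀ a, (U (Sum.inl a)).1 = (ρ y)⁻¹ • u a) ∧
      ∀ j, (U (Sum.inr j)).1 = 0 := by
  have hinj := (h.injective_iff hdim).2 h0
  have hd := h.smooth_coneOf.differentiableAt (by simp)
  obtain ⟨v, hv⟩ := exists_orthonormal_basis
    (LinearMap.mk₂ ℝ (fun v v' : V₂ => lor (fderiv ℝ (coneOf φ C ρ B) y (0, v))
      (fderiv ℝ (coneOf φ C ρ B) y (0, v')))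
      (fun v w z => by
        rw [show ((0, v + w) : V₁ × V₂) = (0, v) + (0, w) by simp, map_add, lor_add_left])
      (fun r v w => by
        rw [show ((0, r • v) : V₁ × V₂) = r • (0, v) by simp, map_smul, lor_smul_left, smul_eq_mul])
      (fun v w z => by
        rw [show ((0, w + z) : V₁ × V₂) = (0, w) + (0, z) by simp, map_add, lor_add_right])
      (fun r v w => by
        rw [show ((0, r • w) : V₁ × V₂) = r • (0, w) by simp, map_smul, lor_smul_right,
          smul_eq_mul]))
    (fun v v' => lor_comm _ _)
    (fun v hv => lor_fderiv_pos h.hyp_coneOf hd hinj fun h1 => hv (congrArg Prod.snd h1))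
  choose s hs using fun a => h.exists_lift hdim ((ρ y)⁻¹ • u a)
  have hsh := fun a => h.dheight_eq_zero (hs a)
  refine ⟨Sum.elim (fun a => ((ρ y)⁻¹ • u a, s a)) fun j => (0, v (finCongr hdim.symm j)), ?_,
    fun a => rfl, fun j => rfl⟩
  rintro (a | a) (c | c)
  · simp only [Sum.elim_inl, h.lor_fderiv_coneOf, hs, hsh, map_smul, lor_smul_left, lor_smul_right,
      hu, Sum.inl.injEq]
    simp only [mul_zero, sub_zero, Finset.sum_const_zero, add_zero]
    split_ifs
    · field_simp
    · ring
  · simp [h.lor_fderiv_coneOf, hs, hsh, lor_zero_right]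
  · simp [h.lor_fderiv_coneOf, hs, hsh, lor_zero_left]
  · have := hv (finCongr hdim.symm a) (finCongr hdim.symm c)
    simp only [EmbeddingLike.apply_eq_iff_eq, Sum.inr.injEq, Sum.elim_inr] at this ⊢
    exact this

/-- In the adapted frame the vertical vectors contribute nothing. The lifts contribute two factors
`(ρ y)⁻¹` and the second fundamental form one factor `ρ y`. -/
theorem mean_coneOf : ∑ i, ∑ j, (inducedMetric b (coneOf φ C ρ B) y)⁻¹ i j •
      secondFFCoord b (coneOf φ C ρ B) y i j =
    (ρ y)⁻¹ • perpPart (fun l => C l - lam l • φ y.1)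
      (∑ i, ∑ j, (inducedMetric b₁ φ y.1)⁻¹ i j • secondFFCoord b₁ φ y.1 i j) := by
  obtain ⟨u, hu⟩ := exists_orthonormal_basis
    (LinearMap.mk₂ ℝ (fun v v' : V₁ => lor (fderiv ℝ φ y.1 v) (fderiv ℝ φ y.1 v'))
      (by intros; rw [map_add, lor_add_left]) (by intros; rw [map_smul, lor_smul_left, smul_eq_mul])
      (by intros; rw [map_add, lor_add_right])
      (by intros; rw [map_smul, lor_smul_right, smul_eq_mul]))
    (fun v v' => lor_comm _ _)
    (fun v hv => lor_fderiv_pos h.hyp (h.smooth.differentiableAt (by simp)) h.injective hv)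
  obtain ⟨U, hU, hU1, hU2⟩ := h.exists_adapted hdim h0 u hu
  have hc : Fintype.card (Fin (Module.finrank ℝ V₁) ⊕ Fin ν) = Fintype.card ι := by
    rw [← Module.finrank_eq_card_basis b, Module.finrank_prod, hdim, Fintype.card_sum,
      Fintype.card_fin, Fintype.card_fin]
  have h1 := sum_inv_smul b U hc hU (sff b (coneOf φ C ρ B) y)
  have h2 := sum_inv_smul b₁ u (by rw [← Module.finrank_eq_card_basis b₁, Fintype.card_fin]) hu
    (sff b₁ φ y.1)
  simp only [sff_basis] at h1 h2
  rw [h1, h2, Fintype.sum_sum_type]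
  simp only [h.sff_coneOf hdim b b₁ h0, hU1, hU2, map_zero, map_smul, LinearMap.smul_apply,
    perpPart_smul, perpPart_sum, Finset.smul_sum]
  rw [Finset.sum_eq_zero (s := (Finset.univ : Finset (Fin ν))) fun j _ => by simp [perpPart, lor_zero_left], add_zero]
  refine Finset.sum_congr rfl fun a _ => ?_
  rw [smul_smul, smul_smul]
  congr 1
  field_simp

/-- By `hmin` the cone is minimal at the point, so only the squared norm of its second fundamental
form remains in `scalarCurvature_eq`, with four factors `(ρ y)⁻¹` and two factors `ρ y`. -/
theorem scalarCurvature_coneOf {κ : Type*} [Fintype κ] [DecidableEq κ] (u : κ → V₁)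
    (hκ : Fintype.card κ = Fintype.card ι₁)
    (hu : ∀ a c, lor (fderiv ℝ φ y.1 (u a)) (fderiv ℝ φ y.1 (u c)) = if a = c then 1 else 0)
    (hmin : perpPart (fun l => C l - lam l • φ y.1)
      (∑ i, ∑ j, (inducedMetric b₁ φ y.1)⁻¹ i j • secondFFCoord b₁ φ y.1 i j) = 0) :
    scalarCurvature b (inducedMetric b (coneOf φ C ρ B)) y =
      -(((Fintype.card ι : ℝ) ^ 2 - Fintype.card ι)) - ((ρ y)⁻¹) ^ 2 * ∑ a, ∑ c,
        lor (perpPart (fun l => C l - lam l • φ y.1) (sff b₁ φ y.1 (u a) (u c)))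
          (perpPart (fun l => C l - lam l • φ y.1) (sff b₁ φ y.1 (u a) (u c))) := by
  obtain ⟨U, hU, hU1, hU2⟩ := h.exists_adapted hdim h0 u hu
  have hc : Fintype.card (κ ⊕ Fin ν) = Fintype.card ι := by
    rw [← Module.finrank_eq_card_basis b, Module.finrank_prod, hdim, Fintype.card_sum,
      hκ, Fintype.card_fin, ← Module.finrank_eq_card_basis b₁]
  have hinj := (h.injective_iff hdim).2 h0
  rw [scalarCurvature_eq b h.hyp_coneOf hinj h.smooth_coneOf U hc hU, hc]
  have h1 := sum_inv_smul b U hc hU (sff b (coneOf φ C ρ B) y)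
  simp only [sff_basis] at h1
  rw [← h1, h.mean_coneOf hdim b b₁ h0, hmin, smul_zero, lor_zero_left]
  have hf2 : ContDiffAt ℝ 2 (coneOf φ C ρ B) y := h.smooth_coneOf.of_le (by norm_num)
  have e1 : ∀ a c, lor (sff b (coneOf φ C ρ B) y (U a) (U c)) (sff b (coneOf φ C ρ B) y (U c) (U a)) =
      lor (sff b (coneOf φ C ρ B) y (U a) (U c)) (sff b (coneOf φ C ρ B) y (U a) (U c)) :=
    fun a c => by rw [sff_symm b h.hyp_coneOf hinj hf2 (U c) (U a)]
  have e2 : perpPart (fun l => C l - lam l • φ y.1) 0 = 0 := by simp [perpPart, lor_zero_left]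
  simp only [e1]
  simp only [h.sff_coneOf hdim b b₁ h0, Fintype.sum_sum_type, hU1, hU2, map_zero,
    LinearMap.zero_apply, e2, map_smul, LinearMap.smul_apply, mul_zero, lor_zero_left,
    perpPart_smul, lor_smul_left, lor_smul_right, Finset.mul_sum, Finset.sum_const_zero, add_zero]
  have e3 : ∀ t : ℝ, ρ y * (ρ y * ((ρ y)⁻¹ * ((ρ y)⁻¹ * ((ρ y)⁻¹ * ((ρ y)⁻¹ * t))))) =
      (ρ y)⁻¹ ^ 2 * t := fun t => by field_simp
  simp only [e3]
  ring

end Results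

end IsConeData

end ConeLocal

/-! ### Generalized cones -/

/-- For causal `q` with `q.1 ≤ 0`, the Cauchy–Schwarz inequality for the spatial parts would make
`lor q p` nonnegative. This selects the right sheet of the hyperboloid and the future-directed null
vectors. -/
theorem fst_pos_of_lor_neg {n : ℕ} {p q : LorentzSpace n} (hp : lor p p = -1) (hp0 : 0 < p.1)
    (hq : lor q q ≤ 0) (h : lor q p < 0) : 0 < q.1 := by
  simp only [lor, real_inner_self_eq_norm_sq] at *
  by_contra! hneg
  have h1 := neg_le_of_abs_le (abs_real_inner_le_norm q.2 p.2)
  have h2 : ‖p.2‖ ≤ p.1 := abs_le_of_sq_le_sq' (by nlinarith) hp0.le |>.2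
  have h3 : ‖q.2‖ ≤ -q.1 := abs_le_of_sq_le_sq' (by nlinarith) (by linarith) |>.2
  nlinarith [mul_le_mul h3 h2 (norm_nonneg _) (by linarith : 0 ≤ -q.1)]

/-- The map `t ↦ (sinh ‖t‖ / ‖t‖) t` has squared norm `cosh² ‖t‖ - 1`. A vector in the kernel of its
differential is therefore orthogonal to `t`, and on such vectors the differential is multiplication
by a positive number. -/
theorem eq_zero_of_fderiv_sinhc {ν : ℕ} {t v : EuclideanSpace ℝ (Fin ν)}
    (h : fderiv ℝ (fun t : EuclideanSpace ℝ (Fin ν) => sinhcSqrt (‖t‖ ^ 2) • t) t v = 0) :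
    v = 0 := by
  have hn : HasFDerivAt (fun t : EuclideanSpace ℝ (Fin ν) => ‖t‖ ^ 2) (2 • innerSL ℝ t) t :=
    (hasStrictFDerivAt_norm_sq t).hasFDerivAt
  have hpos : 0 ≤ ‖t‖ ^ 2 := sq_nonneg _
  have hS : HasFDerivAt (fun t : EuclideanSpace ℝ (Fin ν) => sinhcSqrt (‖t‖ ^ 2))
      (deriv sinhcSqrt (‖t‖ ^ 2) • (2 • innerSL ℝ t)) t :=
    ((contDiff_sinhcSqrt.differentiable (by simp)) _).hasDerivAt.comp_hasFDerivAt t hn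
  have hC : HasFDerivAt (fun t : EuclideanSpace ℝ (Fin ν) => coshSqrt (‖t‖ ^ 2))
      ((sinhcSqrt (‖t‖ ^ 2) / 2) • (2 • innerSL ℝ t)) t :=
    (hasDerivAt_coshSqrt hpos).comp_hasFDerivAt t hn
  have hb := hS.fun_smul (hasFDerivAt_id t)
  simp only [id] at hb
  rw [hb.fderiv] at h
  have h1 := hb.norm_sq
  have h2 := (hC.pow 2).sub_const 1
  have he : (fun t : EuclideanSpace ℝ (Fin ν) => ‖sinhcSqrt (‖t‖ ^ 2) • t‖ ^ 2) =
      fun t => coshSqrt (‖t‖ ^ 2) ^ 2 - 1 := by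
    funext s
    rw [norm_smul, mul_pow, Real.norm_eq_abs, sq_abs, ← mul_pow, mul_comm, mul_sinhcSqrt_sq,
      coshSqrt_sq, Real.cosh_sq]
    ring
  rw [he] at h1
  have h3 := DFunLike.congr_fun (h1.unique h2) v
  simp only [smul_apply, ContinuousLinearMap.comp_apply, h, map_zero, smul_zero] at h3
  have hS0 := sinhcSqrt_pos hpos
  have hC0 : 0 < coshSqrt (‖t‖ ^ 2) := by rw [coshSqrt_sq]; exact Real.cosh_pos _
  have h4 : inner ℝ t v = 0 := by
    simp only [innerSL_apply_apply, smul_eq_mul, nsmul_eq_mul] at h3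
    norm_num at h3
    rcases h3 with h3 | h3
    · exact absurd h3 hC0.ne'
    · rcases h3 with h3 | h3
      · exact absurd h3 hS0.ne'
      · exact h3
  simp only [add_apply, smul_apply, ContinuousLinearMap.smulRight_apply, innerSL_apply_apply, h4,
    smul_zero, zero_smul, add_zero] at h
  exact (smul_eq_zero.1 h).resolve_left hS0.ne'

/-! ### The cone in the parallel frame. -/

section Cone

variable {n ν : ℕ} {k : ℕ} {N : Type*} [TopologicalSpace N]
  [ChartedSpace (EuclideanSpace ℝ (Fin k)) N]
  {L : Type*} [TopologicalSpace L] [ChartedSpace (EuclideanSpace ℝ (Fin 2)) L]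
  {i : N → LorentzSpace n} {c : ℝ} {g : L → N}
  {C : Fin ν → LorentzSpace n} {lam : Fin ν → ℝ}

theorem normalSpace_sum {q : N} {κ : Type*} (s : Finset κ) (a : κ → ℝ) {e : κ → LorentzSpace n}
    (he : ∀ j, e j ∈ normalSpace k i q) : ∑ j ∈ s, a j • e j ∈ normalSpace k i q := by
  refine ⟨?_, fun v hv => ?_⟩
  · rw [lor_sum_left]
    exact Finset.sum_eq_zero fun j _ => by rw [lor_smul_left, (he j).1, mul_zero]
  · rw [lor_sum_left]
    exact Finset.sum_eq_zero fun j _ => by rw [lor_smul_left, (he j).2 v hv, mul_zero]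

theorem IsUmbilicalInclusion.eq_sum [IsManifold (𝓡 k) ∞ N] (hi : IsUmbilicalInclusion k i c)
    (hn : ν + k = n) {q : N} {e : Fin ν → LorentzSpace n} (he : ∀ j, e j ∈ normalSpace k i q)
    (ho : ∀ j l, lor (e j) (e l) = if j = l then 1 else 0) {w : LorentzSpace n}
    (hw : w ∈ normalSpace k i q) : w = ∑ j, lor w (e j) • e j := by
  refine eq_sum_of_mem_perpSpace (hi.lor_self q) (hi.injective q) (fun X => ?_) ?_
    (fun j => hi.mem_normalSpace_iff.1 (he j)) ho (hi.mem_normalSpace_iff.1 hw)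
  · have := lor_fderiv_self (fun z => hi.lor_self ((extChartAt (𝓡 k) q).symm z))
      ((contDiffAt_rep hi.smooth q (mem_extChartAt_target q)).differentiableAt (by simp)) X
    rwa [extChartAt_to_inv] at this
  · rw [finrank_euclideanSpace_fin, Fintype.card_fin]; exact hn

theorem sum_lor_sq [IsManifold (𝓡 k) ∞ N] (hi : IsUmbilicalInclusion k i c)
    (hn : ν + k = n) {q : N} {e : Fin ν → LorentzSpace n} (he : ∀ j, e j ∈ normalSpace k i q)
    (ho : ∀ j l, lor (e j) (e l) = if j = l then 1 else 0) {w : LorentzSpace n}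
    (hw : w ∈ normalSpace k i q) (w' : LorentzSpace n) :
    lor w w' = ∑ j, lor w (e j) * lor (e j) w' := by
  conv_lhs => rw [hi.eq_sum hn he ho hw]
  rw [lor_sum_left]
  simp only [lor_smul_left]

/-- The vectors of the parallel frame along `g`. -/
def pframe (i : N → LorentzSpace n) (g : L → N) (C : Fin ν → LorentzSpace n) (lam : Fin ν → ℝ)
    (x : L) (l : Fin ν) : LorentzSpace n := C l - lam l • i (g x)

variable (χ : NormalFrame k i ν)

/-- The vector of the normal space with the coordinates `t`. -/
def nvec (g : L → N) (z : L × EuclideanSpace ℝ (Fin ν)) : LorentzSpace n :=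
  ∑ j, z.2 j • χ.vec j (g z.1)

theorem nvec_mem (z : L × EuclideanSpace ℝ (Fin ν)) : nvec χ g z ∈ normalSpace k i (g z.1) :=
  normalSpace_sum _ _ fun j => χ.normal j _

theorem lor_nvec (z : L × EuclideanSpace ℝ (Fin ν)) (j : Fin ν) :
    lor (nvec χ g z) (χ.vec j (g z.1)) = z.2 j := by
  rw [nvec, lor_sum_left]
  simp [lor_smul_left, χ.orthonormal]

theorem lor_nvec_self (z : L × EuclideanSpace ℝ (Fin ν)) :
    lor (nvec χ g z) (nvec χ g z) = ‖z.2‖ ^ 2 := by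
  conv_lhs => rw [nvec]
  rw [lor_sum_left, EuclideanSpace.norm_sq_eq]
  refine Finset.sum_congr rfl fun j _ => ?_
  rw [lor_smul_left, lor_comm, ← nvec, lor_nvec, Real.norm_eq_abs, sq_abs, sq]

theorem cone_eq (z : L × EuclideanSpace ℝ (Fin ν)) : χ.cone g z =
    coshSqrt (‖z.2‖ ^ 2) • i (g z.1) + sinhcSqrt (‖z.2‖ ^ 2) • nvec χ g z := by
  have h1 : lnorm (nvec χ g z) = ‖z.2‖ := by
    rw [lnorm, lor_nvec_self, Real.sqrt_sq (norm_nonneg _)]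
  change hexp (i (g z.1)) (nvec χ g z) = _
  rw [hexp, h1, coshSqrt_sq]
  congr 1
  -- At the zero vector the quotient in `hexp` is `0 / 0 = 0` while `sinhcSqrt 0 = 1`; this is
  -- harmless since both multiply zero.
  rcases eq_or_ne ‖z.2‖ 0 with h0 | h0
  · have : nvec χ g z = 0 := by simp [nvec, norm_eq_zero.1 h0]
    rw [this, smul_zero, smul_zero]
  · rw [← mul_sinhcSqrt_sq, mul_div_cancel_left₀ _ h0]

variable [IsManifold (𝓡 k) ∞ N] [IsManifold (𝓡 2) ∞ L] (hi : IsUmbilicalInclusion k i c)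
  (hg : IsMinimalSurface k i g) (hP : IsParallelFrame k i C lam) (hn : ν + k = n)

include hi in
theorem lor_cone_base (z : L × EuclideanSpace ℝ (Fin ν)) :
    lor (χ.cone g z) (i (g z.1)) = -Real.cosh ‖z.2‖ := by
  rw [cone_eq, lor_add_left, lor_smul_left, lor_smul_left, hi.lor_self, (nvec_mem χ z).1,
    coshSqrt_sq]
  ring

include hi in
theorem cone_mem (z : L × EuclideanSpace ℝ (Fin ν)) : χ.cone g z ∈ hyperbolicSpace n := by
  have h1 : lor (χ.cone g z) (χ.cone g z) = -1 := by
    have h2 : lor (χ.cone g z) (nvec χ g z) = sinhcSqrt (‖z.2‖ ^ 2) * ‖z.2‖ ^ 2 := by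
      rw [cone_eq, lor_add_left, lor_smul_left, lor_smul_left, lor_nvec_self, lor_comm,
        (nvec_mem χ z).1]
      ring
    conv_lhs => enter [2]; rw [cone_eq]
    rw [lor_add_right, lor_smul_right, lor_smul_right, lor_cone_base χ hi, h2, coshSqrt_sq]
    have h3 := mul_sinhcSqrt_sq ‖z.2‖
    have h4 := Real.cosh_sq ‖z.2‖
    rw [← h3] at h4
    linear_combination -h4
  refine ⟨h1, fst_pos_of_lor_neg (hi.lor_self (g z.1)) (hi.mem (g z.1)).2 (by rw [h1]; norm_num) ?_⟩
  rw [lor_cone_base χ hi]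
  linarith [Real.cosh_pos ‖z.2‖]

include hi in
theorem triv_bijective (hn : ν + k = n) : Function.Bijective (χ.triv g) := by
  constructor
  · rintro ⟨x, t⟩ ⟨x', t'⟩ h
    have h1 := congrArg Subtype.val h
    have hx : x = x' := congrArg Prod.fst h1
    subst hx
    have h2 : nvec χ g (x, t) = nvec χ g (x, t') := congrArg Prod.snd h1
    congr 1
    ext j
    rw [← lor_nvec χ (g := g) (x, t) j, h2, lor_nvec]
  · rintro ⟨⟨x, w⟩, hw⟩
    refine ⟨(x, WithLp.toLp 2 fun j => lor w (χ.vec j (g x))), Subtype.ext (Prod.ext rfl ?_)⟩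
    exact (hi.eq_sum hn (fun j => χ.normal j (g x)) (fun j l => χ.orthonormal j l (g x)) hw).symm

/-- The components of the cone in the parallel frame. -/
def coeffB (i : N → LorentzSpace n) (g : L → N) (C : Fin ν → LorentzSpace n) (lam : Fin ν → ℝ)
    (χ : NormalFrame k i ν) (l : Fin ν) (z : L × EuclideanSpace ℝ (Fin ν)) : ℝ :=
  lor (χ.cone g z) (pframe i g C lam z.1 l)

/-- The factor by which the cone stretches the tangent spaces of the surface. -/
def stretch (i : N → LorentzSpace n) (g : L → N) (C : Fin ν → LorentzSpace n) (lam : Fin ν → ℝ)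
    (χ : NormalFrame k i ν) (z : L × EuclideanSpace ℝ (Fin ν)) : ℝ :=
  -lor (χ.cone g z) (i (g z.1)) - ∑ l, lam l * coeffB i g C lam χ l z

include hg in
theorem contMDiff_base (hi : IsUmbilicalInclusion k i c) :
    ContMDiff (𝓡 2) 𝓘(ℝ, LorentzSpace n) ∞ (i ∘ g) := hi.smooth.comp hg.smooth

include hi hg in
theorem contMDiff_cone : ContMDiff ((𝓡 2).prod (𝓡 ν)) 𝓘(ℝ, LorentzSpace n) ∞ (χ.cone g) := by
  have e : χ.cone g = fun z => coshSqrt (‖z.2‖ ^ 2) • i (g z.1) +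
      sinhcSqrt (‖z.2‖ ^ 2) • ∑ j, z.2 j • χ.vec j (g z.1) := funext fun z => cone_eq χ z
  rw [e]
  have h2 : ContMDiff ((𝓡 2).prod (𝓡 ν)) (𝓡 ν) ∞
      (Prod.snd : L × EuclideanSpace ℝ (Fin ν) → EuclideanSpace ℝ (Fin ν)) := contMDiff_snd
  have h1 : ContMDiff ((𝓡 2).prod (𝓡 ν)) (𝓡 2) ∞
      (Prod.fst : L × EuclideanSpace ℝ (Fin ν) → L) := contMDiff_fst
  have hnorm : ContDiff ℝ ∞ fun t : EuclideanSpace ℝ (Fin ν) => ‖t‖ ^ 2 := contDiff_norm_sq ℝ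
  have hC := (contDiff_coshSqrt.comp hnorm).contMDiff.comp h2
  have hS := (contDiff_sinhcSqrt.comp hnorm).contMDiff.comp h2
  have ht : ∀ j, ContMDiff ((𝓡 2).prod (𝓡 ν)) 𝓘(ℝ, ℝ) ∞
      (fun z : L × EuclideanSpace ℝ (Fin ν) => z.2 j) := fun j =>
    ((EuclideanSpace.proj (𝕜 := ℝ) j).contDiff.contMDiff).comp h2
  refine (hC.smul ((contMDiff_base hg hi).comp h1)).add (hS.smul ?_)
  refine contMDiff_finsetSum fun j _ => (ht j).smul ((χ.smooth j).comp (hg.smooth.comp h1))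

include hP

theorem pframe_mem (x : L) (l : Fin ν) : pframe i g C lam x l ∈ normalSpace k i (g x) :=
  hP.normal l (g x)

theorem pframe_orthonormal (x : L) (l m : Fin ν) :
    lor (pframe i g C lam x l) (pframe i g C lam x m) = if l = m then 1 else 0 :=
  hP.orthonormal l m (g x)

theorem coeffB_eq (l : Fin ν) (z : L × EuclideanSpace ℝ (Fin ν)) : coeffB i g C lam χ l z =
    sinhcSqrt (‖z.2‖ ^ 2) * lor (nvec χ g z) (pframe i g C lam z.1 l) := by
  rw [coeffB, cone_eq, lor_add_left, lor_smul_left, lor_smul_left, lor_comm (i _),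
    (pframe_mem hP z.1 l).1, mul_zero, zero_add]

include hi hn in
theorem sum_coeffB_sq (z : L × EuclideanSpace ℝ (Fin ν)) :
    ∑ l, coeffB i g C lam χ l z ^ 2 = Real.sinh ‖z.2‖ ^ 2 := by
  have h1 := sum_lor_sq hi hn (pframe_mem (g := g) hP z.1) (pframe_orthonormal (g := g) hP z.1)
    (nvec_mem χ (g := g) z)
    (nvec χ g z)
  rw [lor_nvec_self] at h1
  simp only [coeffB_eq χ hP]
  rw [← mul_sinhcSqrt_sq, mul_pow]
  generalize sinhcSqrt (‖z.2‖ ^ 2) = S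
  rw [h1, Finset.sum_mul]
  exact Finset.sum_congr rfl fun l _ => by rw [lor_comm (pframe i g C lam z.1 l)]; ring

include hi hn in
-- Replacing each frame vector by `C l - lam l • i (g x)` and collecting the multiples of `i (g x)`
-- produces the factor `stretch`. What remains has constant vectors.
theorem cone_eq_coneOf (z : L × EuclideanSpace ℝ (Fin ν)) : χ.cone g z =
    stretch i g C lam χ z • i (g z.1) + ∑ l, coeffB i g C lam χ l z • C l := by
  have h1 := hi.eq_sum hn (pframe_mem (g := g) hP z.1) (pframe_orthonormal (g := g) hP z.1)
    (nvec_mem χ (g := g) z)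
  have h2 : χ.cone g z = Real.cosh ‖z.2‖ • i (g z.1) +
      ∑ l, coeffB i g C lam χ l z • pframe i g C lam z.1 l := by
    rw [cone_eq, coshSqrt_sq]
    congr 1
    conv_lhs => rw [h1]
    rw [Finset.smul_sum]
    exact Finset.sum_congr rfl fun l _ => by rw [coeffB_eq χ hP, smul_smul]
  rw [h2, stretch, lor_cone_base χ hi]
  simp only [pframe, smul_sub, Finset.sum_sub_distrib, sub_smul, Finset.sum_smul, smul_smul, neg_neg,
    mul_comm (lam _)]
  abel

/-- The coordinates of the mean curvature vector of `i` in the frame `χ`. -/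
def meanCoord (i : N → LorentzSpace n) (g : L → N) (C : Fin ν → LorentzSpace n) (lam : Fin ν → ℝ)
    (χ : NormalFrame k i ν) (x : L) : EuclideanSpace ℝ (Fin ν) :=
  WithLp.toLp 2 fun j => lor (χ.vec j (g x)) (∑ l, lam l • pframe i g C lam x l)

include hi in
theorem stretch_eq (z : L × EuclideanSpace ℝ (Fin ν)) : stretch i g C lam χ z =
    Real.cosh ‖z.2‖ - sinhcSqrt (‖z.2‖ ^ 2) * inner ℝ z.2 (meanCoord i g C lam χ z.1) := by
  rw [stretch, lor_cone_base χ hi, neg_neg]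
  congr 1
  have h1 : ∑ l, lam l * coeffB i g C lam χ l z =
      sinhcSqrt (‖z.2‖ ^ 2) * lor (nvec χ g z) (∑ l, lam l • pframe i g C lam z.1 l) := by
    rw [lor_sum_right, Finset.mul_sum]
    exact Finset.sum_congr rfl fun l _ => by rw [coeffB_eq χ hP, lor_smul_right]; ring
  rw [h1, nvec, lor_sum_left, PiLp.inner_apply]
  congr 1
  refine Finset.sum_congr rfl fun j _ => ?_
  rw [lor_smul_left, meanCoord]
  simp [mul_comm]

include hi hn in
-- Both `χ` and the parallel frame are orthonormal in the same normal space, so the length of the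
-- mean curvature vector may be computed in either. It depends neither on `χ` nor on `x`.
theorem norm_meanCoord_sq (x : L) : ‖meanCoord i g C lam χ x‖ ^ 2 = ∑ l, lam l ^ 2 := by
  have hη : ∑ l, lam l • pframe i g C lam x l ∈ normalSpace k i (g x) :=
    normalSpace_sum _ _ (pframe_mem hP x)
  have h1 := sum_lor_sq hi hn (fun j => χ.normal j (g x)) (fun j l => χ.orthonormal j l (g x)) hη
    (∑ l, lam l • pframe i g C lam x l)
  have h2 : lor (∑ l, lam l • pframe i g C lam x l) (∑ l, lam l • pframe i g C lam x l) =
      ∑ l, lam l ^ 2 := by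
    simp [lor_sum_left, lor_sum_right, lor_smul_left, lor_smul_right, pframe_orthonormal hP, sq]
  rw [← h2, h1, EuclideanSpace.norm_sq_eq]
  refine Finset.sum_congr rfl fun j _ => ?_
  rw [Real.norm_eq_abs, sq_abs, sq, meanCoord, lor_comm (∑ l, lam l • pframe i g C lam x l)]

end Cone

/-! ### The cone in charts: immersion set, minimality, relative nullity, scalar curvature. -/

section ConeCharts

variable {n ν : ℕ} {k : ℕ} {N : Type*} [TopologicalSpace N]
  [ChartedSpace (EuclideanSpace ℝ (Fin k)) N] [IsManifold (𝓡 k) ∞ N]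
  {L : Type*} [TopologicalSpace L] [ChartedSpace (EuclideanSpace ℝ (Fin 2)) L]
  [IsManifold (𝓡 2) ∞ L]
  {i : N → LorentzSpace n} {c : ℝ} {g : L → N}
  {C : Fin ν → LorentzSpace n} {lam : Fin ν → ℝ} (χ : NormalFrame k i ν)
  (hi : IsUmbilicalInclusion k i c) (hg : IsMinimalSurface k i g)
  (hP : IsParallelFrame k i C lam) (hn : ν + k = n)

/-- A function on `L × ℝ^ν` in the chart of `L` at `x`. -/
def inChart (x : L) (f : L × EuclideanSpace ℝ (Fin ν) → ℝ)
    (y : EuclideanSpace ℝ (Fin 2) × EuclideanSpace ℝ (Fin ν)) : ℝ :=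
  f ((extChartAt (𝓡 2) x).symm y.1, y.2)

theorem inChart_self (z : L × EuclideanSpace ℝ (Fin ν))
    (f : L × EuclideanSpace ℝ (Fin ν) → ℝ) :
    inChart z.1 f (extChartAt (𝓡 2) z.1 z.1, z.2) = f z := by
  rw [inChart, extChartAt_to_inv]

theorem rep_prod (F : L × EuclideanSpace ℝ (Fin ν) → LorentzSpace n)
    (z : L × EuclideanSpace ℝ (Fin ν))
    (y : EuclideanSpace ℝ (Fin 2) × EuclideanSpace ℝ (Fin ν)) :
    rep ((𝓡 2).prod (𝓡 ν)) F z y = F ((extChartAt (𝓡 2) z.1).symm y.1, y.2) := by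
  simp only [rep, extChartAt_prod, Function.comp_apply, PartialEquiv.prod_symm,
    PartialEquiv.prod_coe]
  rfl

theorem extChartAt_prod_self (z : L × EuclideanSpace ℝ (Fin ν)) :
    extChartAt ((𝓡 2).prod (𝓡 ν)) z z = (extChartAt (𝓡 2) z.1 z.1, z.2) := by
  simp only [extChartAt_prod, PartialEquiv.prod_coe]
  rfl

include hi hP hn in
theorem rep_cone (z : L × EuclideanSpace ℝ (Fin ν)) :
    rep ((𝓡 2).prod (𝓡 ν)) (χ.cone g) z = coneOf (rep (𝓡 2) (i ∘ g) z.1) C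
      (inChart z.1 (stretch i g C lam χ)) fun l => inChart z.1 (coeffB i g C lam χ l) := by
  funext y
  rw [rep_prod, cone_eq_coneOf χ hi hP hn]
  rfl

include hi hg in
theorem injective_base (x : L) :
    Function.Injective (fderiv ℝ (rep (𝓡 2) (i ∘ g) x) (extChartAt (𝓡 2) x x)) := by
  rw [← mfderiv_eq_fderiv_rep (contMDiff_base hg hi),
    mfderiv_comp x ((hi.smooth _).mdifferentiableAt (by simp))
      ((hg.smooth _).mdifferentiableAt (by simp))]
  exact (hi.immersion (g x)).comp (hg.immersion x)

include hi hP hn in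
-- On a fiber the functions `coeffB` are the components, in the parallel frame, of the normal vector
-- with coordinates `sinhcSqrt (‖t‖ ^ 2) • t`. Passing to these components is injective because the
-- parallel frame spans the normal space.
theorem eq_zero_of_fderiv_coeffB (x : L) (y : EuclideanSpace ℝ (Fin 2) × EuclideanSpace ℝ (Fin ν))
    (hB : ∀ l, DifferentiableAt ℝ (inChart x (coeffB i g C lam χ l)) y)
    (v : EuclideanSpace ℝ (Fin ν))
    (hv : ∀ l, fderiv ℝ (inChart x (coeffB i g C lam χ l)) y (0, v) = 0) : v = 0 := by
  set x' := (extChartAt (𝓡 2) x).symm y.1 with hx'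
  let T : Fin ν → EuclideanSpace ℝ (Fin ν) →L[ℝ] ℝ := fun l => ∑ j,
    lor (χ.vec j (g x')) (pframe i g C lam x' l) • EuclideanSpace.proj (𝕜 := ℝ) j
  have hT : ∀ l t, T l t = lor (nvec χ g (x', t)) (pframe i g C lam x' l) := fun l t => by
    simp only [T, nvec, lor_sum_left, lor_smul_left, sum_apply, smul_apply, smul_eq_mul]
    exact Finset.sum_congr rfl fun j _ => mul_comm _ _
  set b : EuclideanSpace ℝ (Fin ν) → EuclideanSpace ℝ (Fin ν) :=
    fun t => sinhcSqrt (‖t‖ ^ 2) • t with hb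
  have hbd : DifferentiableAt ℝ b y.2 :=
    ((contDiff_sinhcSqrt.comp (contDiff_norm_sq ℝ)).smul contDiff_id).differentiable
      (by simp) y.2
  apply eq_zero_of_fderiv_sinhc (t := y.2)
  set w := fderiv ℝ b y.2 v with hw
  have h1 : ∀ l, T l w = 0 := fun l => by
    have e1 : (fun t => inChart x (coeffB i g C lam χ l) (y.1, t)) = fun t => T l (b t) := by
      funext t
      rw [hb, map_smul, hT, smul_eq_mul]
      exact coeffB_eq χ hP l (x', t)
    have e2 : HasFDerivAt (fun t : EuclideanSpace ℝ (Fin ν) => (y.1, t))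
      (ContinuousLinearMap.inr ℝ _ _) y.2 := hasFDerivAt_prodMk_right y.1 y.2
    have e3 := HasFDerivAt.comp (x := y.2) (f := fun t : EuclideanSpace ℝ (Fin ν) => (y.1, t))
      (hB l).hasFDerivAt e2
    have e4 := ((T l).hasFDerivAt (x := b y.2)).comp y.2 hbd.hasFDerivAt
    have e5 : inChart x (coeffB i g C lam χ l) ∘ (fun t : EuclideanSpace ℝ (Fin ν) => (y.1, t)) =
      T l ∘ b := e1
    rw [e5] at e3
    have := DFunLike.congr_fun (e3.unique e4) v
    exact this.symm.trans (hv l)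
  have h2 : nvec χ g (x', w) = 0 := by
    rw [hi.eq_sum hn (pframe_mem (g := g) hP x') (pframe_orthonormal (g := g) hP x')
      (nvec_mem χ (g := g) (x', w))]
    exact Finset.sum_eq_zero fun l _ => by rw [← hT, h1, zero_smul]
  ext j
  have h3 := lor_nvec χ (g := g) (x', w) j
  rw [h2, lor_zero_left] at h3
  exact h3.symm

include hi hg hP hn

theorem isConeData (z : L × EuclideanSpace ℝ (Fin ν)) :
    IsConeData (rep (𝓡 2) (i ∘ g) z.1) C lam (inChart z.1 (stretch i g C lam χ))
      (fun l => inChart z.1 (coeffB i g C lam χ l)) (extChartAt (𝓡 2) z.1 z.1, z.2) := by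
  have hb : ContDiffAt ℝ ∞ (rep (𝓡 2) (i ∘ g) z.1) (extChartAt (𝓡 2) z.1 z.1) :=
    contDiffAt_rep (contMDiff_base hg hi) z.1 (mem_extChartAt_target z.1)
  have hb3 : ContDiffAt ℝ 3 (fun y : EuclideanSpace ℝ (Fin 2) × EuclideanSpace ℝ (Fin ν) =>
      rep (𝓡 2) (i ∘ g) z.1 y.1) (extChartAt (𝓡 2) z.1 z.1, z.2) :=
    ContDiffAt.comp (f := Prod.fst) (g := rep (𝓡 2) (i ∘ g) z.1) _ (hb.of_le three_le_infty)
      contDiffAt_fst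
  have hc : ContDiffAt ℝ ∞ (rep ((𝓡 2).prod (𝓡 ν)) (χ.cone g) z)
      (extChartAt (𝓡 2) z.1 z.1, z.2) := by
    rw [← extChartAt_prod_self]
    exact contDiffAt_rep (contMDiff_cone χ hi hg) z (mem_extChartAt_target z)
  have hc3 := hc.of_le three_le_infty
  have hB : ∀ l, ContDiffAt ℝ 3 (inChart z.1 (coeffB i g C lam χ l))
      (extChartAt (𝓡 2) z.1 z.1, z.2) := fun l => by
    have e : inChart z.1 (coeffB i g C lam χ l) = fun y =>
        lor (rep ((𝓡 2).prod (𝓡 ν)) (χ.cone g) z y)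
          (C l - lam l • rep (𝓡 2) (i ∘ g) z.1 y.1) := by
      funext y; rw [rep_prod]; rfl
    rw [e]
    exact hc3.lor (contDiffAt_const.sub (hb3.const_smul (lam l)))
  have hlor : ∀ l (q : N), lor (C l) (i q) = -lam l := fun l q => by
    have := (hP.normal l q).1
    rw [lor_sub_left, lor_smul_left, hi.lor_self] at this
    linarith
  refine ⟨fun y => hi.lor_self _, hb.of_le three_le_infty, injective_base hi hg z.1,
    fun l y => hlor l _, fun l m => ?_, ?_, hB, fun y => ?_, fun v hv => ?_⟩
  · have := hP.orthonormal l m (g z.1)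
    rw [lor_sub_right, lor_smul_right, lor_sub_left, lor_smul_left, lor_sub_left, lor_smul_left,
      lor_comm (i _) (C m), hlor, hlor, hi.lor_self] at this
    linarith
  · have e : inChart z.1 (stretch i g C lam χ) = fun y =>
        -lor (rep ((𝓡 2).prod (𝓡 ν)) (χ.cone g) z y) (rep (𝓡 2) (i ∘ g) z.1 y.1) -
          ∑ l, lam l * inChart z.1 (coeffB i g C lam χ l) y := by
      funext y; rw [rep_prod]; rfl
    rw [e]
    exact (hc3.lor hb3).neg.sub (ContDiffAt.sum fun l _ => contDiffAt_const.mul (hB l))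
  · have h1 := sum_coeffB_sq χ hi hP hn (g := g) ((extChartAt (𝓡 2) z.1).symm y.1, y.2)
    simp only [inChart, stretch]
    rw [h1, lor_cone_base χ hi]
    have := Real.cosh_sq ‖y.2‖
    simp only at this ⊢
    linarith
  · exact eq_zero_of_fderiv_coeffB χ hi hP hn z.1 _ (fun l => (hB l).differentiableAt (by simp)) v hv

theorem mem_domain_iff (z : L × EuclideanSpace ℝ (Fin ν)) :
    z ∈ χ.domain g ↔ stretch i g C lam χ z ≠ 0 := by
  have h := isConeData χ hi hg hP hn z
  have h1 := h.injective_iff (by rw [finrank_euclideanSpace_fin])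
  rw [inChart_self z (stretch i g C lam χ), ← rep_cone χ hi hP hn, ← extChartAt_prod_self,
    ← mfderiv_eq_fderiv_rep (contMDiff_cone χ hi hg)] at h1
  exact h1

theorem isOpen_domain : IsOpen (χ.domain g) := by
  have hc : Continuous (stretch i g C lam χ) := by
    have h1 := (contMDiff_cone χ hi hg).continuous
    have h2 : Continuous fun z : L × EuclideanSpace ℝ (Fin ν) => i (g z.1) :=
      (contMDiff_base hg hi).continuous.comp continuous_fst
    have hl : ∀ {a b : L × EuclideanSpace ℝ (Fin ν) → LorentzSpace n}, Continuous a →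
        Continuous b → Continuous fun z => lor (a z) (b z) := fun ha hb =>
      continuous_lor.comp (ha.prodMk hb)
    unfold stretch coeffB pframe
    exact (hl h1 h2).neg.sub (continuous_finsetSum _ fun l _ => continuous_const.mul
      (hl h1 (continuous_const.sub (h2.const_smul (lam l)))))
  have : χ.domain g = stretch i g C lam χ ⁻¹' {0}ᶜ := by
    ext z; exact mem_domain_iff χ hi hg hP hn z
  rw [this]
  exact isOpen_compl_singleton.preimage hc

omit hg in
theorem perpPart_eq_zero {x : L} {w : LorentzSpace n} (h0 : lor w (i (g x)) = 0)
    (hw : ∀ v ∈ tangentImage k i (g x), lor w v = 0) : perpPart (pframe i g C lam x) w = 0 := by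
  have := hi.eq_sum hn (pframe_mem (g := g) hP x) (pframe_orthonormal (g := g) hP x) ⟨h0, hw⟩
  rw [perpPart, ← this, sub_self]

/-- By minimality of `g` the mean curvature vector of `i ∘ g` is normal to `N`, so it is a
combination of the frame. -/
theorem perpPart_mean (x : L) :
    perpPart (pframe i g C lam x) (meanCurvature (𝓡 2) (i ∘ g) x) = 0 := by
  refine perpPart_eq_zero hi hP hn ?_ (hg.minimal x)
  have hh : ∀ y, lor (rep (𝓡 2) (i ∘ g) x y) (rep (𝓡 2) (i ∘ g) x y) = -1 :=
    fun y => hi.lor_self _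
  have hb := (contDiffAt_rep (contMDiff_base hg hi) x (mem_extChartAt_target x)).of_le two_le_infty
  have e0 : i (g x) = rep (𝓡 2) (i ∘ g) x (extChartAt (𝓡 2) x x) := by
    rw [rep, Function.comp_apply, extChartAt_to_inv]; rfl
  rw [e0, meanCurvature]
  simp only [lor_sum_left, lor_smul_left, lor_secondFFCoord_self _ hh hb, mul_zero,
    Finset.sum_const_zero]

theorem meanCurvature_cone {z : L × EuclideanSpace ℝ (Fin ν)} (hz : z ∈ χ.domain g) :
    meanCurvature ((𝓡 2).prod (𝓡 ν)) (χ.cone g) z = 0 := by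
  have h := isConeData χ hi hg hP hn z
  have h0 := (mem_domain_iff χ hi hg hP hn z).1 hz
  rw [← inChart_self z (stretch i g C lam χ)] at h0
  have h1 := h.mean_coneOf (by rw [finrank_euclideanSpace_fin]) (Module.finBasis ℝ _)
    (Module.finBasis ℝ _) h0
  rw [meanCurvature, extChartAt_prod_self, rep_cone χ hi hP hn]
  refine h1.trans ?_
  have h2 := perpPart_mean hi hg hP hn z.1
  have h3 : (fun l => C l - lam l • rep (𝓡 2) (i ∘ g) z.1 (extChartAt (𝓡 2) z.1 z.1)) =
      pframe i g C lam z.1 := by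
    funext l; rw [rep, Function.comp_apply, extChartAt_to_inv]; rfl
  rw [h3]
  exact (congrArg _ h2).trans (smul_zero _)

/-- Vertical vectors have zero first component, and `sff_coneOf` depends only on the first
components. -/
theorem le_relativeNullity {z : L × EuclideanSpace ℝ (Fin ν)} (hz : z ∈ χ.domain g) :
    ν ≤ relativeNullity ((𝓡 2).prod (𝓡 ν)) (χ.cone g) z := by
  have h := isConeData χ hi hg hP hn z
  have h0 := (mem_domain_iff χ hi hg hP hn z).1 hz
  rw [← inChart_self z (stretch i g C lam χ)] at h0
  have h1 := h.sff_coneOf (by rw [finrank_euclideanSpace_fin]) (Module.finBasis ℝ _)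
    (Module.finBasis ℝ _) h0
  rw [← rep_cone χ hi hP hn, ← extChartAt_prod_self] at h1
  have h2 : Module.finrank ℝ (LinearMap.range (LinearMap.inr ℝ (EuclideanSpace ℝ (Fin 2))
      (EuclideanSpace ℝ (Fin ν)))) = ν := by
    rw [LinearMap.finrank_range_of_inj LinearMap.inr_injective, finrank_euclideanSpace_fin]
  conv_lhs => rw [← h2]
  have e : relativeNullity ((𝓡 2).prod (𝓡 ν)) (χ.cone g) z = Module.finrank ℝ (LinearMap.ker
      (sff (Module.finBasis ℝ (EuclideanSpace ℝ (Fin 2) × EuclideanSpace ℝ (Fin ν)))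
        (rep ((𝓡 2).prod (𝓡 ν)) (χ.cone g) z) (extChartAt ((𝓡 2).prod (𝓡 ν)) z z))) := rfl
  rw [e]
  refine Submodule.finrank_mono ?_
  rintro _ ⟨v, rfl⟩
  refine LinearMap.mem_ker.2 (LinearMap.ext fun Y => (h1 _ Y).trans ?_)
  simp [perpPart, lor_zero_left]

/-- The scalar curvature along a fiber. -/
theorem exists_scalAt_eq (x : L) : ∃ K : ℝ, 0 ≤ K ∧ (¬IsTotallyGeodesicAt k i g x → 0 < K) ∧
    ∀ t, stretch i g C lam χ (x, t) ≠ 0 → scalAt ((𝓡 2).prod (𝓡 ν)) (χ.cone g) (x, t) =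
      -((2 + ν : ℝ) ^ 2 - (2 + ν)) - ((stretch i g C lam χ (x, t))⁻¹) ^ 2 * K := by
  set φ := rep (𝓡 2) (i ∘ g) x with hφ
  set y := extChartAt (𝓡 2) x x with hy
  have hh : ∀ y, lor (φ y) (φ y) = -1 := fun y => hi.lor_self _
  have hb : ContDiffAt ℝ 2 φ y :=
    (contDiffAt_rep (contMDiff_base hg hi) x (mem_extChartAt_target x)).of_le two_le_infty
  have hφi := injective_base hi hg x
  obtain ⟨u, hu⟩ := exists_orthonormal_basis
    (LinearMap.mk₂ ℝ (fun v v' : EuclideanSpace ℝ (Fin 2) => lor (fderiv ℝ φ y v) (fderiv ℝ φ y v'))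
      (by intros; rw [map_add, lor_add_left]) (by intros; rw [map_smul, lor_smul_left, smul_eq_mul])
      (by intros; rw [map_add, lor_add_right])
      (by intros; rw [map_smul, lor_smul_right, smul_eq_mul]))
    (fun v v' => lor_comm _ _)
    (fun v hv => lor_fderiv_pos hh (hb.differentiableAt (by simp)) hφi hv)
  set b₁ := Module.finBasis ℝ (EuclideanSpace ℝ (Fin 2)) with hb₁
  set e := pframe i g C lam x with he
  have h3 : (fun l => C l - lam l • φ y) = e := by
    funext l; rw [hφ, rep, Function.comp_apply, extChartAt_to_inv]; rfl
  have hφy : φ y = i (g x) := by rw [hφ, rep, Function.comp_apply, extChartAt_to_inv]; rfl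
  have hpos : ∀ a c, lor (perpPart e (sff b₁ φ y (u a) (u c))) (φ y) = 0 := fun a c => by
    have h1 := (isNormalPart_sff b₁ hh hφi hb (u a) (u c)).perp
    rw [perpPart, lor_sub_left, h1, lor_sum_left, zero_sub, neg_eq_zero]
    refine Finset.sum_eq_zero fun l _ => ?_
    rw [lor_smul_left, hφy, (pframe_mem hP x l).1, mul_zero]
  -- The squared norm of the second fundamental form of `g`: removing the components along the
  -- normal frame leaves the part tangent to `N`.
  refine ⟨∑ a, ∑ c, lor (perpPart e (sff b₁ φ y (u a) (u c)))
    (perpPart e (sff b₁ φ y (u a) (u c))), ?_, fun hne => ?_, fun t ht => ?_⟩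
  · exact Finset.sum_nonneg fun a _ => Finset.sum_nonneg fun c _ =>
      lor_self_nonneg (hh y) (hpos a c)
  · by_contra hle
    have hz : ∀ a c, perpPart e (sff b₁ φ y (u a) (u c)) = 0 := by
      by_contra! hex
      obtain ⟨a, c, hac⟩ := hex
      refine hle (Finset.sum_pos' (fun a _ => Finset.sum_nonneg fun c _ =>
        lor_self_nonneg (hh y) (hpos a c)) ⟨a, Finset.mem_univ _, Finset.sum_pos' (fun c _ =>
        lor_self_nonneg (hh y) (hpos a c)) ⟨c, Finset.mem_univ _, lor_self_pos (hh y) (hpos a c) hac⟩⟩)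
    refine hne fun X Y v hv => ?_
    rw [show secondFF (𝓡 2) (i ∘ g) x X Y = sff b₁ φ y X Y from rfl]
    have hz2 : ∀ X Y, perpPart e (sff b₁ φ y X Y) = 0 := fun X Y => by
      rw [← u.sum_repr X, ← u.sum_repr Y]
      simp only [map_sum, map_smul, LinearMap.sum_apply, LinearMap.smul_apply, perpPart_sum,
        perpPart_smul, hz, smul_zero, Finset.sum_const_zero]
    rw [sub_eq_zero.1 (hz2 X Y), lor_sum_left]
    exact Finset.sum_eq_zero fun l _ => by
      rw [lor_smul_left, (pframe_mem hP x l).2 v hv, mul_zero]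
  · have h := isConeData χ hi hg hP hn (x, t)
    rw [← inChart_self (x, t) (stretch i g C lam χ)] at ht
    have h1 := h.scalarCurvature_coneOf (by rw [finrank_euclideanSpace_fin]) (Module.finBasis ℝ _)
      b₁ ht u (by simp) hu (by
        have := perpPart_mean hi hg hP hn x
        rw [← he, ← h3] at this
        exact this)
    rw [inChart_self (x, t), ← rep_cone χ hi hP hn] at h1
    rw [scalAt, extChartAt_prod_self, h1]
    simp only [Fintype.card_fin, Module.finrank_prod, finrank_euclideanSpace_fin]
    push_cast
    rw [← h3]

end ConeCharts

/-! ### Zeros and lower bounds of the stretching factor. -/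

section Stretch

variable {n ν : ℕ} {k : ℕ} {N : Type*} [TopologicalSpace N]
  [ChartedSpace (EuclideanSpace ℝ (Fin k)) N] [IsManifold (𝓡 k) ∞ N]
  {L : Type*} [TopologicalSpace L] [ChartedSpace (EuclideanSpace ℝ (Fin 2)) L]
  [IsManifold (𝓡 2) ∞ L]
  {i : N → LorentzSpace n} {c : ℝ} {g : L → N}
  {C : Fin ν → LorentzSpace n} {lam : Fin ν → ℝ} (χ : NormalFrame k i ν)
  (hi : IsUmbilicalInclusion k i c) (hg : IsMinimalSurface k i g)
  (hP : IsParallelFrame k i C lam) (hn : ν + k = n)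

include hi hP hn

/-- The Cauchy–Schwarz inequality for the inner product with the mean curvature vector. -/
theorem cosh_sub_le_stretch (z : L × EuclideanSpace ℝ (Fin ν)) :
    Real.cosh ‖z.2‖ - √(∑ l, lam l ^ 2) * Real.sinh ‖z.2‖ ≤ stretch i g C lam χ z := by
  rw [stretch_eq χ hi hP, ← norm_meanCoord_sq χ hi hP hn (g := g) z.1,
    Real.sqrt_sq (norm_nonneg _), ← mul_sinhcSqrt_sq]
  have h1 := real_inner_le_norm z.2 (meanCoord i g C lam χ z.1)
  nlinarith [sinhcSqrt_pos (sq_nonneg ‖z.2‖)]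

/-- Multiples of the mean curvature vector give equality in the Cauchy–Schwarz inequality. -/
theorem exists_stretch_eq (h0 : 0 < ∑ l, lam l ^ 2) (x : L) (r : ℝ) :
    ∃ t, stretch i g C lam χ (x, t) = Real.cosh r - √(∑ l, lam l ^ 2) * Real.sinh r := by
  have h1 := norm_meanCoord_sq χ hi hP hn (g := g) x
  set μ := meanCoord i g C lam χ x
  set h := ∑ l, lam l ^ 2
  have hs : √h ^ 2 = h := Real.sq_sqrt h0.le
  have hs0 : 0 < √h := Real.sqrt_pos.2 h0
  have hμ : ‖μ‖ = √h := by rw [← h1, Real.sqrt_sq (norm_nonneg _)]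
  refine ⟨(r / √h) • μ, ?_⟩
  have h2 : ‖(r / √h) • μ‖ = |r| := by
    rw [norm_smul, hμ, Real.norm_eq_abs, abs_div, abs_of_pos hs0, div_mul_cancel₀ _ hs0.ne']
  rw [stretch_eq χ hi hP]
  simp only [h2, sq_abs, Real.cosh_abs]
  have h3 : inner ℝ ((r / √h) • μ) μ = r * √h := by
    rw [real_inner_smul_left, real_inner_self_eq_norm_sq, hμ]
    field_simp
  have h4 : inner ℝ ((r / √h) • μ) (meanCoord i g C lam χ x) = r * √h := h3
  rw [h4, ← mul_sinhcSqrt_sq r]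
  ring

theorem one_div_le_stretch (h1 : ∑ l, lam l ^ 2 ≤ 1) (z : L × EuclideanSpace ℝ (Fin ν)) :
    1 / (2 * Real.cosh ‖z.2‖) ≤ stretch i g C lam χ z := by
  refine le_trans ?_ (cosh_sub_le_stretch χ hi hP hn z)
  have h2 : √(∑ l, lam l ^ 2) ≤ 1 := Real.sqrt_le_one.2 h1
  have h3 := Real.sinh_nonneg_iff.2 (norm_nonneg z.2)
  -- Here `cosh - sinh = 1 / (cosh + sinh)` and `sinh < cosh`.
  have h4 : 1 / (2 * Real.cosh ‖z.2‖) ≤ Real.cosh ‖z.2‖ - Real.sinh ‖z.2‖ := by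
    rw [div_le_iff₀ (by positivity)]
    nlinarith [Real.cosh_sq ‖z.2‖, Real.sinh_lt_cosh ‖z.2‖]
  nlinarith

theorem stretch_pos (h1 : ∑ l, lam l ^ 2 ≤ 1) (z : L × EuclideanSpace ℝ (Fin ν)) :
    0 < stretch i g C lam χ z :=
  lt_of_lt_of_le (by positivity) (one_div_le_stretch χ hi hP hn h1 z)

theorem exists_stretch_eq_zero (h1 : 1 < ∑ l, lam l ^ 2) (x : L) :
    ∃ t, stretch i g C lam χ (x, t) = 0 := by
  set h := ∑ l, lam l ^ 2 with hh
  -- The radius with `sinh r = 1 / √(h - 1)` solves `cosh r = √h * sinh r`.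
  obtain ⟨t, ht⟩ := exists_stretch_eq χ hi hP hn (g := g) (by linarith) x
    (Real.arsinh (√(h - 1))⁻¹)
  refine ⟨t, ?_⟩
  rw [ht, Real.sinh_arsinh, Real.cosh_arsinh, ← hh]
  have hp : 0 < √(h - 1) := Real.sqrt_pos.2 (by linarith)
  have e : 1 + (√(h - 1))⁻¹ ^ 2 = h * ((√(h - 1))⁻¹) ^ 2 := by
    have := Real.sq_sqrt (by linarith : 0 ≤ h - 1)
    field_simp
    linarith
  rw [e, Real.sqrt_mul (by linarith), Real.sqrt_sq (by positivity), sub_self]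

include hg

theorem domain_eq_univ_iff [Nonempty L] : χ.domain g = Set.univ ↔ ∑ l, lam l ^ 2 ≤ 1 := by
  rw [Set.eq_univ_iff_forall]
  simp only [mem_domain_iff χ hi hg hP hn]
  refine ⟨fun h => ?_, fun h z => (stretch_pos χ hi hP hn h z).ne'⟩
  by_contra! h1
  obtain ⟨x⟩ := ‹Nonempty L›
  obtain ⟨t, ht⟩ := exists_stretch_eq_zero χ hi hP hn (g := g) h1 x
  exact h (x, t) ht

theorem isBounded_scalAt (h1 : ∑ l, lam l ^ 2 < 1) (x : L) : Bornology.IsBounded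
    (Set.range fun t => scalAt ((𝓡 2).prod (𝓡 ν)) (χ.cone g) (x, t)) := by
  obtain ⟨K, hK, -, hs⟩ := exists_scalAt_eq χ hi hg hP hn x
  have h2 : √(∑ l, lam l ^ 2) < 1 := by
    rw [Real.sqrt_lt' one_pos]; simpa using h1
  -- Lower bound for the stretching factor: `cosh - √h * sinh ≥ (1 - √h) * cosh ≥ 1 - √h`.
  set r := 1 - √(∑ l, lam l ^ 2) with hr
  have hr0 : 0 < r := by linarith
  have hge : ∀ t, r ≤ stretch i g C lam χ (x, t) := fun t => by
    refine le_trans ?_ (cosh_sub_le_stretch χ hi hP hn (x, t))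
    have h3 := Real.one_le_cosh ‖t‖
    have h4 := (Real.sinh_lt_cosh ‖t‖).le
    simp only
    nlinarith [Real.sqrt_nonneg (∑ l, lam l ^ 2)]
  refine (Metric.isBounded_Icc (-((2 + ν : ℝ) ^ 2 - (2 + ν)) - r⁻¹ ^ 2 * K)
    (-((2 + ν : ℝ) ^ 2 - (2 + ν)))).subset ?_
  rintro _ ⟨t, rfl⟩
  have hpos := hr0.trans_le (hge t)
  simp only [hs t hpos.ne']
  have h5 : (stretch i g C lam χ (x, t))⁻¹ ^ 2 ≤ r⁻¹ ^ 2 :=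
    pow_le_pow_left₀ (by positivity) (inv_anti₀ hr0 (hge t)) 2
  constructor
  · nlinarith
  · have : 0 ≤ (stretch i g C lam χ (x, t))⁻¹ ^ 2 * K := by positivity
    linarith

theorem not_isBounded_scalAt (h1 : ∑ l, lam l ^ 2 = 1) {x : L} (hx : ¬IsTotallyGeodesicAt k i g x) :
    ¬Bornology.IsBounded
      (Set.range fun t => scalAt ((𝓡 2).prod (𝓡 ν)) (χ.cone g) (x, t)) := by
  obtain ⟨K, -, hK, hs⟩ := exists_scalAt_eq χ hi hg hP hn x
  have hK0 := hK hx
  rintro hb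
  obtain ⟨M, hM⟩ := hb.bddBelow
  set A : ℝ := -((2 + ν : ℝ) ^ 2 - (2 + ν)) with hA
  -- In the direction of the mean curvature vector the factor is `exp (-r)`, so the curvature is `A
  -- - exp (2 * r) * K`. As `exp (2 * r) > r`, this value of `r` brings it below the supposed bound
  -- `M`.
  set r := |A - M| / K with hr
  have hr0 : 0 ≤ r := by positivity
  obtain ⟨t, ht⟩ := exists_stretch_eq χ hi hP hn (g := g) (by rw [h1]; norm_num) x r
  rw [h1, Real.sqrt_one, one_mul, Real.cosh_sub_sinh] at ht
  have h2 := hM ⟨t, rfl⟩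
  simp only [hs t (by rw [ht]; exact (Real.exp_pos _).ne'), ht] at h2
  have h3 : (Real.exp (-r))⁻¹ = Real.exp r := by rw [Real.exp_neg, inv_inv]
  rw [h3] at h2
  have h4 := Real.add_one_le_exp r
  have h5 : r * K = |A - M| := div_mul_cancel₀ _ hK0.ne'
  have h6 : r < Real.exp r ^ 2 := by nlinarith
  nlinarith [le_abs_self (A - M)]

end Stretch

/-! ### Position with respect to equidistant hypersurfaces and horospheres. -/

section Position

variable {n ν : ℕ} {k : ℕ} {N : Type*} [TopologicalSpace N]
  [ChartedSpace (EuclideanSpace ℝ (Fin k)) N] [IsManifold (𝓡 k) ∞ N]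
  {i : N → LorentzSpace n} {c : ℝ}
  {C : Fin ν → LorentzSpace n} {lam : Fin ν → ℝ}
  (hi : IsUmbilicalInclusion k i c) (hP : IsParallelFrame k i C lam)

/-- The mean curvature vector of `i` in terms of the parallel frame. -/
def meanVec (i : N → LorentzSpace n) (C : Fin ν → LorentzSpace n) (lam : Fin ν → ℝ) (q : N) :
    LorentzSpace n := ∑ j, lam j • (C j - lam j • i q)

omit [IsManifold (𝓡 k) ∞ N] [TopologicalSpace N] [ChartedSpace (EuclideanSpace ℝ (Fin k)) N] in
theorem meanVec_eq (q : N) :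
    ∑ j, lam j • C j = meanVec i C lam q + (∑ j, lam j ^ 2) • i q := by
  simp only [meanVec, smul_sub, Finset.sum_sub_distrib, smul_smul, Finset.sum_smul, sq]
  abel

include hP

theorem meanVec_mem (q : N) : meanVec i C lam q ∈ normalSpace k i q :=
  normalSpace_sum _ _ fun j => hP.normal j q

theorem lor_meanVec_self (q : N) :
    lor (meanVec i C lam q) (meanVec i C lam q) = ∑ j, lam j ^ 2 := by
  simp [meanVec, lor_sum_left, lor_sum_right, lor_smul_left, lor_smul_right, hP.orthonormal, sq]

include hi

theorem lor_sum_smul_base (q : N) : lor (∑ j, lam j • C j) (i q) = -∑ j, lam j ^ 2 := by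
  rw [meanVec_eq (i := i) q, lor_add_left, lor_smul_left, hi.lor_self, (meanVec_mem hP q).1]
  ring

theorem lor_sum_smul_self (q : N) : lor (∑ j, lam j • C j) (∑ j, lam j • C j) =
    ∑ j, lam j ^ 2 - (∑ j, lam j ^ 2) ^ 2 := by
  conv_lhs => enter [2]; rw [meanVec_eq (i := i) q]
  rw [lor_add_right, lor_smul_right, lor_sum_smul_base hi hP, meanVec_eq (i := i) q, lor_add_left,
    lor_smul_left, lor_comm (i q), (meanVec_mem hP q).1, lor_meanVec_self hP]
  ring

/-- By `meanVec_eq` a vector orthogonal to `i q` and to `∑ j, lam j • C j` is orthogonal to the mean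
curvature vector, of which all values of the second fundamental form are multiples. -/
theorem isTotallyGeodesicIn_smul {s : ℝ} (hs : s ≠ 0) :
    IsTotallyGeodesicIn (𝓡 k) i (s • ∑ j, lam j • C j) (-(s * ∑ j, lam j ^ 2)) := by
  refine fun q => ⟨⟨hi.mem q, ?_⟩, fun X Y ξ h1 h2 => ?_⟩
  · rw [lor_comm, lor_smul_left, lor_sum_smul_base hi hP]; ring
  · rw [lor_smul_right] at h2
    have h3 := (mul_eq_zero.1 h2).resolve_left hs
    rw [meanVec_eq (i := i) q, lor_add_right, lor_smul_right, h1, mul_zero, add_zero] at h3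
    rw [hP.umbilical q X Y, lor_smul_left, lor_comm]
    exact mul_eq_zero_of_right _ h3

/-- By `lor_sum_smul_self` the constant vector is spacelike for squared length of the mean curvature
between 0 and 1, and it only has to be normalized. -/
theorem exists_equidistant [Nonempty N] (h0 : 0 < ∑ j, lam j ^ 2) (h1 : ∑ j, lam j ^ 2 < 1) :
    ∃ a τ, IsEquidistantData a τ ∧ IsTotallyGeodesicIn (𝓡 k) i a τ := by
  obtain ⟨q⟩ := ‹Nonempty N›
  have hp : 0 < ∑ j, lam j ^ 2 - (∑ j, lam j ^ 2) ^ 2 := by nlinarith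
  have hs := Real.sqrt_pos.2 hp
  refine ⟨_, _, ⟨?_, ?_⟩, isTotallyGeodesicIn_smul hi hP (inv_ne_zero hs.ne')⟩
  · rw [lor_smul_left, lor_smul_right, lor_sum_smul_self hi hP q]
    rw [← mul_assoc, ← sq, inv_pow, Real.sq_sqrt hp.le, inv_mul_cancel₀ hp.ne']
  · exact neg_ne_zero.2 (mul_ne_zero (inv_ne_zero hs.ne') h0.ne')

theorem exists_horosphere [Nonempty N] (h1 : ∑ j, lam j ^ 2 = 1) :
    ∃ a τ, IsHorosphereData a τ ∧ IsTotallyGeodesicIn (𝓡 k) i a τ := by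
  obtain ⟨q⟩ := ‹Nonempty N›
  have h2 := lor_sum_smul_self hi hP q
  have h3 := lor_sum_smul_base hi hP q
  rw [h1] at h2 h3
  refine ⟨_, _, ⟨?_, ?_, ?_⟩, isTotallyGeodesicIn_smul hi hP one_ne_zero⟩
  · rw [one_smul, h2]; norm_num
  · rw [one_smul]
    exact fst_pos_of_lor_neg (hi.mem q).1 (hi.mem q).2 (by rw [h2]; norm_num) (by rw [h3]; norm_num)
  · rw [h1]; norm_num

/-- Let `b = a + τ • i q` be the projection of `a` to the tangent space of hyperbolic space. Total
geodesy forces the mean curvature vector `η` to be a multiple of `b`, and the position in the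
hyperplane section forces `lor η a = -τ`. Since `lor b b = lor a a + τ ^ 2`, the length of `η` is
determined. -/
theorem sum_sq_mul_eq [Nonempty N] (hk : 1 ≤ k) {a : LorentzSpace n} {τ : ℝ}
    (ha : 0 < lor a a + τ ^ 2) (h : IsTotallyGeodesicIn (𝓡 k) i a τ) :
    (∑ j, lam j ^ 2) * (lor a a + τ ^ 2) = τ ^ 2 := by
  obtain ⟨q⟩ := ‹Nonempty N›
  set f := rep (𝓡 k) i q with hf
  set y := extChartAt (𝓡 k) q q with hy
  have hfy : f y = i q := by rw [hf, rep, Function.comp_apply, extChartAt_to_inv]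
  have hh : ∀ z, lor (f z) (f z) = -1 := fun z => hi.lor_self _
  have hfs : ContDiffAt ℝ 2 f y := (contDiffAt_rep hi.smooth q (mem_extChartAt_target q)).of_le two_le_infty
  have hd : DifferentiableAt ℝ f y := hfs.differentiableAt (by simp : (2 : WithTop ℕ∞) ≠ 0)
  have hinj : Function.Injective (fderiv ℝ f y) := hi.injective q
  set X : EuclideanSpace ℝ (Fin k) := EuclideanSpace.single ⟨0, hk⟩ 1 with hX
  have hX0 : X ≠ 0 := fun h => by
    have := congrArg (fun v : EuclideanSpace ℝ (Fin k) => v ⟨0, hk⟩) h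
    simp [hX] at this
  set G := lor (fderiv ℝ f y X) (fderiv ℝ f y X) with hG
  have hG0 : 0 < G := lor_fderiv_pos hh hd hinj hX0
  set η := meanVec i C lam q with hη
  have hα : sff (Module.finBasis ℝ (EuclideanSpace ℝ (Fin k))) f y X X = G • η := by
    rw [hG, ← hi.metricAt_eq q X X]
    exact hP.umbilical q X X
  have hfa : ∀ z, lor (f z) a = τ := fun z => ((h ((extChartAt (𝓡 k) q).symm z)).1).2
  have hDa : ∀ z, DifferentiableAt ℝ f z → ∀ Z, lor (fderiv ℝ f z Z) a = 0 := fun z hz Z => by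
    have h1 := fderiv_lor hz (differentiableAt_const a) Z
    simp only [hfa] at h1
    simpa [lor_zero_right] using h1.symm
  have hD2a : lor (D2 f y X X) a = 0 := by
    have hev : (fun z => lor (fderiv ℝ f z X) a) =ᶠ[𝓝 y] fun _ => 0 := by
      filter_upwards [hfs.eventually (by simp)] with z hz
      exact hDa z (hz.differentiableAt (by simp)) X
    have hd2 : DifferentiableAt ℝ (fderiv ℝ f) y :=
      (contDiffAt_fderiv hfs (m := 1) (by norm_num)).differentiableAt (by simp)
    have h1 := fderiv_lor (hd2.clm_apply (differentiableAt_const X)) (differentiableAt_const a) X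
    rw [hev.fderiv_eq] at h1
    have h2 : fderiv ℝ (fun z => fderiv ℝ f z X) y X = D2 f y X X := by
      rw [fderiv_clm_apply hd2 (differentiableAt_const X)]
      simp [D2]
    rw [h2] at h1
    simpa [lor_zero_right] using h1.symm
  have hηi : lor η (i q) = 0 := (meanVec_mem hP q).1
  -- The second derivative of `f` is orthogonal to `a`, and its component along `f` has the
  -- coefficient `G`, as pairing with `f` shows.
  have hηa : lor η a = -τ := by
    obtain ⟨r, Z, hZ⟩ := (isNormalPart_sff (Module.finBasis ℝ _) hh hinj hfs X X).decomp
    rw [hα] at hZ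
    have h1 := congrArg (fun v => lor v (f y)) hZ
    simp only [lor_D2_self hh hfs, lor_add_left, lor_smul_left, hh, lor_fderiv_self hh hd] at h1
    rw [hfy, hηi] at h1
    have h2 := congrArg (fun v => lor v a) hZ
    simp only [hD2a, lor_add_left, lor_smul_left, hDa y hd, hfa] at h2
    have h3 : r = G := by linarith
    rw [h3] at h2
    have h4 : G * (lor η a + τ) = 0 := by linarith
    linarith [(mul_eq_zero.1 h4).resolve_left hG0.ne']
  have hia : lor (i q) a = τ := (h q).1.2
  set b := a + τ • i q with hb
  have hbi : lor b (i q) = 0 := by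
    rw [hb, lor_add_left, lor_smul_left, hi.lor_self, lor_comm, hia]; ring
  have hba : lor b a = lor a a + τ ^ 2 := by
    rw [hb, lor_add_left, lor_smul_left, hia]; ring
  -- The component of `η` orthogonal to `b` is an admissible test vector: it is orthogonal to both
  -- `i q` and `a`.
  set ξ := η - (lor η a / (lor a a + τ ^ 2)) • b with hξ
  have h1 : lor ξ (i q) = 0 := by rw [hξ, lor_sub_left, lor_smul_left, hbi, hηi]; ring
  have h2 : lor ξ a = 0 := by
    rw [hξ, lor_sub_left, lor_smul_left, hba, div_mul_cancel₀ _ ha.ne', sub_self]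
  have h3 : lor (sff (Module.finBasis ℝ (EuclideanSpace ℝ (Fin k))) f y X X) ξ = 0 :=
    (h q).2 X X ξ h1 h2
  rw [hα, lor_smul_left] at h3
  have h4 := (mul_eq_zero.1 h3).resolve_left hG0.ne'
  have h5 : lor η b = -τ := by rw [hb, lor_add_right, lor_smul_right, hηi, hηa]; ring
  rw [hξ, lor_sub_right, lor_smul_right, h5, hηa, lor_meanVec_self hP] at h4
  field_simp at h4
  linarith

end Position

/-! ### Completeness -/

theorem ofReal_sub_le_lintegral {f f' φ : ℝ → ℝ} {s₁ : ℝ} (hs : s₁ ∈ Set.Icc (0 : ℝ) 1)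
    (hf : ∀ s ∈ Set.Icc (0 : ℝ) 1, HasDerivWithinAt f (f' s) (Set.Icc 0 1) s)
    (hφ : ContinuousOn φ (Set.Icc 0 1)) (hφ0 : ∀ s ∈ Set.Icc (0 : ℝ) 1, 0 ≤ φ s)
    (hle : ∀ s ∈ Set.Icc (0 : ℝ) 1, f' s ≤ φ s) :
    ENNReal.ofReal (f s₁ - f 0) ≤ ∫⁻ s in Set.Icc (0 : ℝ) 1, ENNReal.ofReal (φ s) := by
  have hsub : Set.Icc 0 s₁ ⊆ Set.Icc (0 : ℝ) 1 := Set.Icc_subset_Icc_right hs.2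
  have hint : MeasureTheory.IntegrableOn φ (Set.Icc 0 s₁) :=
    (hφ.mono hsub).integrableOn_compact isCompact_Icc
  have h1 : f s₁ - f 0 ≤ ∫ s in (0 : ℝ)..s₁, φ s := by
    refine intervalIntegral.sub_le_integral_of_hasDeriv_right_of_le (g' := f') hs.1
      (fun s h => ((hf s (hsub h)).continuousWithinAt).mono hsub) (fun s h => ?_) hint
      fun s h => hle s (hsub (Set.Ioo_subset_Icc_self h))
    have h2 : s ∈ Set.Ioo (0 : ℝ) 1 := ⟨h.1, h.2.trans_le hs.2⟩
    exact ((hf s (Set.Ioo_subset_Icc_self h2)).hasDerivAt (Icc_mem_nhds h2.1 h2.2)).hasDerivWithinAt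
  refine (ENNReal.ofReal_le_ofReal h1).trans ?_
  rw [intervalIntegral.integral_of_le hs.1, ← MeasureTheory.integral_Icc_eq_integral_Ioc,
    MeasureTheory.ofReal_integral_eq_lintegral_ofReal hint
      ((MeasureTheory.ae_restrict_iff' measurableSet_Icc).2
        (Filter.Eventually.of_forall fun s h => hφ0 s (hsub h)))]
  exact MeasureTheory.lintegral_mono_set hsub

/-! ### Length estimates for curves in a cone. -/

section Curves

variable {n ν : ℕ} {C : Fin ν → LorentzSpace n} {lam : Fin ν → ℝ}

/-- Differentiating `hcP` gives the orthogonal decomposition `c' = ρ P' - α' P + ∑ β'_l e_l`, so the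
squared speed is `ρ² |P'|² - α'² + ∑ β'_l²`. From `α² = 1 + ∑ β_l²` the last two terms together are
at least `∑ β'_l² / α²`, as for the metric of a hyperbolic fiber. -/
theorem curve_estimates {c P : ℝ → LorentzSpace n} {c' P' : LorentzSpace n} {T : Set ℝ} {s : ℝ}
    (hT : UniqueDiffWithinAt ℝ T s)
    (hc : HasDerivWithinAt c c' T s) (hP : HasDerivWithinAt P P' T s)
    (hPP : ∀ r, lor (P r) (P r) = -1) (hCP : ∀ l r, lor (C l) (P r) = -lam l)
    (hCC : ∀ l m, lor (C l) (C m) = (if l = m then 1 else 0) - lam l * lam m)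
    (hcP : ∀ r, c r = (-lor (c r) (P r) - ∑ l, lam l * lor (c r) (C l - lam l • P r)) • P r +
      ∑ l, lor (c r) (C l - lam l • P r) • C l)
    (hsq : ∀ r, lor (c r) (P r) ^ 2 = 1 + ∑ l, lor (c r) (C l - lam l • P r) ^ 2)
    (hpos : lor (c s) (P s) < 0) :
    (-lor (c s) (P s) - ∑ l, lam l * lor (c s) (C l - lam l • P s)) * lnorm P' ≤ lnorm c' ∧
      (∀ l, |lor c' (C l - lam l • P s) + lor (c s) (-(lam l • P'))| ≤
        -lor (c s) (P s) * lnorm c') ∧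
      -(lor c' (P s) + lor (c s) P') ≤ -lor (c s) (P s) * lnorm c' := by
  have hα := hc.lor hP
  have hβ : ∀ l, HasDerivWithinAt (fun r => lor (c r) (C l - lam l • P r))
      (lor c' (C l - lam l • P s) + lor (c s) (-(lam l • P'))) T s := fun l => by
    refine hc.lor ?_
    have := (hasDerivWithinAt_const s T (C l)).fun_sub (hP.fun_const_smul (lam l))
    simpa using this
  set α' := lor c' (P s) + lor (c s) P' with hα'
  set β : Fin ν → ℝ → ℝ := fun l r => lor (c r) (C l - lam l • P r) with hβd
  set β' : Fin ν → ℝ := fun l => lor c' (C l - lam l • P s) + lor (c s) (-(lam l • P')) with hβ'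
  set e : Fin ν → LorentzSpace n := fun l => C l - lam l • P s with he
  set ρ := -lor (c s) (P s) - ∑ l, lam l * β l s with hρ
  have hPP' : lor P' (P s) = 0 := by
    have h1 := hP.lor hP
    simp only [hPP] at h1
    have := hT.eq_deriv _ h1 (hasDerivWithinAt_const s T (-1))
    rw [lor_comm (P s)] at this
    linarith
  have hCP' : ∀ l, lor (C l) P' = 0 := fun l => by
    have h1 := (hasDerivWithinAt_const s T (C l)).lor hP
    simp only [hCP] at h1
    have := hT.eq_deriv _ h1 (hasDerivWithinAt_const s T (-lam l))
    rwa [lor_zero_left, zero_add] at this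
  have heP : ∀ l, lor (e l) (P s) = 0 := fun l => by
    rw [he, lor_sub_left, lor_smul_left, hCP, hPP]; ring
  have heP' : ∀ l, lor (e l) P' = 0 := fun l => by
    rw [he, lor_sub_left, lor_smul_left, hCP', lor_comm, hPP']; ring
  have hee : ∀ l m, lor (e l) (e m) = if l = m then 1 else 0 := fun l m => by
    simp only [he, lor_sub_left, lor_sub_right, lor_smul_left, lor_smul_right, hCC, hCP, hPP,
      lor_comm (P s) (C m)]
    ring
  have hc' : c' = ρ • P' + (-α') • P s + ∑ l, β' l • e l := by
    have h1 := ((hα.fun_neg.fun_sub (HasDerivWithinAt.fun_sum (u := Finset.univ) fun l _ =>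
      (hβ l).const_mul (lam l))).fun_smul hP).fun_add (HasDerivWithinAt.fun_sum
        (u := Finset.univ) fun l _ => (hβ l).smul_const (C l))
    have h2 : c' = ρ • P' + (-α' - ∑ l, lam l * β' l) • P s + ∑ l, β' l • C l :=
      hT.eq_deriv _ hc (h1.congr (fun r _ => hcP r) (hcP s))
    rw [h2]
    simp only [he, smul_sub, Finset.sum_sub_distrib, sub_smul, Finset.sum_smul, smul_smul,
      mul_comm (lam _), neg_smul]
    abel
  have hsq' : lor (c s) (P s) * α' = ∑ l, β l s * β' l := by
    have h1 := hα.pow 2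
    have h2 := (HasDerivWithinAt.fun_sum (u := Finset.univ) fun l _ => (hβ l).pow 2).const_add 1
    have h3 := hT.eq_deriv _ h1 (h2.congr (fun r _ => hsq r) (hsq s))
    simp only [Nat.cast_ofNat, Nat.add_one_sub_one, pow_one, mul_assoc, ← Finset.mul_sum] at h3
    linarith
  set G := lor P' P' with hG
  have hG0 : 0 ≤ G := lor_self_nonneg (hPP s) hPP'
  set Q := ∑ l, β' l ^ 2 with hQ
  have hS : lor c' c' = ρ ^ 2 * G - α' ^ 2 + Q := by
    rw [hc']
    simp only [lor_add_left, lor_add_right, lor_smul_left, lor_smul_right, lor_sum_left,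
      lor_sum_right, hPP', heP, heP', hPP, hee, lor_comm (P s) P', lor_comm (P s) (e _),
      lor_comm P' (e _)]
    simp only [mul_zero, zero_add, add_zero, Finset.sum_const_zero, mul_ite, mul_one,
      Finset.sum_ite_eq', Finset.mem_univ, if_true, hQ, sq, ← hG]
    ring
  set a := lor (c s) (P s) with ha
  -- Cauchy–Schwarz applied to the derivative `a * α' = ∑ β_l β'_l` of the relation `hsq`.
  have hCS : (a * α') ^ 2 ≤ (a ^ 2 - 1) * Q := by
    have h1 := Finset.sum_mul_sq_le_sq_mul_sq Finset.univ (fun l => β l s) β'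
    have h2 := hsq s
    rw [hsq', ← ha] at *
    have h3 : ∑ l, β l s ^ 2 = a ^ 2 - 1 := by linarith
    rw [← h3]; exact h1
  have hQ0 : 0 ≤ Q := Finset.sum_nonneg fun l _ => sq_nonneg _
  have ha1 : 1 ≤ a ^ 2 := by
    rw [hsq s]
    linarith [Finset.sum_nonneg fun l (_ : l ∈ Finset.univ) => sq_nonneg (lor (c s) (C l - lam l • P s))]
  have hαQ : α' ^ 2 ≤ Q := by nlinarith
  have hQS : Q ≤ a ^ 2 * lor c' c' := by
    rw [hS]; nlinarith [mul_nonneg (sq_nonneg a) (mul_nonneg (sq_nonneg ρ) hG0)]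
  have hSS : ρ ^ 2 * G ≤ lor c' c' := by rw [hS]; linarith
  have hS0 : 0 ≤ lor c' c' := (mul_nonneg (sq_nonneg ρ) hG0).trans hSS
  have hl : lnorm c' ^ 2 = lor c' c' := Real.sq_sqrt hS0
  have hl0 : 0 ≤ lnorm c' := Real.sqrt_nonneg _
  have hQS' : Q ≤ (-a * lnorm c') ^ 2 := by rw [mul_pow, hl, neg_sq]; exact hQS
  have hal : 0 ≤ -a * lnorm c' := mul_nonneg (by linarith) hl0
  refine ⟨?_, fun l => ?_, ?_⟩
  · refine abs_le_of_sq_le_sq' ?_ hl0 |>.2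
    rw [mul_pow, hl, lnorm, Real.sq_sqrt hG0]
    exact hSS
  · refine abs_le_of_sq_le_sq (le_trans ?_ hQS') hal
    exact Finset.single_le_sum (f := fun l => β' l ^ 2) (fun l _ => sq_nonneg _) (Finset.mem_univ l)
  · refine abs_le_of_sq_le_sq' ?_ hal |>.2
    rw [neg_sq]; exact hαQ.trans hQS'

end Curves

theorem ofReal_abs_le {x : ℝ} {M : ℝ≥0∞} (h1 : ENNReal.ofReal x ≤ M)
    (h2 : ENNReal.ofReal (-x) ≤ M) : ENNReal.ofReal |x| ≤ M := by
  rcases abs_choice x with h | h <;> rwa [h]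

theorem continuous_lnorm {n : ℕ} : Continuous (lnorm : LorentzSpace n → ℝ) :=
  Real.continuous_sqrt.comp (continuous_lor.comp (continuous_id.prodMk continuous_id))

/-- Bounds along a curve in a cone of length at most one. -/
theorem length_bounds {n ν : ℕ} {C : Fin ν → LorentzSpace n} {lam : Fin ν → ℝ}
    {c P : ℝ → LorentzSpace n} (hFs : ContDiffOn ℝ 1 c (Set.Icc 0 1))
    (hPs : ContDiffOn ℝ 1 P (Set.Icc 0 1))
    (hPP : ∀ r, lor (P r) (P r) = -1) (hCP : ∀ l r, lor (C l) (P r) = -lam l)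
    (hCC : ∀ l m, lor (C l) (C m) = (if l = m then 1 else 0) - lam l * lam m)
    (hcP : ∀ r, c r = (-lor (c r) (P r) - ∑ l, lam l * lor (c r) (C l - lam l • P r)) • P r +
      ∑ l, lor (c r) (C l - lam l • P r) • C l)
    (hsq : ∀ r, lor (c r) (P r) ^ 2 = 1 + ∑ l, lor (c r) (C l - lam l • P r) ^ 2)
    (hpos : ∀ r, lor (c r) (P r) < 0)
    (hρ : ∀ r, 1 / (2 * -lor (c r) (P r)) ≤
      -lor (c r) (P r) - ∑ l, lam l * lor (c r) (C l - lam l • P r))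
    (hlen : ∫⁻ s in Set.Icc (0 : ℝ) 1, ENNReal.ofReal (lnorm (derivWithin c (Set.Icc 0 1) s)) ≤ 1) :
    -lor (c 1) (P 1) ≤ 3 * -lor (c 0) (P 0) ∧
    ∫⁻ s in Set.Icc (0 : ℝ) 1, ENNReal.ofReal (lnorm (derivWithin P (Set.Icc 0 1) s)) ≤
      ENNReal.ofReal (6 * -lor (c 0) (P 0)) *
        ∫⁻ s in Set.Icc (0 : ℝ) 1, ENNReal.ofReal (lnorm (derivWithin c (Set.Icc 0 1) s)) ∧
    ∀ l, ENNReal.ofReal |lor (c 1) (C l - lam l • P 1) - lor (c 0) (C l - lam l • P 0)| ≤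
      ENNReal.ofReal (3 * -lor (c 0) (P 0)) *
        ∫⁻ s in Set.Icc (0 : ℝ) 1, ENNReal.ofReal (lnorm (derivWithin c (Set.Icc 0 1) s)) := by
  set T := Set.Icc (0 : ℝ) 1 with hT
  have hTu : UniqueDiffOn ℝ T := uniqueDiffOn_Icc zero_lt_one
  have hFd : ∀ s ∈ T, HasDerivWithinAt c (derivWithin c T s) T s := fun s hs =>
    ((hFs.differentiableOn one_ne_zero) s hs).hasDerivWithinAt
  have hPd : ∀ s ∈ T, HasDerivWithinAt P (derivWithin P T s) T s := fun s hs =>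
    ((hPs.differentiableOn one_ne_zero) s hs).hasDerivWithinAt
  have est := fun s (hs : s ∈ T) => curve_estimates (C := C) (lam := lam) (hTu s hs) (hFd s hs)
    (hPd s hs) hPP hCP hCC hcP hsq (hpos s)
  set S : ℝ → ℝ := fun s => lnorm (derivWithin c T s) with hS
  have hS0 : ∀ s, 0 ≤ S s := fun s => Real.sqrt_nonneg _
  have hdc : ContinuousOn (derivWithin c T) T := hFs.continuousOn_derivWithin hTu le_rfl
  have hSc : ContinuousOn S T :=
    continuous_lnorm.comp_continuousOn hdc
  set a : ℝ → ℝ := fun s => -lor (c s) (P s) with ha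
  have ha0 : ∀ s, 0 < a s := fun s => neg_pos.2 (hpos s)
  have h01 : (0 : ℝ) ∈ T := ⟨le_rfl, zero_le_one⟩
  have h11 : (1 : ℝ) ∈ T := ⟨zero_le_one, le_rfl⟩
  -- The logarithmic derivative of `a` is at most the speed, so over length at most one `a` grows by
  -- a factor at most `e < 3`.
  have key : ∀ s ∈ T, a s ≤ 3 * a 0 := fun s hs => by
    have hl := ofReal_sub_le_lintegral (f := fun s => Real.log (a s)) hs
      (fun s hs => (((hFd s hs).lor (hPd s hs)).neg).log (ha0 s).ne') hSc (fun s _ => hS0 s)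
      (fun s hs => by
        have := (est s hs).2.2
        simp only [Pi.neg_apply]
        rw [div_le_iff₀ (neg_pos.2 (hpos s)), mul_comm]
        exact this)
    have h2 : ENNReal.ofReal (Real.log (a s) - Real.log (a 0)) ≤ 1 := hl.trans hlen
    rw [ENNReal.ofReal_le_one] at h2
    have h3 : a s ≤ Real.exp 1 * a 0 := by
      rw [← Real.exp_log (ha0 s), ← Real.exp_log (ha0 0), ← Real.exp_add]
      exact Real.exp_le_exp.2 (by linarith)
    have h4 := Real.exp_one_lt_d9
    nlinarith [ha0 0]
  refine ⟨key 1 h11, ?_, fun l => ?_⟩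
  · rw [← MeasureTheory.lintegral_const_mul' _ _ ENNReal.ofReal_ne_top]
    refine MeasureTheory.setLIntegral_mono' measurableSet_Icc fun s hs => ?_
    rw [← ENNReal.ofReal_mul (mul_nonneg (by norm_num) (ha0 0).le)]
    refine ENNReal.ofReal_le_ofReal ?_
    have h2 := (est s hs).1
    -- By `key` the lower bound `1 / (2 * a s)` of the stretching factor is at least `1 / (6 * a
    -- 0)`, uniformly along the curve.
    have h4 : 1 / (6 * a 0) ≤ 1 / (2 * a s) :=
      one_div_le_one_div_of_le (by linarith [ha0 s]) (by linarith [key s hs])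
    have h5 : 0 ≤ lnorm (derivWithin P T s) := Real.sqrt_nonneg _
    have h6 : 1 / (6 * a 0) * lnorm (derivWithin P T s) ≤ S s :=
      (mul_le_mul_of_nonneg_right (h4.trans (hρ s)) h5).trans h2
    rw [one_div, inv_mul_le_iff₀ (by linarith [ha0 0])] at h6
    exact h6
  · have hBd : ∀ s ∈ T, HasDerivWithinAt (fun s => lor (c s) (C l - lam l • P s))
        (lor (derivWithin c T s) (C l - lam l • P s) +
          lor (c s) (-(lam l • derivWithin P T s))) T s := fun s hs => by
      refine (hFd s hs).lor ?_
      have := (hasDerivWithinAt_const s T (C l)).fun_sub ((hPd s hs).fun_const_smul (lam l))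
      simpa using this
    have hb : ∀ s ∈ T, |lor (derivWithin c T s) (C l - lam l • P s) +
        lor (c s) (-(lam l • derivWithin P T s))| ≤ 3 * a 0 * S s := fun s hs =>
      ((est s hs).2.1 l).trans (mul_le_mul_of_nonneg_right (key s hs) (hS0 s))
    have hn0 : 0 ≤ 3 * a 0 := by linarith [ha0 0]
    have e : ∫⁻ s in T, ENNReal.ofReal (3 * a 0 * S s) =
        ENNReal.ofReal (3 * a 0) * ∫⁻ s in T, ENNReal.ofReal (S s) := by
      rw [← MeasureTheory.lintegral_const_mul' _ _ ENNReal.ofReal_ne_top]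
      exact MeasureTheory.lintegral_congr fun s => ENNReal.ofReal_mul hn0
    have h0 : ∀ s ∈ T, 0 ≤ 3 * a 0 * S s := fun s _ => mul_nonneg hn0 (hS0 s)
    have hcont : ContinuousOn (fun s => 3 * a 0 * S s) T := continuousOn_const.mul hSc
    refine ofReal_abs_le (le_trans ?_ e.le) (le_trans ?_ e.le)
    · exact ofReal_sub_le_lintegral h11 hBd hcont h0 fun s hs => (le_abs_self _).trans (hb s hs)
    · have := ofReal_sub_le_lintegral h11 (fun s hs => (hBd s hs).fun_neg) hcont
        h0 fun s hs => (neg_le_abs _).trans (hb s hs)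
      refine le_trans (ENNReal.ofReal_le_ofReal (le_of_eq ?_)) this
      ring

/-! ### Completeness of the cone and of the surface. -/

section ConeCompleteness

variable {n ν : ℕ} {k : ℕ} {N : Type*} [TopologicalSpace N]
  [ChartedSpace (EuclideanSpace ℝ (Fin k)) N] [IsManifold (𝓡 k) ∞ N]
  {L : Type*} [TopologicalSpace L] [ChartedSpace (EuclideanSpace ℝ (Fin 2)) L]
  [IsManifold (𝓡 2) ∞ L]
  {i : N → LorentzSpace n} {c : ℝ} {g : L → N}
  {C : Fin ν → LorentzSpace n} {lam : Fin ν → ℝ} (χ : NormalFrame k i ν)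
  (hi : IsUmbilicalInclusion k i c) (hg : IsMinimalSurface k i g)
  (hP : IsParallelFrame k i C lam) (hn : ν + k = n)

theorem exists_pos_mul_lt (M : ℝ) {ε : ℝ≥0∞} (hε : 0 < ε) :
    ∃ r : ℝ≥0∞, 0 < r ∧ r ≤ 1 ∧ ENNReal.ofReal M * r < ε := by
  have h1 : 0 < min ε 1 := lt_min hε one_pos
  have h2 : min ε 1 ≠ ⊤ := (lt_of_le_of_lt (min_le_right _ _) ENNReal.one_lt_top).ne
  refine ⟨min 1 (min ε 1 / 2 / ENNReal.ofReal M), lt_min one_pos ?_, min_le_left _ _, ?_⟩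
  · exact ENNReal.div_pos (ENNReal.div_pos h1.ne' (by norm_num)).ne' ENNReal.ofReal_ne_top
  · calc ENNReal.ofReal M * min 1 (min ε 1 / 2 / ENNReal.ofReal M)
        ≤ ENNReal.ofReal M * (min ε 1 / 2 / ENNReal.ofReal M) := mul_le_mul' le_rfl (min_le_right _ _)
      _ ≤ min ε 1 / 2 := ENNReal.mul_div_le
      _ < min ε 1 := ENNReal.half_lt_self h1.ne' h2
      _ ≤ ε := min_le_left _ _

/-- As `‖sinhcSqrt (‖t‖ ^ 2) • t‖ = sinh ‖t‖`, the length of `t` is recovered by `arsinh`. This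
explicit continuous inverse turns convergence of the components of the cone into convergence in the
fiber. -/
theorem inv_sinhc_smul (t : EuclideanSpace ℝ (Fin ν)) :
    (sinhcSqrt (Real.arsinh ‖sinhcSqrt (‖t‖ ^ 2) • t‖ ^ 2))⁻¹ • (sinhcSqrt (‖t‖ ^ 2) • t) = t := by
  have hS := sinhcSqrt_pos (sq_nonneg ‖t‖)
  have h1 : ‖sinhcSqrt (‖t‖ ^ 2) • t‖ = Real.sinh ‖t‖ := by
    rw [norm_smul, Real.norm_eq_abs, abs_of_pos hS, mul_comm, mul_sinhcSqrt_sq]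
  rw [h1, Real.arsinh_sinh, smul_smul, inv_mul_cancel₀ hS.ne', one_smul]

include hi hg hP hn

theorem curve_bounds (h1 : ∑ l, lam l ^ 2 ≤ 1) {γ : ℝ → L × EuclideanSpace ℝ (Fin ν)}
    (hγ : ContMDiffOn 𝓘(ℝ, ℝ) ((𝓡 2).prod (𝓡 ν)) 1 γ (Set.Icc 0 1))
    (hlen : curveLength (χ.cone g) γ ≤ 1) :
    Real.cosh ‖(γ 1).2‖ ≤ 3 * Real.cosh ‖(γ 0).2‖ ∧
    curveLength (i ∘ g) (fun s => (γ s).1) ≤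
      ENNReal.ofReal (6 * Real.cosh ‖(γ 0).2‖) * curveLength (χ.cone g) γ ∧
    ∀ l, ENNReal.ofReal |coeffB i g C lam χ l (γ 1) - coeffB i g C lam χ l (γ 0)| ≤
      ENNReal.ofReal (3 * Real.cosh ‖(γ 0).2‖) * curveLength (χ.cone g) γ := by
  have hFs : ContDiffOn ℝ 1 (χ.cone g ∘ γ) (Set.Icc 0 1) := contMDiffOn_iff_contDiffOn.1
    (((contMDiff_cone χ hi hg).of_le (by simp)).comp_contMDiffOn hγ)
  have hPs : ContDiffOn ℝ 1 ((i ∘ g) ∘ fun s => (γ s).1) (Set.Icc 0 1) :=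
    contMDiffOn_iff_contDiffOn.1 (((contMDiff_base hg hi).of_le (by simp)).comp_contMDiffOn
      (contMDiff_fst.comp_contMDiffOn hγ))
  have hA : ∀ s, lor ((χ.cone g ∘ γ) s) (((i ∘ g) ∘ fun s => (γ s).1) s) =
      -Real.cosh ‖(γ s).2‖ := fun s => lor_cone_base χ hi (γ s)
  have hCP : ∀ l s, lor (C l) (((i ∘ g) ∘ fun s => (γ s).1) s) = -lam l := fun l s => by
    have := (hP.normal l (g (γ s).1)).1
    rw [lor_sub_left, lor_smul_left, hi.lor_self] at this
    have e : lor (C l) (((i ∘ g) ∘ fun s => (γ s).1) s) = lor (C l) (i (g (γ s).1)) := rfl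
    linarith
  have hB := length_bounds hFs hPs (fun r => hi.lor_self (g (γ r).1)) hCP
    (isConeData χ hi hg hP hn (γ 0)).lor_const
    (fun r => cone_eq_coneOf χ hi hP hn (γ r))
    (fun r => by
      have h2 := sum_coeffB_sq χ hi hP hn (g := g) (γ r)
      have h3 := Real.cosh_sq ‖(γ r).2‖
      rw [hA, neg_sq, h3, ← h2, add_comm]
      rfl)
    (fun r => by rw [hA]; linarith [Real.cosh_pos ‖(γ r).2‖])
    (fun r => by
      rw [hA, neg_neg]
      refine (one_div_le_stretch χ hi hP hn (g := g) h1 (γ r)).trans (le_of_eq ?_)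
      rw [stretch, lor_cone_base χ hi]
      rw [neg_neg]
      rfl) hlen
  rw [hA, hA, neg_neg, neg_neg] at hB
  exact hB

theorem edist_bounds (h1 : ∑ l, lam l ^ 2 ≤ 1) {z w : L × EuclideanSpace ℝ (Fin ν)} {r : ℝ≥0∞}
    (hr : r ≤ 1) (h : inducedEDist ((𝓡 2).prod (𝓡 ν)) (χ.cone g) z w < r) :
    Real.cosh ‖w.2‖ ≤ 3 * Real.cosh ‖z.2‖ ∧
    inducedEDist (𝓡 2) (i ∘ g) z.1 w.1 ≤ ENNReal.ofReal (6 * Real.cosh ‖z.2‖) * r ∧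
    ∀ l, ENNReal.ofReal |coeffB i g C lam χ l w - coeffB i g C lam χ l z| ≤
      ENNReal.ofReal (6 * Real.cosh ‖z.2‖) * r := by
  simp only [inducedEDist, iInf_lt_iff] at h
  obtain ⟨γ, ⟨rfl, rfl, hγ⟩, hlen⟩ := h
  obtain ⟨h2, h3, h4⟩ := curve_bounds χ hi hg hP hn h1 hγ (hlen.le.trans hr)
  refine ⟨h2, ?_, fun l => (h4 l).trans (mul_le_mul' (ENNReal.ofReal_le_ofReal ?_) hlen.le)⟩
  · refine le_trans ?_ (h3.trans (mul_le_mul' le_rfl hlen.le))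
    exact iInf₂_le (fun s => (γ s).1) ⟨rfl, rfl, contMDiff_fst.comp_contMDiffOn hγ⟩
  · linarith [Real.cosh_pos ‖(γ 0).2‖]

omit hP hn in
-- On the zero section the cone is `i ∘ g`, so curves of `L` keep their length there and a Cauchy
-- sequence of `L` is Cauchy in the cone. Its limit is projected back to `L`.
theorem isCompleteInduced_base
    (h : IsCompleteInduced ((𝓡 2).prod (𝓡 ν)) (χ.cone g)) : IsCompleteInduced (𝓡 2) (i ∘ g) := by
  have hz : ∀ x, χ.cone g (x, 0) = i (g x) := fun x => by
    rw [cone_eq, nvec]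
    simp only [norm_zero, PiLp.zero_apply, zero_smul, Finset.sum_const_zero, smul_zero, add_zero,
      coshSqrt_sq, Real.cosh_zero, one_smul]
  have hle : ∀ x y, inducedEDist ((𝓡 2).prod (𝓡 ν)) (χ.cone g) (x, 0) (y, 0) ≤
      inducedEDist (𝓡 2) (i ∘ g) x y := fun x y => by
    refine le_iInf₂ fun γ hγ => ?_
    refine (iInf₂_le (fun s => (γ s, 0)) ⟨by simp [hγ.1], by simp [hγ.2.1],
      hγ.2.2.prodMk contMDiffOn_const⟩).trans (le_of_eq ?_)
    have e : χ.cone g ∘ (fun s => (γ s, 0)) = (i ∘ g) ∘ γ := funext fun s => hz (γ s)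
    rw [curveLength, curveLength, e]
  intro u hu
  obtain ⟨z, hz⟩ := h (fun k => (u k, 0)) fun ε hε => by
    obtain ⟨K, hK⟩ := hu ε hε
    exact ⟨K, fun k hk l hl => (hle _ _).trans_lt (hK k hk l hl)⟩
  exact ⟨z.1, (continuous_fst.tendsto z).comp hz⟩

omit hg in
theorem sinhc_smul_eq (z : L × EuclideanSpace ℝ (Fin ν)) (j : Fin ν) :
    sinhcSqrt (‖z.2‖ ^ 2) * z.2 j =
      ∑ l, coeffB i g C lam χ l z * lor (C l) (χ.vec j (g z.1)) := by
  have h1 : lor (χ.cone g z) (χ.vec j (g z.1)) = sinhcSqrt (‖z.2‖ ^ 2) * z.2 j := by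
    rw [cone_eq, lor_add_left, lor_smul_left, lor_smul_left, lor_nvec, lor_comm (i _),
      (χ.normal j (g z.1)).1]
    ring
  rw [← h1, cone_eq_coneOf χ hi hP hn, lor_add_left, lor_smul_left, lor_comm (i _),
    (χ.normal j (g z.1)).1, mul_zero, zero_add, lor_sum_left]
  simp only [lor_smul_left]

/-- By `edist_bounds` the base points and the functions `coeffB` along a Cauchy sequence are Cauchy.
The base points converge by completeness of the surface; the limits of `coeffB` determine those of
the fiber coordinates through `sinhc_smul_eq` and the inverse in `inv_sinhc_smul`. -/
theorem isCompleteInduced_cone (h1 : ∑ l, lam l ^ 2 ≤ 1) (h : IsCompleteInduced (𝓡 2) (i ∘ g)) :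
    IsCompleteInduced ((𝓡 2).prod (𝓡 ν)) (χ.cone g) := by
  intro u hu
  -- From `K₀` on all points are within distance one of `u K₀`, so `cosh` of the fiber norm is
  -- bounded and the later estimates share one constant.
  obtain ⟨K₀, hK₀⟩ := hu 1 one_pos
  set A := 3 * Real.cosh ‖(u K₀).2‖ with hA
  have hcosh : ∀ k ≥ K₀, Real.cosh ‖(u k).2‖ ≤ A := fun k hk =>
    (edist_bounds χ hi hg hP hn h1 le_rfl (hK₀ K₀ le_rfl k hk)).1
  have tail : ∀ ε : ℝ≥0∞, 0 < ε → ∃ K, ∀ k ≥ K, ∀ l ≥ K,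
      inducedEDist (𝓡 2) (i ∘ g) (u k).1 (u l).1 < ε ∧
      ∀ m, ENNReal.ofReal |coeffB i g C lam χ m (u l) - coeffB i g C lam χ m (u k)| < ε := by
    intro ε hε
    obtain ⟨r, hr0, hr1, hr⟩ := exists_pos_mul_lt (6 * A) hε
    obtain ⟨K, hK⟩ := hu r hr0
    refine ⟨max K K₀, fun k hk l hl => ?_⟩
    obtain ⟨-, h2, h3⟩ := edist_bounds χ hi hg hP hn h1 hr1
      (hK k (le_of_max_le_left hk) l (le_of_max_le_left hl))
    have h4 : ENNReal.ofReal (6 * Real.cosh ‖(u k).2‖) * r < ε := lt_of_le_of_lt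
      (mul_le_mul' (ENNReal.ofReal_le_ofReal (by linarith [hcosh k (le_of_max_le_right hk)])) le_rfl) hr
    exact ⟨h2.trans_lt h4, fun m => (h3 m).trans_lt h4⟩
  obtain ⟨x, hx⟩ := h (fun k => (u k).1) fun ε hε => by
    obtain ⟨K, hK⟩ := tail ε hε
    exact ⟨K, fun k hk l hl => (hK k hk l hl).1⟩
  have hB : ∀ m, ∃ β, Filter.Tendsto (fun k => coeffB i g C lam χ m (u k)) Filter.atTop (𝓝 β) := by
    intro m
    refine cauchySeq_tendsto_of_complete (EMetric.cauchySeq_iff.2 fun ε hε => ?_)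
    obtain ⟨K, hK⟩ := tail ε hε
    refine ⟨K, fun k hk l hl => ?_⟩
    rw [edist_dist, Real.dist_eq]
    exact (hK l hl k hk).2 m
  choose β hβ using hB
  set b : L × EuclideanSpace ℝ (Fin ν) → EuclideanSpace ℝ (Fin ν) :=
    fun z => sinhcSqrt (‖z.2‖ ^ 2) • z.2 with hb
  have hbt : Filter.Tendsto (fun k => b (u k)) Filter.atTop
      (𝓝 (WithLp.toLp 2 fun j => ∑ l, β l * lor (C l) (χ.vec j (g x)))) := by
    have h2 : Filter.Tendsto (fun k j => b (u k) j) Filter.atTop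
        (𝓝 fun j => ∑ l, β l * lor (C l) (χ.vec j (g x))) := by
      refine tendsto_pi_nhds.2 fun j => ?_
      have e : (fun k => b (u k) j) = fun k =>
          ∑ l, coeffB i g C lam χ l (u k) * lor (C l) (χ.vec j (g (u k).1)) :=
        funext fun k => sinhc_smul_eq χ hi hP hn (u k) j
      rw [e]
      refine tendsto_finsetSum _ fun l _ => (hβ l).mul ?_
      have hc : Continuous fun x => lor (C l) (χ.vec j (g x)) := continuous_lor.comp
        (continuous_const.prodMk ((χ.smooth j).continuous.comp hg.smooth.continuous))
      exact (hc.tendsto x).comp hx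
    exact ((PiLp.continuous_toLp 2 _).tendsto _).comp h2
  have hψ : Continuous fun v : EuclideanSpace ℝ (Fin ν) =>
      (sinhcSqrt (Real.arsinh ‖v‖ ^ 2))⁻¹ • v :=
    ((contDiff_sinhcSqrt.continuous.comp ((Real.continuous_arsinh.comp continuous_norm).pow 2)).inv₀
      fun v => (sinhcSqrt_pos (sq_nonneg _)).ne').smul continuous_id
  have h2 := (hψ.tendsto _).comp hbt
  have e : ((fun v : EuclideanSpace ℝ (Fin ν) => (sinhcSqrt (Real.arsinh ‖v‖ ^ 2))⁻¹ • v) ∘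
      fun k => b (u k)) = fun k => (u k).2 := funext fun k => inv_sinhc_smul (u k).2
  rw [e] at h2
  exact ⟨(x, _), hx.prodMk_nhds h2⟩

end ConeCompleteness

/-- The normal frame given by a parallel frame. -/
def IsParallelFrame.normalFrame {n ν k : ℕ} {N : Type*} [TopologicalSpace N]
    [ChartedSpace (EuclideanSpace ℝ (Fin k)) N] {i : N → LorentzSpace n} {c : ℝ}
    {C : Fin ν → LorentzSpace n} {lam : Fin ν → ℝ} (hP : IsParallelFrame k i C lam)
    (hi : IsUmbilicalInclusion k i c) : NormalFrame k i ν where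
  vec j q := C j - lam j • i q
  smooth j := ContDiff.comp_contMDiff (g := fun p => C j - lam j • p)
    (contDiff_const.sub (contDiff_id.const_smul (lam j))) hi.smooth
  normal := hP.normal
  orthonormal := hP.orthonormal

end HypCone

end

/-! ### The main theorem. -/

theorem mainTheorem3 (n ν : ℕ) (hν : 1 ≤ ν) (hνn : ν + 3 ≤ n) (c : ℝ) (hc : c ≠ -1)
    {N : Type*} [TopologicalSpace N] [T2Space N] [SimplyConnectedSpace N]
    [ChartedSpace (EuclideanSpace ℝ (Fin (n - ν))) N] [IsManifold (𝓡 (n - ν)) ∞ N]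
    {L : Type*} [TopologicalSpace L] [T2Space L] [Nonempty L]
    [ChartedSpace (EuclideanSpace ℝ (Fin 2)) L] [IsManifold (𝓡 2) ∞ L]
    (i : N → HypCone.LorentzSpace n) (hi : HypCone.IsUmbilicalInclusion (n - ν) i c)
    (g : L → N) (hg : HypCone.IsMinimalSurface (n - ν) i g) :
    Nonempty (HypCone.NormalFrame (n - ν) i ν) ∧
    ∀ η : HypCone.NormalFrame (n - ν) i ν,
      Function.Bijective (η.triv g) ∧
      -- the map `G` is smooth, with values in hyperbolic space, and `M` is open
      (ContMDiff ((𝓡 2).prod (𝓡 ν)) 𝓘(ℝ, HypCone.LorentzSpace n) ∞ (η.cone g) ∧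
        (∀ z, η.cone g z ∈ HypCone.hyperbolicSpace n) ∧ IsOpen (η.domain g)) ∧
      -- (i) the generalized cone is minimal with relative nullity index at least `ν`
      (∀ z ∈ η.domain g,
        HypCone.meanCurvature ((𝓡 2).prod (𝓡 ν)) (η.cone g) z = 0 ∧
        ν ≤ HypCone.relativeNullity ((𝓡 2).prod (𝓡 ν)) (η.cone g) z) ∧
      -- (ii) characterization of the case in which `G` is an immersion
      (η.domain g = Set.univ ↔
        ∃ a τ, (HypCone.IsEquidistantData a τ ∨ HypCone.IsHorosphereData a τ) ∧
          HypCone.IsTotallyGeodesicIn (𝓡 (n - ν)) i a τ) ∧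
      -- completeness in that case
      (η.domain g = Set.univ →
        (HypCone.IsCompleteInduced ((𝓡 2).prod (𝓡 ν)) (η.cone g) ↔
          HypCone.IsCompleteInduced (𝓡 2) (i ∘ g))) ∧
      -- scalar curvature along the fibers, equidistant case
      ((∃ a τ, HypCone.IsEquidistantData a τ ∧
          HypCone.IsTotallyGeodesicIn (𝓡 (n - ν)) i a τ) →
        ∀ x, Bornology.IsBounded
          (Set.range fun t => HypCone.scalAt ((𝓡 2).prod (𝓡 ν)) (η.cone g) (x, t))) ∧
      -- scalar curvature along the fibers, horosphere case
      ((∃ a τ, HypCone.IsHorosphereData a τ ∧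
          HypCone.IsTotallyGeodesicIn (𝓡 (n - ν)) i a τ) →
        ∀ x, ¬ HypCone.IsTotallyGeodesicAt (n - ν) i g x →
          ¬ Bornology.IsBounded
            (Set.range fun t => HypCone.scalAt ((𝓡 2).prod (𝓡 ν)) (η.cone g) (x, t))) := by
  have hn : ν + (n - ν) = n := by omega
  have : Nonempty N := ‹Nonempty L›.map g
  obtain ⟨C, lam, hP, hsum, hpos⟩ := hi.exists_parallelFrame (by omega : 2 ≤ n - ν) hn hc
  refine ⟨⟨hP.normalFrame hi⟩, fun η => ?_⟩
  have hdom := HypCone.domain_eq_univ_iff η hi hg hP hn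
  -- With `h = ∑ l, lam l ^ 2`, an equidistant hypersurface gives `h * (1 + τ ^ 2) = τ ^ 2` with `τ
  -- ≠ 0`, so `h < 1`; in `hho` the null vector gives `h = 1`.
  have heq : ∀ a τ, HypCone.IsEquidistantData a τ →
      HypCone.IsTotallyGeodesicIn (𝓡 (n - ν)) i a τ → ∑ l, lam l ^ 2 < 1 := fun a τ ha h => by
    have hτ : 0 < τ ^ 2 := by have := ha.2; positivity
    have h1 := HypCone.sum_sq_mul_eq hi hP (by omega) (by rw [ha.1]; positivity) h
    rw [ha.1] at h1
    nlinarith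
  have hho : ∀ a τ, HypCone.IsHorosphereData a τ →
      HypCone.IsTotallyGeodesicIn (𝓡 (n - ν)) i a τ → ∑ l, lam l ^ 2 = 1 := fun a τ ha h => by
    have h1 := HypCone.sum_sq_mul_eq hi hP (by omega) (by rw [ha.1, ha.2.2]; norm_num) h
    rw [ha.1, ha.2.2] at h1
    linarith
  refine ⟨HypCone.triv_bijective η hi hn, ⟨HypCone.contMDiff_cone η hi hg, HypCone.cone_mem η hi,
    HypCone.isOpen_domain η hi hg hP hn⟩, fun z hz =>
    ⟨HypCone.meanCurvature_cone η hi hg hP hn hz, HypCone.le_relativeNullity η hi hg hP hn hz⟩,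
    ⟨fun h => ?_, ?_⟩, fun h => ⟨HypCone.isCompleteInduced_base η hi hg,
      HypCone.isCompleteInduced_cone η hi hg hP hn (hdom.1 h)⟩, ?_, ?_⟩
  · rcases (hdom.1 h).lt_or_eq with h1 | h1
    · obtain ⟨a, τ, ha, ht⟩ := HypCone.exists_equidistant hi hP (hsum ▸ hpos) h1
      exact ⟨a, τ, Or.inl ha, ht⟩
    · obtain ⟨a, τ, ha, ht⟩ := HypCone.exists_horosphere hi hP h1
      exact ⟨a, τ, Or.inr ha, ht⟩
  · rintro ⟨a, τ, ha | ha, ht⟩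
    · exact hdom.2 (heq a τ ha ht).le
    · exact hdom.2 (hho a τ ha ht).le
  · rintro ⟨a, τ, ha, ht⟩ x
    exact HypCone.isBounded_scalAt η hi hg hP hn (heq a τ ha ht) x
  · rintro ⟨a, τ, ha, ht⟩ x hx
    exact HypCone.not_isBounded_scalAt η hi hg hP hn (hho a τ ha ht) hx
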